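/- Theorem 1.2. Fix a sign $\sigma\in\{+1,-1\}$. For $a>0$ and $u_+\in L^1(\mathbb R)\cap L^2(\mathbb R)$ (complex-valued) put $$v_1(t,x)=a+e^{i\sigma a^2\log t}\,\bigl(e^{it\partial_x^2}u_+\bigr)(x),\qquad t>0,$$ where $e^{it\partial_x^2}$ is the free Schrödinger group on $L^2(\mathbb R)$. Consider the equation $$i v_t+v_{xx}+\frac{\sigma}{t}\bigl(|v|^2-a^2\bigr)v=0. \tag{19}$$ For every $t_0>0$ there exist constants $a_0>0$ and $\varepsilon>0$ such that for all $0<a<a_0$ and all $u_+$ with $\|u_+\|_{L^1}+\|u_+\|_{L^2}<\varepsilon$ there is exactly one $v$ on $[t_0,\infty)\times\mathbb R$ (for each $t$ up to equality for almost every $x$) that satisfies all of the following: 1. $v$ solves (19) in the sense of distributions on $(t_0,\infty)\times\mathbb R$; 2. $v-v_1\in C([t_0,\infty),L^2(\mathbb R))\cap L^4([t_0,\infty),L^\infty(\mathbb R))$; 3. $\|v(t)-v_1(t)\|_{L^2}+\|v-v_1\|_{L^4((t,\infty),L^\infty)}=O(t^{-1/4})$ as $t\to\infty$. -/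

import Mathlib

open MeasureTheory Filter Topology
open scoped ENNReal FourierTransform

namespace SingularVortex

/-- The Fourier symbol of `e^{it∂ₓ²}`. With Mathlib's normalisation
`𝓕 f ξ = ∫ e^{-2πixξ} f x dx`, the operator `∂ₓ²` becomes multiplication by `-(2πξ)²`. -/
noncomputable def schrodingerSymbol (t : ℝ) (ξ : ℝ) : ℂ :=
  Complex.exp (-(Complex.I * ((t * (2 * Real.pi * ξ) ^ 2 : ℝ) : ℂ)))

theorem norm_schrodingerSymbol (t ξ : ℝ) : ‖schrodingerSymbol t ξ‖ = 1 := by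
  rw [schrodingerSymbol, ← mul_neg, ← Complex.ofReal_neg, mul_comm]
  exact Complex.norm_exp_ofReal_mul_I _

theorem continuous_schrodingerSymbol (t : ℝ) : Continuous (schrodingerSymbol t) := by
  unfold schrodingerSymbol
  fun_prop

theorem memLp_schrodingerSymbol_mul (t : ℝ) (f : Lp ℂ 2 (volume : Measure ℝ)) :
    MemLp (fun ξ => schrodingerSymbol t ξ * f ξ) 2 (volume : Measure ℝ) :=
  (Lp.memLp f).congr_norm
    ((continuous_schrodingerSymbol t).aestronglyMeasurable.mul (Lp.aestronglyMeasurable f))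
    (Eventually.of_forall fun ξ => by simp [norm_schrodingerSymbol])

/-- The free Schrödinger evolution `e^{it∂ₓ²} f` of `f ∈ L²(ℝ)`: the value at time `t` of the
solution of `i z_t + z_xx = 0`, `z(0) = f`. -/
noncomputable def freeEvolution (t : ℝ) (f : Lp ℂ 2 (volume : Measure ℝ)) :
    Lp ℂ 2 (volume : Measure ℝ) :=
  𝓕⁻ ((memLp_schrodingerSymbol_mul t (𝓕 f)).toLp)

/-- The asymptotic profile `v₁(t, x) = a + e^{σ i a² log t} (e^{it∂ₓ²} u₊)(x)`. -/
noncomputable def profile (σ a : ℝ) (u : Lp ℂ 2 (volume : Measure ℝ)) (t x : ℝ) : ℂ :=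
  a + Complex.exp (Complex.I * ((σ * a ^ 2 * Real.log t : ℝ) : ℂ)) * freeEvolution t u x

/-- The norm of `L⁴(I, L^∞(ℝ))`, the first variable of `f` being time. -/
noncomputable def normL4Linfty (I : Set ℝ) (f : ℝ → ℝ → ℂ) : ℝ≥0∞ :=
  (∫⁻ t in I, eLpNorm (f t) ∞ volume ^ (4 : ℝ)) ^ (1 / 4 : ℝ)

/-- `f ∈ C([t₀, ∞), L²(ℝ))`, where `f t` is regarded modulo equality almost everywhere. -/
def ContinuousInL2 (t₀ : ℝ) (f : ℝ → ℝ → ℂ) : Prop :=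
  (∀ t, t₀ ≤ t → MemLp (f t) 2 volume) ∧
    ∀ t, t₀ ≤ t →
      Tendsto (fun s => eLpNorm (fun x => f s x - f t x) 2 volume) (𝓝[Set.Ici t₀] t) (𝓝 0)

/-- `v` solves `i v_t + v_xx + (σ / t) (|v|² - a²) v = 0` on `(t₀, ∞) × ℝ` in the sense of
distributions: the equation is tested against all `φ ∈ C_c^∞((t₀, ∞) × ℝ)`. It is used for `v` with
`v - v₁ ∈ C([t₀, ∞), L²) ∩ L⁴([t₀, ∞), L^∞)`, where `v₁` is the profile of some `u₊ ∈ L¹ ∩ L²`, and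
`t₀ > 0`; then `v ∈ C([t₀, ∞), L²_loc)` and `|v|² v ∈ L¹_loc`, so that the integrals converge. -/
def IsDistributionalSolution (σ a t₀ : ℝ) (v : ℝ → ℝ → ℂ) : Prop :=
  ∀ φ : ℝ × ℝ → ℂ, ContDiff ℝ (⊤ : ℕ∞) φ → HasCompactSupport φ →
    tsupport φ ⊆ Set.Ioi t₀ ×ˢ Set.univ →
      ∫ t in Set.Ioi t₀, ∫ x : ℝ,
        (v t x * (-Complex.I * deriv (fun s => φ (s, x)) t
            + iteratedDeriv 2 (fun y => φ (t, y)) x)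
          + (σ / t : ℝ) * ((‖v t x‖ ^ 2 - a ^ 2 : ℝ) : ℂ) * v t x * φ (t, x)) = 0

/-- `v` is a solution on `[t₀, ∞)` which is asymptotic to the profile `v₁` of `u₊`:
`v` solves the equation, `v - v₁ ∈ C([t₀, ∞), L²) ∩ L⁴([t₀, ∞), L^∞)`, and
`‖v(t) - v₁(t)‖_{L²} + ‖v - v₁‖_{L⁴((t, ∞), L^∞)} = O(t^{-1/4})` as `t → ∞`. -/
structure IsAsymptoticSolution (σ a t₀ : ℝ) (u : Lp ℂ 2 (volume : Measure ℝ))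
    (v : ℝ → ℝ → ℂ) : Prop where
  solves : IsDistributionalSolution σ a t₀ v
  continuousInL2 : ContinuousInL2 t₀ (fun t x => v t x - profile σ a u t x)
  l4Linfty : normL4Linfty (Set.Ici t₀) (fun t x => v t x - profile σ a u t x) < ∞
  decay : ∃ C : ℝ, ∀ᶠ t in atTop,
    eLpNorm (fun x => v t x - profile σ a u t x) 2 volume
      + normL4Linfty (Set.Ioi t) (fun s x => v s x - profile σ a u s x)
        ≤ ENNReal.ofReal (C * t ^ (-(1 / 4) : ℝ))

end SingularVortex

open MeasureTheory Filter Topology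
open scoped ENNReal FourierTransform

namespace SingularVortex

/-! Write v = a + z. Then z_t = i z_xx + (iσ/t) N(z) with N(z) = (|a+z|² - a²)(a+z) = a²z + a²z̄ +
O(a|z|² + |z|³). The coefficient a²/t is not integrable in time, so the two linear terms acting on
the profile cannot simply be integrated.

The term a²z is absorbed exactly: the phase e^{iσa² log t} makes e^{it∂ₓ²}u₊ a solution of z_t = i
z_xx + iσa²z/t (`freePart_mild`). The term a²z̄ oscillates. Conjugation reverses time in the
Schrödinger group, so pulled back by the group it is τ⁻¹ e^{-2iτ∂ₓ²}ū₊ up to a unimodular factor and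
a constant. Its Duhamel integral up to time infinity converges in L², though not absolutely: a TT*
argument, with the dispersive decay |t-s|^{-1/2} and the Hardy–Littlewood–Sobolev inequality, bounds
the tail by the L^{4/3}(t,∞) norm of τ⁻¹, of order t^{-1/4} (`exists_resonant_correction`). This
fixes the decay rate and uses u₊ ∈ L¹.

What remains is solved for w = v - v₁ by Banach's fixed point theorem, with data zero at time
infinity. The quadratic and cubic terms of the profile are O(τ^{-3/2}) in L², hence integrable. The
terms involving w carry the factor τ⁻¹(a² + ‖z‖²_{L^∞}). Against the weight τ^{-1/4} the part a²/τ
integrates to 4a²t^{-1/4}: no power of t is gained, and a must be small. Unitarity controls L² and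
the retarded Strichartz estimate L¹L² → L⁴L^∞ (`lintegral_eLpNorm_top_duhamel_le`) controls the
other norm. The contraction is measured only in sup t^{1/4}‖w(t)‖_{L²}; the L⁴L^∞ bound is a
constraint that survives L² limits by lower semicontinuity (`exists_fixedPoint_of_isAdmissible`).

For uniqueness (`perturbedPath_unique`), a competitor need not be small in L⁴L^∞, but its tail is.
The same weighted estimate gives equality for large times, and a backward Grönwall argument carries
it down to t₀.

The Duhamel formula and the distributional equation are matched through Gaussian wave packets: they
are explicit smooth solutions of the free equation, orbits of the Fourier-defined group, and total
in L² (`IsMildSolution.isWeakSolution`, `IsWeakSolution.isMildSolution`). -/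

/-- The Hilbert space `L²(ℝ)`. -/
abbrev L2 : Type := Lp ℂ 2 (volume : Measure ℝ)

/-! ### The free Schrödinger group on L² -/

theorem fourier_freeEvolution (t : ℝ) (f : L2) :
    (𝓕 (freeEvolution t f) : L2) =ᵐ[volume] fun ξ => schrodingerSymbol t ξ * (𝓕 f : L2) ξ := by
  rw [freeEvolution, FourierInvPair.fourier_fourierInv_eq]
  exact MemLp.coeFn_toLp _

theorem fourier_injective : Function.Injective (fun f : L2 => (𝓕 f : L2)) :=
  (Lp.fourierTransformₗᵢ ℝ ℂ).injective

theorem schrodingerSymbol_add (s t ξ : ℝ) :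
    schrodingerSymbol (s + t) ξ = schrodingerSymbol s ξ * schrodingerSymbol t ξ := by
  rw [schrodingerSymbol, schrodingerSymbol, schrodingerSymbol, ← Complex.exp_add]
  congr 1
  push_cast
  ring

theorem schrodingerSymbol_zero (ξ : ℝ) : schrodingerSymbol 0 ξ = 1 := by
  simp [schrodingerSymbol]

theorem continuous_schrodingerSymbol_left (ξ : ℝ) :
    Continuous (fun t => schrodingerSymbol t ξ) := by
  unfold schrodingerSymbol
  fun_prop

/-- The free Schrödinger group as a group of linear isometries. -/
noncomputable def freeGroup (t : ℝ) : L2 →ₗᵢ[ℂ] L2 where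
  toFun := freeEvolution t
  map_add' f g := by
    apply fourier_injective
    simp only [FourierAdd.fourier_add]
    apply Lp.ext
    filter_upwards [fourier_freeEvolution t (f + g), fourier_freeEvolution t f,
      fourier_freeEvolution t g, Lp.coeFn_add (𝓕 f : L2) (𝓕 g),
      Lp.coeFn_add (𝓕 (freeEvolution t f) : L2) (𝓕 (freeEvolution t g))] with ξ h1 h2 h3 h4 h5
    rw [h1, h5, Pi.add_apply, h2, h3, FourierAdd.fourier_add, h4, Pi.add_apply, mul_add]
  map_smul' c f := by
    apply fourier_injective
    simp only [FourierSMul.fourier_smul, RingHom.id_apply]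
    apply Lp.ext
    filter_upwards [fourier_freeEvolution t (c • f), fourier_freeEvolution t f,
      Lp.coeFn_smul c (𝓕 f : L2), Lp.coeFn_smul c (𝓕 (freeEvolution t f) : L2)] with ξ h1 h2 h3 h4
    rw [h1, h4, Pi.smul_apply, h2, FourierSMul.fourier_smul, h3, Pi.smul_apply, smul_eq_mul,
      smul_eq_mul]
    ring
  norm_map' f := by
    rw [← Lp.norm_fourier_eq, ← Lp.norm_fourier_eq f]
    show ‖(𝓕 (freeEvolution t f) : L2)‖ = _
    rw [Lp.norm_def, Lp.norm_def]
    congr 1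
    apply eLpNorm_congr_norm_ae
    filter_upwards [fourier_freeEvolution t f] with ξ h
    rw [h, norm_mul, norm_schrodingerSymbol, one_mul]

theorem fourier_freeGroup (t : ℝ) (f : L2) :
    (𝓕 (freeGroup t f) : L2) =ᵐ[volume] fun ξ => schrodingerSymbol t ξ * (𝓕 f : L2) ξ :=
  fourier_freeEvolution t f

theorem freeGroup_add (s t : ℝ) (f : L2) : freeGroup (s + t) f = freeGroup s (freeGroup t f) := by
  apply fourier_injective
  apply Lp.ext
  filter_upwards [fourier_freeGroup (s + t) f, fourier_freeGroup t f,
    fourier_freeGroup s (freeGroup t f)] with ξ h1 h2 h3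
  rw [h1, h3, h2, schrodingerSymbol_add, mul_assoc]

theorem freeGroup_zero (f : L2) : freeGroup 0 f = f := by
  apply fourier_injective
  apply Lp.ext
  filter_upwards [fourier_freeGroup 0 f] with ξ h1
  rw [h1, schrodingerSymbol_zero, one_mul]

theorem freeGroup_neg_apply_self (t : ℝ) (f : L2) : freeGroup (-t) (freeGroup t f) = f := by
  rw [← freeGroup_add, neg_add_cancel, freeGroup_zero]

theorem freeGroup_apply_neg_self (t : ℝ) (f : L2) : freeGroup t (freeGroup (-t) f) = f := by
  rw [← freeGroup_add, add_neg_cancel, freeGroup_zero]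

theorem inner_freeGroup_neg (t : ℝ) (f g : L2) :
    inner ℂ g (freeGroup (-t) f) = inner ℂ (freeGroup t g) f := by
  rw [← (freeGroup t).inner_map_map g, freeGroup_apply_neg_self]

theorem inner_freeGroup (t : ℝ) (f g : L2) :
    inner ℂ g (freeGroup t f)
      = ∫ ξ, schrodingerSymbol t ξ * inner ℂ ((𝓕 g : L2) ξ) ((𝓕 f : L2) ξ) := by
  rw [← Lp.inner_fourier_eq, L2.inner_def]
  apply integral_congr_ae
  filter_upwards [fourier_freeGroup t f] with ξ h
  rw [h, ← smul_eq_mul, inner_smul_right]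

theorem continuous_inner_freeGroup (f g : L2) :
    Continuous (fun t => inner ℂ g (freeGroup t f)) := by
  simp_rw [inner_freeGroup]
  refine continuous_of_dominated (bound := fun ξ => ‖inner ℂ ((𝓕 g : L2) ξ) ((𝓕 f : L2) ξ)‖)
    (fun t => ?_) (fun t => ?_) (L2.integrable_inner _ _).norm ?_
  · exact (continuous_schrodingerSymbol t).aestronglyMeasurable.mul
      (L2.integrable_inner (𝕜 := ℂ) (𝓕 g : L2) (𝓕 f : L2)).aestronglyMeasurable
  · exact Eventually.of_forall fun ξ => by rw [norm_mul, norm_schrodingerSymbol, one_mul]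
  · exact Eventually.of_forall fun ξ => (continuous_schrodingerSymbol_left ξ).mul continuous_const

/-- Weak continuity upgrades to strong continuity because the norm is conserved: the squared
distance between the orbit at times s and t is 2‖f‖² minus twice the real part of an inner product
that tends to ‖f‖². -/
theorem continuous_freeGroup_left (f : L2) : Continuous (fun t => freeGroup t f) := by
  rw [continuous_iff_continuousAt]
  intro t
  rw [ContinuousAt, tendsto_iff_norm_sub_tendsto_zero]
  have h2 : Tendsto (fun s => ‖freeGroup s f - freeGroup t f‖ ^ 2) (𝓝 t) (𝓝 0) := by
    have : ∀ s, ‖freeGroup s f - freeGroup t f‖ ^ 2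
        = 2 * ‖f‖ ^ 2 - 2 * RCLike.re (inner ℂ (freeGroup t f) (freeGroup s f)) := by
      intro s
      rw [norm_sub_sq (𝕜 := ℂ), LinearIsometry.norm_map, LinearIsometry.norm_map,
        ← inner_re_symm]
      ring
    simp_rw [this]
    have h3 := ((continuous_inner_freeGroup f (freeGroup t f)).tendsto t)
    have h4 := (RCLike.continuous_re.tendsto _).comp h3
    have h5 := (h4.const_mul 2).const_sub (2 * ‖f‖ ^ 2)
    have h6 : (0 : ℝ) = 2 * ‖f‖ ^ 2
        - 2 * RCLike.re (inner ℂ (freeGroup t f) (freeGroup t f)) := by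
      rw [inner_self_eq_norm_sq, LinearIsometry.norm_map]
      ring
    rw [h6]
    exact h5
  have := (Real.continuous_sqrt.tendsto 0).comp h2
  simpa [Function.comp_def, Real.sqrt_sq] using this

/-- The maps are isometries, hence equicontinuous, so separate continuity gives joint continuity. -/
theorem continuous_freeGroup : Continuous (fun p : ℝ × L2 => freeGroup p.1 p.2) := by
  rw [continuous_iff_continuousAt]
  rintro ⟨t, f⟩
  rw [ContinuousAt, tendsto_iff_norm_sub_tendsto_zero]
  have h1 : Tendsto (fun p : ℝ × L2 => ‖p.2 - f‖ + ‖freeGroup p.1 f - freeGroup t f‖)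
      (𝓝 (t, f)) (𝓝 0) := by
    have : Continuous (fun p : ℝ × L2 => ‖p.2 - f‖ + ‖freeGroup p.1 f - freeGroup t f‖) := by
      have := (continuous_freeGroup_left f).comp (continuous_fst (X := ℝ) (Y := L2))
      exact (continuous_snd.sub continuous_const).norm.add (this.sub continuous_const).norm
    simpa using this.tendsto (t, f)
  refine squeeze_zero (fun _ => norm_nonneg _) (fun p => ?_) h1
  rw [← (freeGroup p.1).norm_map (p.2 - f), map_sub]
  exact norm_sub_le_norm_sub_add_norm_sub _ _ _

theorem _root_.Continuous.freeGroup {X : Type*} [TopologicalSpace X] {τ : X → ℝ} {f : X → L2}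
    (hτ : Continuous τ) (hf : Continuous f) :
    Continuous (fun x => SingularVortex.freeGroup (τ x) (f x)) := by
  have h := continuous_freeGroup.comp (hτ.prodMk hf)
  rwa [Function.comp_def] at h

theorem aestronglyMeasurable_freeGroup {X : Type*} [MeasurableSpace X] {μ : Measure X}
    {τ : X → ℝ} {f : X → L2} (hτ : AEStronglyMeasurable τ μ) (hf : AEStronglyMeasurable f μ) :
    AEStronglyMeasurable (fun x => freeGroup (τ x) (f x)) μ := by
  have h := continuous_freeGroup.comp_aestronglyMeasurable (hτ.prodMk hf)
  exact h

/-! ### The Fourier transform on L¹ ∩ L² and the dispersive estimate -/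

theorem integral_fourier_mul_eq {f g : ℝ → ℂ} (hf : Integrable f) (hg : Integrable g) :
    ∫ ξ, 𝓕 f ξ * g ξ = ∫ x, f x * 𝓕 g x := by
  simpa using! VectorFourier.integral_fourierIntegral_smul_eq_flip (L := innerₗ ℝ)
    Real.continuous_fourierChar continuous_inner hf hg

/-- The Plancherel extension agrees with the distributional transform. Paired with a smooth
compactly supported function, the latter is computed by the multiplication formula ∫ f̂ g = ∫ f ĝ,
which is also satisfied by the integral transform. -/
theorem fourier_ae_eq_of_integrable (f : L2) (hf : Integrable f) :
    (𝓕 f : L2) =ᵐ[volume] 𝓕 (f : ℝ → ℂ) := by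
  have hcont : Continuous (𝓕 (f : ℝ → ℂ)) :=
    VectorFourier.fourierIntegral_continuous Real.continuous_fourierChar continuous_inner hf
  refine ae_eq_of_integral_contDiff_smul_eq ((Lp.memLp _).locallyIntegrable one_le_two)
    hcont.locallyIntegrable fun g hg hgc => ?_
  have hg₁ : HasCompactSupport (Complex.ofRealCLM ∘ g) := hgc.comp_left rfl
  have hg₂ : ContDiff ℝ (⊤ : ℕ∞) (Complex.ofRealCLM ∘ g) := by fun_prop
  set φ := hg₁.toSchwartzMap hg₂ with hφ
  have key := congrArg (fun T => T φ) (Lp.fourier_toTemperedDistribution_eq f)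
  simp only [TemperedDistribution.fourier_apply, Lp.toTemperedDistribution_apply] at key
  calc ∫ x, g x • (𝓕 f : L2) x = ∫ x, φ x • (𝓕 f : L2) x := by simp [hφ]
    _ = ∫ x, (𝓕 φ) x • f x := key.symm
    _ = ∫ x, 𝓕 (φ : ℝ → ℂ) x * f x := by simp [SchwartzMap.fourier_coe]
    _ = ∫ x, φ x * 𝓕 (f : ℝ → ℂ) x := integral_fourier_mul_eq φ.integrable hf
    _ = ∫ x, g x • 𝓕 (f : ℝ → ℂ) x := by simp [hφ]

/-- The transform is again a complex Gaussian, with amplitude b^{-1/2} and width b⁻¹, translated by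
y. Since Re b⁻¹ = Re b/|b|² > 0, its exponential has modulus at most 1. -/
theorem norm_fourier_gaussian_le {b : ℂ} (hb : 0 < b.re) (y x : ℝ) :
    ‖𝓕 (fun ξ : ℝ => Complex.exp (-Real.pi * b * ξ ^ 2 + 2 * Real.pi * (Complex.I * y) * ξ)) x‖
      ≤ ‖b‖ ^ (-(1 / 2) : ℝ) := by
  have hb0 : b ≠ 0 := by rintro rfl; simp at hb
  rw [fourier_gaussian_pi' hb, norm_mul, Complex.norm_exp, norm_div, norm_one,
    Real.rpow_neg (norm_nonneg _)]
  have h1 : ‖b ^ (1 / 2 : ℂ)‖ = ‖b‖ ^ (1 / 2 : ℝ) := by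
    have := Complex.norm_cpow_real b (1 / 2)
    simpa using this
  rw [h1, one_div]
  apply mul_le_of_le_one_right (by positivity)
  rw [Real.exp_le_one_iff]
  have h2 : -(Real.pi : ℂ) / b * (x + Complex.I * (Complex.I * y)) ^ 2
      = ((-(Real.pi * (x - y) ^ 2) : ℝ) : ℂ) * b⁻¹ := by
    have : (x + Complex.I * (Complex.I * y) : ℂ) = x - y := by
      rw [← mul_assoc, Complex.I_mul_I]; ring
    rw [this]; push_cast; ring
  rw [h2, Complex.re_ofReal_mul, Complex.inv_re]
  have : 0 ≤ Real.pi * (x - y) ^ 2 * (b.re / Complex.normSq b) := by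
    have := Complex.normSq_nonneg b
    positivity
  linarith

theorem continuous_fourier_of_integrable {f : ℝ → ℂ} (hf : Integrable f) : Continuous (𝓕 f) :=
  VectorFourier.fourierIntegral_continuous Real.continuous_fourierChar continuous_inner hf

theorem norm_fourier_le {f : ℝ → ℂ} (x : ℝ) : ‖𝓕 f x‖ ≤ ∫ y, ‖f y‖ :=
  VectorFourier.norm_fourierIntegral_le_integral_norm _ _ _ _ _

theorem integrable_gaussian {b : ℂ} (hb : 0 < b.re) (c : ℂ) :
    Integrable (fun ξ : ℝ => Complex.exp (-Real.pi * b * ξ ^ 2 + 2 * Real.pi * c * ξ)) := by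
  have := integrable_cexp_quadratic (b := Real.pi * b)
    (by simpa using mul_pos Real.pi_pos hb) (2 * Real.pi * c) 0
  simpa using this

/-- Moving the transform off g leaves ∫ ḡ · 𝓕⁻(Gaussian · f̂). The multiplication formula writes
that inverse transform as an integral of f against a kernel bounded by |b|^{-1/2}, whence the L¹–L¹
bound. -/
theorem norm_integral_gaussian_mul_fourier_le {b : ℂ} (hb : 0 < b.re) {f g : ℝ → ℂ}
    (hf : Integrable f) (hg : Integrable g) :
    ‖∫ ξ : ℝ, Complex.exp (-Real.pi * b * ξ ^ 2) * ((starRingEnd ℂ) (𝓕 g ξ) * 𝓕 f ξ)‖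
      ≤ ‖b‖ ^ (-(1 / 2) : ℝ) * (∫ x, ‖f x‖) * ∫ y, ‖g y‖ := by
  set E : ℝ → ℂ := fun ξ => Complex.exp (-Real.pi * b * ξ ^ 2) with hE
  have hEi : Integrable E := by simpa [hE] using integrable_gaussian hb 0
  set h : ℝ → ℂ := fun ξ => E ξ * 𝓕 f ξ with hh
  have hhi : Integrable h := by
    refine hEi.mul_bdd (c := ∫ y, ‖f y‖) (continuous_fourier_of_integrable hf).aestronglyMeasurable
      (Eventually.of_forall fun x => norm_fourier_le x)
  have hinv : ∀ y : ℝ, ‖𝓕⁻ h y‖ ≤ ‖b‖ ^ (-(1 / 2) : ℝ) * ∫ x, ‖f x‖ := by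
    intro y
    have e1 : 𝓕⁻ h y = ∫ ξ, 𝓕 f ξ *
        Complex.exp (-Real.pi * b * ξ ^ 2 + 2 * Real.pi * (Complex.I * y) * ξ) := by
      rw [Real.fourierInv_eq']
      congr 1
      ext ξ
      rw [smul_eq_mul, hh]
      simp only [hE]
      rw [Complex.exp_add]
      have : ((2 * Real.pi * inner ℝ ξ y : ℝ) : ℂ) * Complex.I
          = 2 * Real.pi * (Complex.I * y) * ξ := by
        simp
        ring
      rw [this]
      ring
    rw [e1, integral_fourier_mul_eq hf (integrable_gaussian hb _), ← integral_const_mul]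
    refine (norm_integral_le_of_norm_le (hf.norm.const_mul _) (Eventually.of_forall fun x => ?_))
    rw [norm_mul, mul_comm]
    exact mul_le_mul_of_nonneg_right (norm_fourier_gaussian_le hb y x) (norm_nonneg _)
  have hgc : Integrable (fun y => (starRingEnd ℂ) (g y)) :=
    (LinearIsometryEquiv.integrable_comp_iff Complex.conjLIE).2 hg
  have e2 : ∫ ξ, E ξ * ((starRingEnd ℂ) (𝓕 g ξ) * 𝓕 f ξ)
      = ∫ y, (starRingEnd ℂ) (g y) * 𝓕⁻ h y := by
    have e3 : ∀ ξ, E ξ * ((starRingEnd ℂ) (𝓕 g ξ) * 𝓕 f ξ)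
        = 𝓕 (fun y => (starRingEnd ℂ) (g y)) (-ξ) * h (-(-ξ)) := by
      intro ξ
      have : (starRingEnd ℂ) (𝓕 g ξ) = 𝓕 (fun y => (starRingEnd ℂ) (g y)) (-ξ) := by
        rw [Real.fourier_real_eq_integral_exp_smul, Real.fourier_real_eq_integral_exp_smul,
          ← integral_conj]
        congr 1
        ext y
        rw [smul_eq_mul, smul_eq_mul, map_mul, ← Complex.exp_conj, map_mul,
          Complex.conj_ofReal, Complex.conj_I]
        congr 2
        push_cast
        ring
      rw [this, neg_neg, hh]
      ring
    simp_rw [e3]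
    rw [integral_neg_eq_self (fun ξ => 𝓕 (fun y => (starRingEnd ℂ) (g y)) ξ * h (-ξ)),
      integral_fourier_mul_eq hgc hhi.comp_neg, Real.fourierInv_eq_fourier_comp_neg]
  rw [e2, ← integral_const_mul]
  refine (norm_integral_le_of_norm_le (hg.norm.const_mul _) (Eventually.of_forall fun x => ?_))
  rw [norm_mul, RCLike.norm_conj, mul_comm]
  exact mul_le_mul_of_nonneg_right (hinv x) (norm_nonneg _)

/-- The dispersive estimate, in dual form. -/
theorem norm_inner_freeGroup_le {t : ℝ} (ht : t ≠ 0) (f g : L2) (hf : Integrable f)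
    (hg : Integrable g) :
    ‖inner ℂ g (freeGroup t f)‖ ≤ |t| ^ (-(1 / 2) : ℝ) * (∫ x, ‖f x‖) * ∫ y, ‖g y‖ := by
  have hint : Integrable (fun ξ => (starRingEnd ℂ) (𝓕 (g : ℝ → ℂ) ξ) * 𝓕 (f : ℝ → ℂ) ξ) := by
    refine (L2.integrable_inner (𝕜 := ℂ) (𝓕 g : L2) (𝓕 f : L2)).congr ?_
    filter_upwards [fourier_ae_eq_of_integrable f hf, fourier_ae_eq_of_integrable g hg] with ξ h1 h2
    rw [h1, h2, RCLike.inner_apply, mul_comm]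
  have e1 : inner ℂ g (freeGroup t f) = ∫ ξ, schrodingerSymbol t ξ *
      ((starRingEnd ℂ) (𝓕 (g : ℝ → ℂ) ξ) * 𝓕 (f : ℝ → ℂ) ξ) := by
    rw [inner_freeGroup]
    apply integral_congr_ae
    filter_upwards [fourier_ae_eq_of_integrable f hf, fourier_ae_eq_of_integrable g hg] with ξ h1 h2
    rw [h1, h2, RCLike.inner_apply, mul_comm (𝓕 (f : ℝ → ℂ) ξ)]
  -- The symbol e^{-4π²itξ²} is e^{-πbξ²} with b = 4πit, on the boundary of the half-plane Re b > 0.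
  -- The shift by δ > 0 makes the Gaussian integrable, and dominated convergence removes it.
  set b : ℝ → ℂ := fun δ => δ + 4 * Real.pi * t * Complex.I with hb
  have hre : ∀ δ, (b δ).re = δ := by intro δ; simp [hb]
  have him : ∀ δ, (b δ).im = 4 * Real.pi * t := by intro δ; simp [hb]
  have hsplit : ∀ δ ξ : ℝ, Complex.exp (-Real.pi * b δ * ξ ^ 2)
      = Complex.exp ((-(Real.pi * δ * ξ ^ 2) : ℝ)) * schrodingerSymbol t ξ := by
    intro δ ξ
    rw [schrodingerSymbol, ← Complex.exp_add]
    congr 1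
    simp only [hb]
    push_cast
    ring
  have hlim : Tendsto (fun δ : ℝ => ∫ ξ : ℝ, Complex.exp (-Real.pi * b δ * ξ ^ 2) *
      ((starRingEnd ℂ) (𝓕 (g : ℝ → ℂ) ξ) * 𝓕 (f : ℝ → ℂ) ξ)) (𝓝[>] 0)
      (𝓝 (inner ℂ g (freeGroup t f))) := by
    rw [e1]
    refine tendsto_integral_filter_of_dominated_convergence _ ?_ ?_ hint.norm ?_
    · refine Eventually.of_forall fun δ => ?_
      refine AEStronglyMeasurable.mul (Continuous.aestronglyMeasurable (by fun_prop))
        hint.aestronglyMeasurable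
    · filter_upwards [self_mem_nhdsWithin] with δ hδ
      refine Eventually.of_forall fun ξ => ?_
      rw [norm_mul, hsplit, norm_mul, norm_schrodingerSymbol, mul_one, Complex.norm_exp,
        Complex.ofReal_re]
      refine mul_le_of_le_one_left (norm_nonneg _) ?_
      rw [Real.exp_le_one_iff]
      have : 0 < δ := hδ
      have := Real.pi_pos
      have : 0 ≤ Real.pi * δ * ξ ^ 2 := by positivity
      linarith
    · refine Eventually.of_forall fun ξ => ?_
      refine Tendsto.mul_const _ ?_
      have hc : Continuous (fun δ : ℝ => Complex.exp (-Real.pi * b δ * ξ ^ 2)) := by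
        simp only [hb]; fun_prop
      have := (hc.tendsto 0).mono_left (nhdsWithin_le_nhds (s := Set.Ioi 0))
      rw [hsplit 0 ξ] at this
      simpa using this
  refine le_of_tendsto hlim.norm ?_
  filter_upwards [self_mem_nhdsWithin] with δ hδ
  have hδ' : 0 < (b δ).re := by rw [hre]; exact hδ
  refine (norm_integral_gaussian_mul_fourier_le hδ' hf hg).trans ?_
  -- The sharp constant (4π)^{-1/2} is given up here.
  have h1 : |t| ≤ ‖b δ‖ := by
    refine le_trans ?_ (Complex.abs_im_le_norm _)
    have := Real.pi_gt_three
    rw [him, abs_mul, abs_of_pos (show 0 < 4 * Real.pi by positivity)]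
    nlinarith [abs_nonneg t]
  have h2 : ‖b δ‖ ^ (-(1 / 2) : ℝ) ≤ |t| ^ (-(1 / 2) : ℝ) :=
    Real.rpow_le_rpow_of_nonpos (abs_pos.2 ht) h1 (by norm_num)
  have : 0 ≤ ∫ x, ‖f x‖ := integral_nonneg fun _ => norm_nonneg _
  have : 0 ≤ ∫ x, ‖g x‖ := integral_nonneg fun _ => norm_nonneg _
  gcongr

/-! ### The Hardy–Littlewood–Sobolev inequality in time -/

theorem lintegral_comp_abs {F : ℝ → ℝ≥0∞} (hF : Measurable F) :
    ∫⁻ x, F |x| = 2 * ∫⁻ x in Set.Ioi (0 : ℝ), F x := by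
  have hm : Measurable (fun x : ℝ => F |x|) := hF.comp measurable_norm
  rw [← lintegral_add_compl _ (measurableSet_Ioi (a := (0 : ℝ))), two_mul]
  congr 1
  · exact setLIntegral_congr_fun measurableSet_Ioi fun x hx => by rw [abs_of_pos hx]
  · rw [Set.compl_Ioi, setLIntegral_congr (Iio_ae_eq_Iic (a := (0 : ℝ)) (μ := volume)).symm]
    have h := (Measure.measurePreserving_neg (volume : Measure ℝ)).setLIntegral_comp_preimage
      (measurableSet_Ioi (a := (0 : ℝ))) hF
    rw [← h]
    have : (Neg.neg ⁻¹' Set.Ioi 0 : Set ℝ) = Set.Iio 0 := by ext; simp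
    rw [this]
    exact setLIntegral_congr_fun measurableSet_Iio fun x hx => by rw [abs_of_neg hx]

/-- The kernel `|t|^{-1/2}` of the dispersive estimate. -/
noncomputable def dispersiveKernel (t : ℝ) : ℝ≥0∞ := ENNReal.ofReal (|t| ^ (-(1 / 2) : ℝ))

theorem measurable_dispersiveKernel : Measurable dispersiveKernel := by
  unfold dispersiveKernel
  fun_prop

theorem dispersiveKernel_neg (t : ℝ) : dispersiveKernel (-t) = dispersiveKernel t := by
  rw [dispersiveKernel, dispersiveKernel, abs_neg]

theorem lintegral_dispersiveKernel_near {r : ℝ} (hr : 0 < r) :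
    ∫⁻ x, Set.indicator {x | |x| ≤ r} dispersiveKernel x = ENNReal.ofReal (4 * r ^ (1 / 2 : ℝ)) := by
  have h1 : ∀ x, Set.indicator {x | |x| ≤ r} dispersiveKernel x
      = (fun y => Set.indicator (Set.Iic r) (fun y => ENNReal.ofReal (y ^ (-(1 / 2) : ℝ))) y) |x| := by
    intro x
    simp only [Set.indicator, Set.mem_ofPred_eq, Set.mem_Iic, dispersiveKernel]
  simp_rw [h1]
  rw [lintegral_comp_abs ((by fun_prop : Measurable fun y : ℝ =>
    ENNReal.ofReal (y ^ (-(1 / 2) : ℝ))).indicator measurableSet_Iic),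
    lintegral_indicator measurableSet_Iic, Measure.restrict_restrict measurableSet_Iic]
  have h2 : Set.Iic r ∩ Set.Ioi 0 = Set.Ioc 0 r := by ext; simp [and_comm]
  rw [h2, ← ofReal_integral_eq_lintegral_ofReal, ← intervalIntegral.integral_of_le hr.le,
    integral_rpow (Or.inl (by norm_num)), ← ENNReal.ofReal_ofNat, ← ENNReal.ofReal_mul (by norm_num)]
  · congr 1
    rw [Real.zero_rpow (by norm_num)]
    norm_num
    ring
  · have := intervalIntegral.intervalIntegrable_rpow' (a := 0) (b := r)
      (r := (-(1 / 2) : ℝ)) (by norm_num)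
    exact (intervalIntegrable_iff_integrableOn_Ioc_of_le hr.le).1 this
  · filter_upwards [ae_restrict_mem measurableSet_Ioc] with x hx
    exact Real.rpow_nonneg hx.1.le _

theorem lintegral_dispersiveKernel_far {r : ℝ} (hr : 0 < r) :
    ∫⁻ x, (Set.indicator {x | r < |x|} dispersiveKernel x) ^ (4 : ℝ) = ENNReal.ofReal (2 / r) := by
  have h1 : ∀ x, (Set.indicator {x | r < |x|} dispersiveKernel x) ^ (4 : ℝ)
      = (fun y => Set.indicator (Set.Ioi r) (fun y => ENNReal.ofReal (y ^ (-2 : ℝ))) y) |x| := by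
    intro x
    simp only [Set.indicator, Set.mem_ofPred_eq, Set.mem_Ioi, dispersiveKernel]
    split_ifs with h
    · rw [ENNReal.ofReal_rpow_of_nonneg (by positivity) (by norm_num),
        ← Real.rpow_mul (abs_nonneg _)]
      norm_num
    · simp
  simp_rw [h1]
  rw [lintegral_comp_abs ((by fun_prop : Measurable fun y : ℝ =>
    ENNReal.ofReal (y ^ (-2 : ℝ))).indicator measurableSet_Ioi),
    lintegral_indicator measurableSet_Ioi, Measure.restrict_restrict measurableSet_Ioi]
  have h2 : Set.Ioi r ∩ Set.Ioi 0 = Set.Ioi r := by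
    ext x; simp only [Set.mem_inter_iff, Set.mem_Ioi, and_iff_left_iff_imp]; exact hr.trans
  rw [h2, ← ofReal_integral_eq_lintegral_ofReal (integrableOn_Ioi_rpow_of_lt (by norm_num) hr),
    integral_Ioi_rpow_of_lt (by norm_num) hr, ← ENNReal.ofReal_ofNat,
    ← ENNReal.ofReal_mul (by norm_num)]
  · congr 1
    norm_num [Real.rpow_neg_one]
    rfl
  · filter_upwards [ae_restrict_mem measurableSet_Ioi] with x hx
    exact Real.rpow_nonneg (hr.trans hx).le _

/-- At distance at most r the kernel is integrable and α is bounded by b. Farther away the kernel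
lies in L⁴ and is paired with α ∈ L^{4/3} by Hölder. The radius r stays free to be optimised. -/
theorem lintegral_dispersiveKernel_mul_le_of_le {α : ℝ → ℝ≥0∞} (hα : Measurable α) (t : ℝ)
    {b M r : ℝ} (hb : 0 < b) (hr : 0 < r) (hM : 0 < M)
    (hMα : ∫⁻ s, α s ^ (4 / 3 : ℝ) = ENNReal.ofReal M) :
    ∫⁻ s in {s | α s ≤ ENNReal.ofReal b}, dispersiveKernel (t - s) * α s
      ≤ ENNReal.ofReal (4 * r ^ (1 / 2 : ℝ) * b + (2 / r) ^ (1 / 4 : ℝ) * M ^ (3 / 4 : ℝ)) := by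
  set near := Set.indicator {x : ℝ | |x| ≤ r} dispersiveKernel with hnear
  set far := Set.indicator {x : ℝ | r < |x|} dispersiveKernel with hfar
  have mnear : Measurable near :=
    measurable_dispersiveKernel.indicator (measurableSet_le measurable_norm measurable_const)
  have mfar : Measurable far :=
    measurable_dispersiveKernel.indicator (measurableSet_lt measurable_const measurable_norm)
  have mS : MeasurableSet {s | α s ≤ ENNReal.ofReal b} := measurableSet_le hα measurable_const
  calc ∫⁻ s in {s | α s ≤ ENNReal.ofReal b}, dispersiveKernel (t - s) * α s
      ≤ ∫⁻ s in {s | α s ≤ ENNReal.ofReal b},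
          (near (t - s) * ENNReal.ofReal b + far (t - s) * α s) := by
        refine setLIntegral_mono' mS fun s hs => ?_
        by_cases h : |t - s| ≤ r
        · have h1 : near (t - s) = dispersiveKernel (t - s) := Set.indicator_of_mem (by exact h) _
          rw [h1]
          exact (mul_le_mul_right hs _).trans le_self_add
        · have h1 : far (t - s) = dispersiveKernel (t - s) :=
            Set.indicator_of_mem (by exact not_le.1 h) _
          rw [h1]
          exact le_add_self
    _ ≤ ∫⁻ s, (near (t - s) * ENNReal.ofReal b + far (t - s) * α s) :=
        setLIntegral_le_lintegral _ _
    _ = (∫⁻ s, near (t - s)) * ENNReal.ofReal b + ∫⁻ s, far (t - s) * α s := by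
        have mnear' : Measurable fun s => near (t - s) := mnear.comp (by fun_prop)
        rw [lintegral_add_left (mnear'.mul_const _), lintegral_mul_const _ mnear']
    _ ≤ ENNReal.ofReal (4 * r ^ (1 / 2 : ℝ)) * ENNReal.ofReal b
          + ENNReal.ofReal (2 / r) ^ (1 / 4 : ℝ) * ENNReal.ofReal M ^ (3 / 4 : ℝ) := by
        gcongr
        · rw [lintegral_sub_left_eq_self (fun x => near x) t, hnear,
            lintegral_dispersiveKernel_near hr]
        · have hH := ENNReal.lintegral_mul_le_Lp_mul_Lq volume
            (p := 4) (q := 4 / 3) (Real.holderConjugate_iff.2 (by norm_num))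
            (f := fun s => far (t - s)) (g := α) (mfar.comp (by fun_prop)).aemeasurable
            hα.aemeasurable
          rw [lintegral_sub_left_eq_self (fun x => far x ^ (4 : ℝ)) t, hfar,
            lintegral_dispersiveKernel_far hr, hMα] at hH
          refine hH.trans_eq ?_
          norm_num
    _ = _ := by
        rw [ENNReal.ofReal_rpow_of_nonneg (by positivity) (by norm_num),
          ENNReal.ofReal_rpow_of_nonneg (by positivity) (by norm_num),
          ← ENNReal.ofReal_mul (by positivity), ← ENNReal.ofReal_mul (by positivity),
          ← ENNReal.ofReal_add (by positivity) (by positivity)]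

theorem mul_lintegral_dispersiveKernel_le {α : ℝ → ℝ≥0∞} (hα : Measurable α) (t : ℝ)
    {M : ℝ} (hM : 0 < M) (hMα : ∫⁻ s, α s ^ (4 / 3 : ℝ) = ENNReal.ofReal M) (ht : α t ≠ ∞) :
    α t * ∫⁻ s in {s | α s ≤ α t}, dispersiveKernel (t - s) * α s
      ≤ ENNReal.ofReal (6 * M ^ (1 / 2 : ℝ)) * α t ^ (4 / 3 : ℝ) := by
  rcases eq_or_ne (α t) 0 with h0 | h0
  · rw [h0, zero_mul]; exact zero_le
  set b := (α t).toReal with hb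
  have hbpos : 0 < b := ENNReal.toReal_pos h0 ht
  have hαb : α t = ENNReal.ofReal b := (ENNReal.ofReal_toReal ht).symm
  -- This radius balances r^{1/2}b against r^{-1/4}M^{3/4}: both equal M^{1/2}b^{1/3}.
  set r : ℝ := M * b ^ (-(4 / 3) : ℝ) with hr
  have hrpos : 0 < r := by positivity
  have h := lintegral_dispersiveKernel_mul_le_of_le hα t hbpos hrpos hM hMα
  rw [hαb]
  refine (mul_le_mul_right h _).trans ?_
  rw [← ENNReal.ofReal_mul hbpos.le, ENNReal.ofReal_rpow_of_pos hbpos,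
    ← ENNReal.ofReal_mul (by positivity)]
  apply ENNReal.ofReal_le_ofReal
  have e1 : r ^ (1 / 2 : ℝ) = M ^ (1 / 2 : ℝ) * b ^ (-(2 / 3) : ℝ) := by
    rw [hr, Real.mul_rpow hM.le (by positivity), ← Real.rpow_mul hbpos.le]
    norm_num
  have e2 : (2 / r) ^ (1 / 4 : ℝ)
      = 2 ^ (1 / 4 : ℝ) * (M ^ (-(1 / 4) : ℝ) * b ^ (1 / 3 : ℝ)) := by
    rw [div_eq_mul_inv, Real.mul_rpow (by norm_num) (by positivity), hr, mul_inv,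
      Real.mul_rpow (by positivity) (by positivity), ← Real.rpow_neg hbpos.le,
      ← Real.rpow_mul hbpos.le, ← Real.rpow_neg_one, ← Real.rpow_mul hM.le]
    norm_num
  have e3 : (2 : ℝ) ^ (1 / 4 : ℝ) ≤ 2 := by
    calc (2 : ℝ) ^ (1 / 4 : ℝ) ≤ 2 ^ (1 : ℝ) :=
          Real.rpow_le_rpow_of_exponent_le (by norm_num) (by norm_num)
      _ = 2 := Real.rpow_one 2
  have e4 : M ^ (-(1 / 4) : ℝ) * M ^ (3 / 4 : ℝ) = M ^ (1 / 2 : ℝ) := by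
    rw [← Real.rpow_add hM]; norm_num
  have e5 : b * (b ^ (-(2 / 3) : ℝ) * b) = b ^ (4 / 3 : ℝ) := by
    have : b * (b ^ (-(2 / 3) : ℝ) * b) = b ^ (1 : ℝ) * (b ^ (-(2 / 3) : ℝ) * b ^ (1 : ℝ)) := by
      rw [Real.rpow_one]
    rw [this, ← Real.rpow_add hbpos, ← Real.rpow_add hbpos]; norm_num
  have e6 : b * b ^ (1 / 3 : ℝ) = b ^ (4 / 3 : ℝ) := by
    have : b * b ^ (1 / 3 : ℝ) = b ^ (1 : ℝ) * b ^ (1 / 3 : ℝ) := by rw [Real.rpow_one]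
    rw [this, ← Real.rpow_add hbpos]; norm_num
  rw [e1, e2]
  calc b * (4 * (M ^ (1 / 2 : ℝ) * b ^ (-(2 / 3) : ℝ)) * b
        + 2 ^ (1 / 4 : ℝ) * (M ^ (-(1 / 4) : ℝ) * b ^ (1 / 3 : ℝ)) * M ^ (3 / 4 : ℝ))
      = 4 * M ^ (1 / 2 : ℝ) * (b * (b ^ (-(2 / 3) : ℝ) * b))
        + 2 ^ (1 / 4 : ℝ) * ((M ^ (-(1 / 4) : ℝ) * M ^ (3 / 4 : ℝ)) * (b * b ^ (1 / 3 : ℝ))) := by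
        ring
    _ ≤ 4 * M ^ (1 / 2 : ℝ) * b ^ (4 / 3 : ℝ) + 2 * (M ^ (1 / 2 : ℝ) * b ^ (4 / 3 : ℝ)) := by
        rw [e4, e5, e6]
        gcongr
    _ = 6 * M ^ (1 / 2 : ℝ) * b ^ (4 / 3 : ℝ) := by ring

/-- The Hardy–Littlewood–Sobolev inequality for the kernel `|t|^{-1/2}` on `L^{4/3}(ℝ)`. -/
theorem lintegral_lintegral_dispersiveKernel_le {α : ℝ → ℝ≥0∞} (hα : Measurable α) :
    ∫⁻ t, ∫⁻ s, dispersiveKernel (t - s) * α s * α t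
      ≤ 12 * (∫⁻ s, α s ^ (4 / 3 : ℝ)) ^ (3 / 2 : ℝ) := by
  rcases eq_or_ne (∫⁻ s, α s ^ (4 / 3 : ℝ)) ∞ with htop | htop
  · rw [htop, ENNReal.top_rpow_of_pos (by norm_num), ENNReal.mul_top (by norm_num)]
    exact le_top
  have hαtop : ∀ᵐ t, α t ≠ ∞ := by
    filter_upwards [ae_lt_top (hα.pow_const _) htop] with t ht h
    rw [h, ENNReal.top_rpow_of_pos (by norm_num)] at ht
    exact lt_irrefl _ ht
  rcases eq_or_ne (∫⁻ s, α s ^ (4 / 3 : ℝ)) 0 with hzero | hzero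
  · have hα0 : ∀ᵐ t, α t = 0 := by
      filter_upwards [(lintegral_eq_zero_iff (hα.pow_const _)).1 hzero] with t ht
      exact (ENNReal.rpow_eq_zero_iff_of_pos (by norm_num)).1 ht
    have : ∫⁻ t, ∫⁻ s, dispersiveKernel (t - s) * α s * α t = 0 := by
      rw [← lintegral_zero (μ := (volume : Measure ℝ))]
      apply lintegral_congr_ae
      filter_upwards [hα0] with t ht
      simp [ht]
    rw [this]
    exact zero_le
  set M := (∫⁻ s, α s ^ (4 / 3 : ℝ)).toReal with hM
  have hMpos : 0 < M := ENNReal.toReal_pos hzero htop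
  have hMα : ∫⁻ s, α s ^ (4 / 3 : ℝ) = ENNReal.ofReal M := (ENNReal.ofReal_toReal htop).symm
  set K : ℝ → ℝ → ℝ≥0∞ := fun t s => dispersiveKernel (t - s) * α s * α t with hK
  have hKm : Measurable (Function.uncurry K) := by
    have h1 : Measurable (fun p : ℝ × ℝ => dispersiveKernel (p.1 - p.2)) :=
      measurable_dispersiveKernel.comp (by fun_prop)
    exact (h1.mul (hα.comp measurable_snd)).mul (hα.comp measurable_fst)
  have hKsymm : ∀ t s, K t s = K s t := by
    intro t s
    simp only [hK]
    rw [← dispersiveKernel_neg, neg_sub]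
    ring
  -- The form is symmetric, so it is enough to integrate where α(s) ≤ α(t), at the price of a factor
  -- 2. There the previous bound holds pointwise in t and integrates to a multiple of ∫ α^{4/3}.
  set I : ℝ → ℝ → ℝ≥0∞ := fun t s => Set.indicator {s | α s ≤ α t} (K t) s with hI
  have hIm : Measurable (Function.uncurry I) := by
    have : Function.uncurry I
        = Set.indicator {p : ℝ × ℝ | α p.2 ≤ α p.1} (Function.uncurry K) := by
      ext ⟨t, s⟩
      simp [hI, Set.indicator, Function.uncurry]
    rw [this]
    exact hKm.indicator (measurableSet_le (hα.comp measurable_snd) (hα.comp measurable_fst))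
  have hle : ∀ t s, K t s ≤ I t s + I s t := by
    intro t s
    rcases le_total (α s) (α t) with h | h
    · refine le_trans (le_of_eq ?_) le_self_add
      simp [hI, h]
    · refine le_trans (le_of_eq ?_) le_add_self
      rw [hKsymm]
      simp [hI, h]
  have hIle : ∀ᵐ t, ∫⁻ s, I t s ≤ ENNReal.ofReal (6 * M ^ (1 / 2 : ℝ)) * α t ^ (4 / 3 : ℝ) := by
    filter_upwards [hαtop] with t ht
    refine le_trans (le_of_eq ?_) (mul_lintegral_dispersiveKernel_le hα t hMpos hMα ht)
    simp only [hI, hK]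
    rw [lintegral_indicator (measurableSet_le hα measurable_const), mul_comm, lintegral_mul_const]
    exact (measurable_dispersiveKernel.comp (by fun_prop)).mul hα
  have hIint : ∫⁻ t, ∫⁻ s, I t s ≤ ENNReal.ofReal (6 * M ^ (1 / 2 : ℝ)) * ENNReal.ofReal M := by
    refine (lintegral_mono_ae hIle).trans ?_
    rw [lintegral_const_mul _ (hα.pow_const _), hMα]
  calc ∫⁻ t, ∫⁻ s, K t s ≤ ∫⁻ t, ∫⁻ s, (I t s + I s t) := by
        gcongr with t s
        exact hle t s
    _ = ∫⁻ t, ((∫⁻ s, I t s) + ∫⁻ s, I s t) := by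
        congr 1
        ext t
        exact lintegral_add_left (hIm.comp measurable_prodMk_left) _
    _ = (∫⁻ t, ∫⁻ s, I t s) + ∫⁻ t, ∫⁻ s, I s t :=
        lintegral_add_left hIm.lintegral_prod_right' _
    _ = (∫⁻ t, ∫⁻ s, I t s) + ∫⁻ t, ∫⁻ s, I t s := by
        congr 1
        exact lintegral_lintegral_swap (f := fun t s => I s t)
          (hIm.comp measurable_swap).aemeasurable
    _ ≤ ENNReal.ofReal (6 * M ^ (1 / 2 : ℝ)) * ENNReal.ofReal M
        + ENNReal.ofReal (6 * M ^ (1 / 2 : ℝ)) * ENNReal.ofReal M := add_le_add hIint hIint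
    _ = 12 * (∫⁻ s, α s ^ (4 / 3 : ℝ)) ^ (3 / 2 : ℝ) := by
        rw [hMα, ENNReal.ofReal_rpow_of_pos hMpos, ← ENNReal.ofReal_mul (by positivity),
          ← ENNReal.ofReal_add (by positivity) (by positivity), ← ENNReal.ofReal_ofNat,
          ← ENNReal.ofReal_mul (by norm_num)]
        congr 1
        have : M ^ (3 / 2 : ℝ) = M ^ (1 / 2 : ℝ) * M := by
          conv_rhs => rw [← Real.rpow_one M]
          rw [← Real.rpow_mul hMpos.le, ← Real.rpow_add hMpos]
          norm_num
        rw [this]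
        ring

/-! ### The TT* method in a Hilbert space -/

section Hilbert

variable {E : Type*} [NormedAddCommGroup E] [InnerProductSpace ℂ E] [CompleteSpace E]

theorem integral_inner_right {X : Type*} [MeasurableSpace X] {μ : Measure X} {f : X → E}
    (hf : Integrable f μ) (c : E) : ∫ x, inner ℂ (f x) c ∂μ = inner ℂ (∫ x, f x ∂μ) c := by
  rw [← inner_conj_symm, ← integral_inner hf, ← integral_conj]
  simp_rw [inner_conj_symm]

theorem enorm_integral_sq_le {X : Type*} [MeasurableSpace X] {μ : Measure X} {A : X → E}
    (hA : Integrable A μ) :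
    ‖∫ x, A x ∂μ‖ₑ ^ (2 : ℝ) ≤ ∫⁻ t, ∫⁻ s, ‖inner ℂ (A s) (A t)‖ₑ ∂μ ∂μ := by
  have h1 : ‖∫ x, A x ∂μ‖ₑ ^ (2 : ℝ) = ‖inner ℂ (∫ x, A x ∂μ) (∫ x, A x ∂μ)‖ₑ := by
    rw [inner_self_eq_norm_sq_to_K, enorm_pow, RCLike.ofReal_eq_complex_ofReal]
    simp [← ofReal_norm]
  rw [h1, ← integral_inner hA]
  refine (enorm_integral_le_lintegral_enorm _).trans (lintegral_mono fun t => ?_)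
  rw [← integral_inner_right hA]
  exact enorm_integral_le_lintegral_enorm _

/-- Fubini on {s < τ}: the adjoint of integration over the future is integration over the past. This
dualises retarded integrals and also serves as integration by parts for absolutely continuous paths.
-/
theorem integral_inner_integral_Ioi {A B : ℝ → E} (hA : Integrable A) (hB : Integrable B) :
    ∫ s, inner ℂ (A s) (∫ τ in Set.Ioi s, B τ) = ∫ τ, inner ℂ (∫ s in Set.Iio τ, A s) (B τ) := by
  set F : ℝ → ℝ → ℂ := fun s τ => Set.indicator {p : ℝ × ℝ | p.1 < p.2}
    (fun p => inner ℂ (A p.1) (B p.2)) (s, τ) with hF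
  have hint : Integrable (Function.uncurry F) (volume.prod volume) := by
    have : Function.uncurry F = Set.indicator {p : ℝ × ℝ | p.1 < p.2}
        (fun p => inner ℂ (A p.1) (B p.2)) := by ext ⟨s, τ⟩; rfl
    rw [this]
    refine Integrable.indicator ?_ (measurableSet_lt measurable_fst measurable_snd)
    refine (hA.norm.mul_prod hB.norm).mono
      (hA.aestronglyMeasurable.comp_fst.inner hB.aestronglyMeasurable.comp_snd) ?_
    refine Eventually.of_forall fun p => ?_
    rw [norm_mul, norm_norm, norm_norm]
    exact norm_inner_le_norm _ _
  have h1 : ∀ s, ∫ τ, F s τ = inner ℂ (A s) (∫ τ in Set.Ioi s, B τ) := by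
    intro s
    rw [← integral_inner hB.integrableOn, ← integral_indicator measurableSet_Ioi]
    rfl
  have h2 : ∀ τ, ∫ s, F s τ = inner ℂ (∫ s in Set.Iio τ, A s) (B τ) := by
    intro τ
    rw [← integral_inner_right hA.integrableOn, ← integral_indicator measurableSet_Iio]
    rfl
  simp_rw [← h1, ← h2]
  exact integral_integral_swap hint

/-- A `TT*` estimate for families of vectors with dispersive decay of correlations. -/
theorem enorm_integral_le_of_dispersive {A : ℝ → E} (hA : Integrable A) {α : ℝ → ℝ≥0∞}
    (hα : Measurable α)
    (h : ∀ s t, s ≠ t → ‖inner ℂ (A s) (A t)‖ₑ ≤ dispersiveKernel (t - s) * α s * α t) :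
    ‖∫ s, A s‖ₑ ≤ 4 * (∫⁻ s, α s ^ (4 / 3 : ℝ)) ^ (3 / 4 : ℝ) := by
  have h1 : ‖∫ s, A s‖ₑ ^ (2 : ℝ) ≤ 12 * (∫⁻ s, α s ^ (4 / 3 : ℝ)) ^ (3 / 2 : ℝ) := by
    refine (enorm_integral_sq_le hA).trans (le_trans ?_
      (lintegral_lintegral_dispersiveKernel_le hα))
    refine lintegral_mono fun t => lintegral_mono_ae ?_
    have : ∀ᵐ s : ℝ, s ≠ t := by simp [ae_iff, measure_singleton]
    filter_upwards [this] with s hs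
    exact h s t hs
  have h2 := ENNReal.rpow_le_rpow h1 (show (0 : ℝ) ≤ 1 / 2 by norm_num)
  rw [← ENNReal.rpow_mul, ENNReal.mul_rpow_of_nonneg _ _ (by norm_num), ← ENNReal.rpow_mul] at h2
  norm_num at h2
  refine h2.trans ?_
  gcongr
  calc (12 : ℝ≥0∞) ^ (1 / 2 : ℝ) ≤ 16 ^ (1 / 2 : ℝ) := by gcongr; norm_num
    _ = 4 := by
      rw [show (16 : ℝ≥0∞) = 4 ^ (2 : ℝ) by norm_num, ← ENNReal.rpow_mul]; norm_num

end Hilbert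

/-! ### The L^∞ norm on L² by duality with L¹ -/

/-- The dispersive estimate for elements of `L¹ ∩ L²`. -/
theorem enorm_inner_freeGroup_le {t : ℝ} (ht : t ≠ 0) (f g : L2)
    (hf : eLpNorm f 1 volume ≠ ∞) (hg : eLpNorm g 1 volume ≠ ∞) :
    ‖inner ℂ g (freeGroup t f)‖ₑ
      ≤ dispersiveKernel t * eLpNorm g 1 volume * eLpNorm f 1 volume := by
  have key : ∀ f : L2, eLpNorm f 1 volume ≠ ∞ → Integrable f ∧
      ENNReal.ofReal (∫ x, ‖f x‖) = eLpNorm f 1 volume := by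
    intro f hf
    have hfi : Integrable f := memLp_one_iff_integrable.1
      ⟨Lp.aestronglyMeasurable f, hf.lt_top⟩
    exact ⟨hfi, by rw [ofReal_integral_norm_eq_lintegral_enorm hfi, eLpNorm_one_eq_lintegral_enorm]⟩
  obtain ⟨hfi, hf1⟩ := key f hf
  obtain ⟨hgi, hg1⟩ := key g hg
  have h := norm_inner_freeGroup_le ht f g hfi hgi
  have h0 : 0 ≤ |t| ^ (-(1 / 2) : ℝ) := by positivity
  have h1 : 0 ≤ ∫ x, ‖f x‖ := integral_nonneg fun _ => norm_nonneg _
  have h2 := ENNReal.ofReal_le_ofReal h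
  rw [ofReal_norm, ENNReal.ofReal_mul (by positivity), ENNReal.ofReal_mul h0, hf1, hg1] at h2
  refine h2.trans (le_of_eq ?_)
  rw [dispersiveKernel]
  ring

theorem enorm_inner_le (g f : L2) :
    ‖inner ℂ g f‖ₑ ≤ eLpNorm f ∞ volume * eLpNorm g 1 volume := by
  rw [L2.inner_def]
  refine (enorm_integral_le_lintegral_enorm _).trans ?_
  rw [eLpNorm_one_eq_lintegral_enorm, eLpNorm_exponent_top, ← lintegral_const_mul'' _
    (Lp.aestronglyMeasurable g).enorm]
  refine lintegral_mono_ae ?_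
  filter_upwards [ae_le_eLpNormEssSup (f := f) (μ := volume)] with x hx
  refine le_trans ?_ (mul_le_mul_left hx _)
  rw [RCLike.inner_apply, enorm_mul, RCLike.enorm_conj]

/-- Testing against the phase of f on a set A of finite positive measure, divided by |A|, bounds the
mean of |f| over A by M. This holds for every such A, so |f| ≤ M almost everywhere. -/
theorem eLpNorm_top_le_of_forall_inner (f : L2) {M : ℝ≥0∞}
    (h : ∀ g : L2, eLpNorm g 1 volume ≤ 1 → ‖inner ℂ g f‖ₑ ≤ M) :
    eLpNorm f ∞ volume ≤ M := by
  rw [eLpNorm_exponent_top]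
  refine eLpNormEssSup_le_of_ae_enorm_bound ?_
  refine ae_le_of_forall_setLIntegral_le_of_sigmaFinite
    (Lp.stronglyMeasurable f).enorm fun A hA hAfin => ?_
  rw [setLIntegral_const]
  rcases eq_or_ne (volume A) 0 with h0 | h0
  · rw [setLIntegral_measure_zero _ _ h0]; exact zero_le
  set c : ℂ := (((volume A).toReal⁻¹ : ℝ) : ℂ) with hc
  have hcpos : 0 < (volume A).toReal := ENNReal.toReal_pos h0 hAfin.ne
  -- Where f vanishes the quotient is 0/0 = 0, so |φ| ≤ |c| holds everywhere.
  set φ : ℝ → ℂ := fun x => c * (f x / ‖f x‖) with hφ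
  have hφm : Measurable φ := by
    have := (Lp.stronglyMeasurable f).measurable
    fun_prop
  have hce : ‖c‖ₑ = (volume A)⁻¹ := by
    rw [hc, ← ofReal_norm, Complex.norm_real, norm_inv, Real.norm_of_nonneg hcpos.le,
      ENNReal.ofReal_inv_of_pos hcpos, ENNReal.ofReal_toReal hAfin.ne]
  have hφle : ∀ x, ‖φ x‖ ≤ ‖c‖ := by
    intro x
    simp only [hφ]
    have h1 : ‖((‖f x‖ : ℝ) : ℂ)‖ = ‖f x‖ := by simp
    rw [norm_mul, norm_div, h1]
    exact mul_le_of_le_one_right (norm_nonneg _) (div_self_le_one _)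
  have hmem : MemLp (A.indicator φ) 2 volume := by
    rw [memLp_indicator_iff_restrict hA]
    have : IsFiniteMeasure (volume.restrict A) := ⟨by simpa using hAfin⟩
    exact MemLp.of_bound hφm.aestronglyMeasurable ‖c‖ (Eventually.of_forall hφle)
  have hg1 : eLpNorm hmem.toLp 1 volume ≤ 1 := by
    rw [eLpNorm_congr_ae hmem.coeFn_toLp, eLpNorm_indicator_eq_eLpNorm_restrict hA,
      eLpNorm_one_eq_lintegral_enorm]
    calc ∫⁻ x in A, ‖φ x‖ₑ ≤ ∫⁻ x in A, ‖c‖ₑ :=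
          lintegral_mono fun x => by
            rw [← ofReal_norm, ← ofReal_norm]; exact ENNReal.ofReal_le_ofReal (hφle x)
      _ = 1 := by rw [setLIntegral_const, hce, ENNReal.inv_mul_cancel h0 hAfin.ne]
  have hfint : Integrable (fun x => ‖f x‖) (volume.restrict A) := by
    have : IsFiniteMeasure (volume.restrict A) := ⟨by simpa using hAfin⟩
    exact (((Lp.memLp f).restrict A).integrable one_le_two).norm
  have hinner : inner ℂ hmem.toLp f = c * ((∫ x in A, ‖f x‖ : ℝ) : ℂ) := by
    rw [L2.inner_def, ← integral_complex_ofReal, ← integral_const_mul, ← integral_indicator hA]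
    apply integral_congr_ae
    filter_upwards [hmem.coeFn_toLp] with x hx
    rw [hx, RCLike.inner_apply]
    by_cases hxA : x ∈ A
    · rw [Set.indicator_of_mem hxA, Set.indicator_of_mem hxA, hφ]
      simp only [map_mul, map_div₀, hc, Complex.conj_ofReal]
      rcases eq_or_ne (f x) 0 with h | h
      · simp [h]
      · have h' : (‖f x‖ : ℂ) ≠ 0 := by simpa using h
        have h3 := Complex.mul_conj' (f x)
        field_simp
        rw [mul_right_comm, h3]
        ring
    · simp [Set.indicator_of_notMem hxA]
  have hfin := h _ hg1
  rw [hinner, enorm_mul, hce] at hfin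
  have h3 : ‖((∫ x in A, ‖f x‖ : ℝ) : ℂ)‖ₑ = ∫⁻ x in A, ‖f x‖ₑ := by
    rw [← ofReal_norm, Complex.norm_real, Real.norm_of_nonneg
      (integral_nonneg fun _ => norm_nonneg _)]
    have := ofReal_integral_norm_eq_lintegral_enorm (μ := volume.restrict A) (f := f)
      ((integrable_norm_iff (Lp.aestronglyMeasurable f).restrict).1 hfint)
    exact this
  rw [h3] at hfin
  calc ∫⁻ x in A, ‖f x‖ₑ = volume A * ((volume A)⁻¹ * ∫⁻ x in A, ‖f x‖ₑ) := by
        rw [← mul_assoc, ENNReal.mul_inv_cancel h0 hAfin.ne, one_mul]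
    _ ≤ volume A * M := by gcongr
    _ = M * volume A := mul_comm _ _

/-- The elements of `L²` in the unit ball of `L¹`. -/
def unitBallL1 : Set L2 := {g | eLpNorm g 1 volume ≤ 1}

theorem zero_mem_unitBallL1 : (0 : L2) ∈ unitBallL1 := by
  have : eLpNorm (0 : L2) 1 volume = 0 := by
    rw [eLpNorm_congr_ae (Lp.coeFn_zero ℂ 2 volume)]
    exact eLpNorm_zero
  show eLpNorm (0 : L2) 1 volume ≤ 1
  rw [this]
  exact zero_le

instance : SecondCountableTopology L2 :=
  haveI : Fact ((2 : ℝ≥0∞) ≠ ∞) := ⟨ENNReal.ofNat_ne_top⟩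
  Lp.SecondCountableTopology

instance : Nonempty unitBallL1 := ⟨⟨0, zero_mem_unitBallL1⟩⟩

/-- A countable family which norms `L^∞`. -/
noncomputable def normingSeq (n : ℕ) : L2 :=
  (TopologicalSpace.denseSeq unitBallL1 n : L2)

theorem normingSeq_mem (n : ℕ) : normingSeq n ∈ unitBallL1 := Subtype.coe_prop _

/-- Density of the sequence in the L² topology suffices, although the ball is measured in L¹,
because g ↦ ⟨g, f⟩ is continuous on L². Being a countable supremum of continuous functions, the L^∞
norm is measurable along measurable paths and lower semicontinuous under L² convergence. -/
theorem eLpNorm_top_eq_iSup (f : L2) :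
    eLpNorm f ∞ volume = ⨆ n, ‖inner ℂ (normingSeq n) f‖ₑ := by
  apply le_antisymm
  · refine eLpNorm_top_le_of_forall_inner f fun g hg => ?_
    have hc : IsClosed {g : unitBallL1 | ‖inner ℂ (g : L2) f‖ₑ
        ≤ ⨆ n, ‖inner ℂ (normingSeq n) f‖ₑ} := by
      refine isClosed_le ?_ continuous_const
      exact (Continuous.inner continuous_subtype_val continuous_const).enorm
    exact (TopologicalSpace.denseRange_denseSeq unitBallL1).induction_on
      (p := fun g : unitBallL1 => ‖inner ℂ (g : L2) f‖ₑ ≤ ⨆ n, ‖inner ℂ (normingSeq n) f‖ₑ)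
      (⟨g, hg⟩ : unitBallL1) hc fun n => le_iSup (fun n => ‖inner ℂ (normingSeq n) f‖ₑ) n
  · refine iSup_le fun n => (enorm_inner_le _ _).trans ?_
    exact mul_le_of_le_one_right' (normingSeq_mem n)

theorem aemeasurable_eLpNorm_top {X : Type*} [MeasurableSpace X] {μ : Measure X} {S : X → L2}
    (hS : AEStronglyMeasurable S μ) : AEMeasurable (fun x => eLpNorm (S x) ∞ volume) μ := by
  simp_rw [eLpNorm_top_eq_iSup]
  exact AEMeasurable.iSup fun n => (aestronglyMeasurable_const.inner hS).enorm

theorem eLpNorm_top_le_liminf {ι : Type*} {l : Filter ι} [NeBot l] {F : ι → L2} {f : L2}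
    (h : Tendsto F l (𝓝 f)) :
    eLpNorm f ∞ volume ≤ liminf (fun i => eLpNorm (F i) ∞ volume) l := by
  rw [eLpNorm_top_eq_iSup]
  refine iSup_le fun n => ?_
  have h1 : Tendsto (fun i => ‖inner ℂ (normingSeq n) (F i)‖ₑ) l
      (𝓝 ‖inner ℂ (normingSeq n) f‖ₑ) :=
    ((continuous_const.inner continuous_id).enorm.tendsto f).comp h
  rw [← h1.liminf_eq]
  refine liminf_le_liminf (Eventually.of_forall fun i => ?_)
  rw [eLpNorm_top_eq_iSup]
  exact le_iSup (fun n => ‖inner ℂ (normingSeq n) (F i)‖ₑ) n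

theorem eLpNorm_top_le_of_tendsto {ι : Type*} {l : Filter ι} [NeBot l] {F : ι → L2} {f : L2}
    (h : Tendsto F l (𝓝 f)) {M : ℝ≥0∞} (hM : ∀ᶠ i in l, eLpNorm (F i) ∞ volume ≤ M) :
    eLpNorm f ∞ volume ≤ M :=
  (eLpNorm_top_le_liminf h).trans (liminf_le_of_frequently_le' hM.frequently)

theorem eLpNorm_top_integral_le {X : Type*} [MeasurableSpace X] {μ : Measure X} {S : X → L2}
    (hS : Integrable S μ) :
    eLpNorm (∫ x, S x ∂μ : L2) ∞ volume ≤ ∫⁻ x, eLpNorm (S x) ∞ volume ∂μ := by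
  rw [eLpNorm_top_eq_iSup]
  refine iSup_le fun n => ?_
  rw [← integral_inner hS]
  refine (enorm_integral_le_lintegral_enorm _).trans (lintegral_mono fun x => ?_)
  rw [eLpNorm_top_eq_iSup]
  exact le_iSup (fun n => ‖inner ℂ (normingSeq n) (S x)‖ₑ) n

theorem eLpNorm_top_add_le (f g : L2) :
    eLpNorm (f + g : L2) ∞ volume ≤ eLpNorm f ∞ volume + eLpNorm g ∞ volume := by
  rw [eLpNorm_congr_ae (Lp.coeFn_add f g)]
  exact eLpNorm_add_le (Lp.aestronglyMeasurable f) (Lp.aestronglyMeasurable g) le_top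

/-- The dispersive estimate from `L¹ ∩ L²` to `L^∞`. -/
theorem eLpNorm_top_freeGroup_le {t : ℝ} (ht : t ≠ 0) (f : L2) (hf : eLpNorm f 1 volume ≠ ∞) :
    eLpNorm (freeGroup t f) ∞ volume ≤ dispersiveKernel t * eLpNorm f 1 volume := by
  refine eLpNorm_top_le_of_forall_inner _ fun g hg => ?_
  refine (enorm_inner_freeGroup_le ht f g hf (ne_top_of_le_ne_top ENNReal.one_ne_top hg)).trans ?_
  rw [mul_right_comm]
  exact mul_le_of_le_one_right' hg

/-! ### Duhamel integrals and the retarded Strichartz estimate -/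

theorem continuous_integral_Ioi {E : Type*} [NormedAddCommGroup E] [NormedSpace ℝ E]
    {B : ℝ → E} (hB : Integrable B) : Continuous (fun s => ∫ τ in Set.Ioi s, B τ) := by
  have h : ∀ s, ∫ τ in Set.Ioi s, B τ = (∫ τ in Set.Ioi 0, B τ) - ∫ τ in (0 : ℝ)..s, B τ := by
    intro s
    rw [intervalIntegral.integral_Ioi_sub_Ioi' hB.integrableOn hB.integrableOn |>.symm]
    abel
  rw [funext h]
  exact continuous_const.sub (intervalIntegral.continuous_primitive
    (fun a b => hB.intervalIntegrable) 0)

/-- The retarded Duhamel term, with data at time infinity. -/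
noncomputable def duhamel (r : ℝ → L2) (s : ℝ) : L2 :=
  freeGroup s (∫ τ in Set.Ioi s, freeGroup (-τ) (r τ))

theorem integrable_freeGroup_neg {r : ℝ → L2} {μ : Measure ℝ} (hr : Integrable r μ) :
    Integrable (fun τ => freeGroup (-τ) (r τ)) μ := by
  refine hr.mono (aestronglyMeasurable_freeGroup (Continuous.aestronglyMeasurable (by fun_prop))
    hr.aestronglyMeasurable) (Eventually.of_forall fun τ => ?_)
  rw [LinearIsometry.norm_map]

theorem continuous_duhamel {r : ℝ → L2} (hr : Integrable r) : Continuous (duhamel r) :=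
  Continuous.freeGroup continuous_id (continuous_integral_Ioi (integrable_freeGroup_neg hr))

theorem enorm_duhamel_le (r : ℝ → L2) (s : ℝ) : ‖duhamel r s‖ₑ ≤ ∫⁻ τ in Set.Ioi s, ‖r τ‖ₑ := by
  rw [duhamel, LinearIsometry.enorm_map]
  refine (enorm_integral_le_lintegral_enorm _).trans (le_of_eq ?_)
  simp_rw [LinearIsometry.enorm_map]

theorem enorm_inner_freeGroup_neg_le {s t : ℝ} (hst : s ≠ t) (f g : L2)
    (hf : eLpNorm f 1 volume ≠ ∞) (hg : eLpNorm g 1 volume ≠ ∞) :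
    ‖inner ℂ (freeGroup (-s) g) (freeGroup (-t) f)‖ₑ
      ≤ dispersiveKernel (t - s) * eLpNorm g 1 volume * eLpNorm f 1 volume := by
  rw [inner_freeGroup_neg, ← freeGroup_add, ← inner_conj_symm, RCLike.enorm_conj]
  refine (enorm_inner_freeGroup_le (by rwa [← sub_eq_add_neg, sub_ne_zero, ne_comm]) _ _ hg
    hf).trans (le_of_eq ?_)
  rw [← sub_eq_add_neg]
  ring

/-- The Strichartz estimate linearised: a direction G(s) in the L¹ ball replaces the L^∞ norm by the
scalar p(s) = ⟨G(s), duhamel r s⟩. With P = ∫|p|⁴, duality and TT* give P ≤ 4P^{3/4}‖r‖_{L¹L²}. The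
set E of finite measure and the bound c only ensure P < ∞, so that P^{3/4} can be cancelled. -/
theorem lintegral_enorm_inner_duhamel_le {r : ℝ → L2} (hr : Integrable r) {G : ℝ → L2}
    (hG : StronglyMeasurable G) (hG1 : ∀ s, G s ∈ unitBallL1) {c : ℝ} (hGc : ∀ s, ‖G s‖ ≤ c)
    {E : Set ℝ} (hE : MeasurableSet E) (hEfin : volume E ≠ ∞) :
    ∫⁻ s in E, ‖inner ℂ (G s) (duhamel r s)‖ₑ ^ (4 : ℝ) ≤ (4 * ∫⁻ τ, ‖r τ‖ₑ) ^ (4 : ℝ) := by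
  have hc : 0 ≤ c := (norm_nonneg _).trans (hGc 0)
  set R : ℝ := ∫ τ, ‖r τ‖ with hR
  have hR0 : 0 ≤ R := integral_nonneg fun _ => norm_nonneg _
  have hRe : ENNReal.ofReal R = ∫⁻ τ, ‖r τ‖ₑ := ofReal_integral_norm_eq_lintegral_enorm hr
  set B : ℝ → L2 := fun τ => freeGroup (-τ) (r τ) with hB
  have hBi : Integrable B := integrable_freeGroup_neg hr
  have hSR : ∀ s, ‖duhamel r s‖ ≤ R := by
    intro s
    have h1 := (enorm_duhamel_le r s).trans (setLIntegral_le_lintegral _ _)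
    rw [← hRe, ← ofReal_norm] at h1
    exact (ENNReal.ofReal_le_ofReal_iff hR0).1 h1
  set p : ℝ → ℂ := E.indicator fun s => inner ℂ (G s) (duhamel r s) with hp
  have hpm : StronglyMeasurable p :=
    (hG.inner (continuous_duhamel hr).stronglyMeasurable).indicator hE
  have hpb : ∀ s, ‖p s‖ ≤ c * R := by
    intro s
    rw [hp]
    refine (norm_indicator_le_norm_self _ _).trans ((norm_inner_le_norm _ _).trans ?_)
    exact mul_le_mul (hGc s) (hSR s) (norm_nonneg _) hc
  have hpE : ∀ s, s ∉ E → p s = 0 := fun s hs => Set.indicator_of_notMem hs _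
  -- The weight |p|²p is dual to p in L⁴: pairing A(s) with the integral of B over the future of s
  -- gives exactly |p(s)|⁴.
  set A : ℝ → L2 := fun s => ((‖p s‖ ^ 2 : ℝ) * p s : ℂ) • freeGroup (-s) (G s) with hA
  have hAm : AEStronglyMeasurable A volume := by
    have h1 : AEStronglyMeasurable (fun s => ((‖p s‖ ^ 2 : ℝ) * p s : ℂ)) volume :=
      ((Complex.continuous_ofReal.comp_stronglyMeasurable
        (hpm.norm.pow 2)).mul hpm).aestronglyMeasurable
    exact h1.smul (aestronglyMeasurable_freeGroup (τ := fun s => -s)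
      (Continuous.aestronglyMeasurable (by fun_prop)) hG.aestronglyMeasurable)
  have hAn : ∀ s, ‖A s‖ = ‖p s‖ ^ 3 * ‖G s‖ := by
    intro s
    simp only [hA]
    rw [norm_smul, LinearIsometry.norm_map, norm_mul, Complex.norm_real, norm_pow, norm_norm]
    ring
  have hAE : ∀ s, s ∉ E → A s = 0 := by
    intro s hs
    simp only [hA]
    rw [hpE s hs, mul_zero, zero_smul]
  have hAi : Integrable A := by
    rw [← integrableOn_iff_integrable_of_support_subset (s := E)
      (fun s hs => by_contra fun h => hs (hAE s h))]
    refine Measure.integrableOn_of_bounded (M := (c * R) ^ 3 * c) hEfin hAm ?_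
    refine Eventually.of_forall fun s => ?_
    rw [hAn]
    have := hpb s
    have := hGc s
    gcongr
  have hp4i : Integrable (fun s => ‖p s‖ ^ 4) := by
    rw [← integrableOn_iff_integrable_of_support_subset (s := E)
      (fun s hs => by_contra fun h => hs (by simp [hpE s h]))]
    refine Measure.integrableOn_of_bounded (M := (c * R) ^ 4) hEfin
      (hpm.norm.pow 4).aestronglyMeasurable ?_
    refine Eventually.of_forall fun s => ?_
    rw [norm_pow, norm_norm]
    have := hpb s
    gcongr
  have hinner : ∀ s, inner ℂ (A s) (∫ τ in Set.Ioi s, B τ) = ((‖p s‖ ^ 4 : ℝ) : ℂ) := by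
    intro s
    by_cases hs : s ∈ E
    · simp only [hA]
      rw [inner_smul_left, ← inner_conj_symm, inner_freeGroup_neg, inner_conj_symm]
      have h1 : inner ℂ (G s) (freeGroup s (∫ τ in Set.Ioi s, B τ)) = p s := by
        rw [hp, Set.indicator_of_mem hs]
        rfl
      rw [h1, map_mul, Complex.conj_ofReal, mul_assoc, ← Complex.normSq_eq_conj_mul_self,
        Complex.normSq_eq_norm_sq]
      push_cast
      ring
    · rw [hAE s hs, hpE s hs]
      simp
  set P : ℝ≥0∞ := ∫⁻ s, ‖p s‖ₑ ^ (4 : ℝ) with hP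
  have hPeq : P = ENNReal.ofReal (∫ s, ‖p s‖ ^ 4) := by
    rw [ofReal_integral_eq_lintegral_ofReal hp4i (Eventually.of_forall fun s => by positivity), hP]
    congr 1
    ext s
    rw [← ofReal_norm, ENNReal.ofReal_rpow_of_nonneg (norm_nonneg _) (by norm_num)]
    norm_num
  have hPfin : P ≠ ∞ := by rw [hPeq]; exact ENNReal.ofReal_ne_top
  -- The truncation s < τ costs nothing, because the TT* bound uses only absolute values of
  -- correlations. The source is in L¹ in time, so this uniform bound in τ is all that is needed.
  have hdual : ∀ τ, ‖∫ s in Set.Iio τ, A s‖ₑ ≤ 4 * P ^ (3 / 4 : ℝ) := by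
    intro τ
    rw [← integral_indicator measurableSet_Iio]
    have h := enorm_integral_le_of_dispersive (hAi.indicator (measurableSet_Iio (a := τ)))
      (α := fun s => ‖p s‖ₑ ^ (3 : ℝ)) (hpm.enorm.pow_const _) ?_
    · refine h.trans (le_of_eq ?_)
      simp_rw [← ENNReal.rpow_mul]
      norm_num [hP]
    · intro s t hst
      have h1 : ‖inner ℂ (A s) (A t)‖ₑ
          ≤ dispersiveKernel (t - s) * ‖p s‖ₑ ^ (3 : ℝ) * ‖p t‖ₑ ^ (3 : ℝ) := by
        have hcoef : ∀ s, ‖((‖p s‖ ^ 2 : ℝ) * p s : ℂ)‖ₑ = ‖p s‖ₑ ^ (3 : ℝ) := by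
          intro s
          rw [← ofReal_norm, ← ofReal_norm, ENNReal.ofReal_rpow_of_nonneg (norm_nonneg _)
            (by norm_num), norm_mul, Complex.norm_real, norm_pow, norm_norm]
          congr 1
          norm_cast
        simp only [hA]
        rw [inner_smul_left, inner_smul_right, enorm_mul, enorm_mul, RCLike.enorm_conj, hcoef,
          hcoef]
        have h2 := enorm_inner_freeGroup_neg_le hst (G t) (G s)
          (ne_top_of_le_ne_top ENNReal.one_ne_top (hG1 t))
          (ne_top_of_le_ne_top ENNReal.one_ne_top (hG1 s))
        have h3 : ‖inner ℂ (freeGroup (-s) (G s)) (freeGroup (-t) (G t))‖ₑ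
            ≤ dispersiveKernel (t - s) := by
          refine h2.trans ?_
          rw [mul_assoc]
          exact mul_le_of_le_one_right' (mul_le_one' (hG1 s) (hG1 t))
        calc _ ≤ ‖p s‖ₑ ^ (3 : ℝ) * (‖p t‖ₑ ^ (3 : ℝ) * dispersiveKernel (t - s)) := by gcongr
          _ = _ := by ring
      by_cases hs : s ∈ Set.Iio τ
      · by_cases ht : t ∈ Set.Iio τ
        · rwa [Set.indicator_of_mem hs, Set.indicator_of_mem ht]
        · rw [Set.indicator_of_notMem ht, inner_zero_right, enorm_zero]
          exact zero_le
      · rw [Set.indicator_of_notMem hs, inner_zero_left, enorm_zero]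
        exact zero_le
  have hmain : P ≤ 4 * P ^ (3 / 4 : ℝ) * ∫⁻ τ, ‖r τ‖ₑ := by
    have h1 : P = ‖∫ s, inner ℂ (A s) (∫ τ in Set.Ioi s, B τ)‖ₑ := by
      simp_rw [hinner]
      rw [integral_complex_ofReal, ← ofReal_norm, Complex.norm_real, Real.norm_of_nonneg
        (integral_nonneg fun _ => by positivity), hPeq]
    have h2 := integral_inner_integral_Ioi hAi hBi
    replace h1 := h1.trans (congrArg (fun z => ‖z‖ₑ) h2)
    rw [← lintegral_const_mul'' _ hr.aestronglyMeasurable.enorm]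
    refine h1.le.trans ((enorm_integral_le_lintegral_enorm _).trans (lintegral_mono fun τ => ?_))
    have h3 : ‖inner ℂ (∫ s in Set.Iio τ, A s) (B τ)‖ₑ
        ≤ ‖∫ s in Set.Iio τ, A s‖ₑ * ‖B τ‖ₑ := by
      rw [← ofReal_norm, ← ofReal_norm, ← ofReal_norm, ← ENNReal.ofReal_mul (norm_nonneg _)]
      exact ENNReal.ofReal_le_ofReal (norm_inner_le_norm _ _)
    refine h3.trans ?_
    simp only [hB]
    rw [LinearIsometry.enorm_map]
    exact mul_le_mul_left (hdual τ) _
  have hfinal : P ≤ (4 * ∫⁻ τ, ‖r τ‖ₑ) ^ (4 : ℝ) := by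
    rcases eq_or_ne P 0 with h0 | h0
    · rw [h0]; exact zero_le
    have h1 : P ^ (1 / 4 : ℝ) ≤ 4 * ∫⁻ τ, ‖r τ‖ₑ := by
      have h2 : P ^ (3 / 4 : ℝ) * P ^ (1 / 4 : ℝ) ≤ P ^ (3 / 4 : ℝ) * (4 * ∫⁻ τ, ‖r τ‖ₑ) := by
        rw [← ENNReal.rpow_add _ _ h0 hPfin]
        norm_num
        refine hmain.trans (le_of_eq ?_)
        norm_num
        ring
      refine (ENNReal.mul_le_mul_iff_right ?_ ?_).1 h2
      · simp [h0, hPfin]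
      · exact ENNReal.rpow_ne_top_of_nonneg (by norm_num) hPfin
    have h3 := ENNReal.rpow_le_rpow h1 (show (0 : ℝ) ≤ 4 by norm_num)
    rw [← ENNReal.rpow_mul] at h3
    norm_num at h3
    norm_num
    exact h3
  refine le_trans (le_of_eq ?_) hfinal
  rw [hP, ← lintegral_indicator hE]
  congr 1
  ext s
  rw [hp]
  by_cases hs : s ∈ E
  · rw [Set.indicator_of_mem hs, Set.indicator_of_mem hs]
  · rw [Set.indicator_of_notMem hs, Set.indicator_of_notMem hs]
    simp

/-- A measurable choice of a norming element among the first `n + 1`. -/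
noncomputable def normingChoice (S : ℝ → L2) : ℕ → ℝ → L2
  | 0 => fun _ => normingSeq 0
  | n + 1 => fun s =>
      open Classical in
      if ‖inner ℂ (normingChoice S n s) (S s)‖ < ‖inner ℂ (normingSeq (n + 1)) (S s)‖ then
        normingSeq (n + 1) else normingChoice S n s

theorem normingChoice_succ (S : ℝ → L2) (n : ℕ) (s : ℝ) :
    normingChoice S (n + 1) s = open Classical in
      if ‖inner ℂ (normingChoice S n s) (S s)‖ < ‖inner ℂ (normingSeq (n + 1)) (S s)‖ then
        normingSeq (n + 1) else normingChoice S n s := rfl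

theorem normingChoice_mem (S : ℝ → L2) (n : ℕ) (s : ℝ) : normingChoice S n s ∈ unitBallL1 := by
  induction n with
  | zero => exact normingSeq_mem 0
  | succ n ih =>
    rw [normingChoice_succ]
    split_ifs
    · exact normingSeq_mem _
    · exact ih

theorem exists_norm_normingChoice_le (S : ℝ → L2) (n : ℕ) : ∃ c, ∀ s, ‖normingChoice S n s‖ ≤ c := by
  induction n with
  | zero => exact ⟨‖normingSeq 0‖, fun s => le_rfl⟩
  | succ n ih =>
    obtain ⟨c, hc⟩ := ih
    refine ⟨max ‖normingSeq (n + 1)‖ c, fun s => ?_⟩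
    rw [normingChoice_succ]
    split_ifs
    · exact le_max_left _ _
    · exact (hc s).trans (le_max_right _ _)

theorem stronglyMeasurable_normingChoice {S : ℝ → L2} (hS : StronglyMeasurable S) (n : ℕ) :
    StronglyMeasurable (normingChoice S n) := by
  induction n with
  | zero => exact stronglyMeasurable_const
  | succ n ih =>
    exact StronglyMeasurable.ite (measurableSet_lt (ih.inner hS).norm.measurable
      (stronglyMeasurable_const.inner hS).norm.measurable) stronglyMeasurable_const ih

theorem monotone_enorm_inner_normingChoice (S : ℝ → L2) (s : ℝ) :
    Monotone fun n => ‖inner ℂ (normingChoice S n s) (S s)‖ₑ := by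
  refine monotone_nat_of_le_succ fun n => ?_
  rw [← ofReal_norm, ← ofReal_norm]
  apply ENNReal.ofReal_le_ofReal
  rw [normingChoice_succ]
  split_ifs with h
  · exact h.le
  · exact le_rfl

theorem enorm_inner_normingSeq_le_normingChoice (S : ℝ → L2) (s : ℝ) (n : ℕ) :
    ‖inner ℂ (normingSeq n) (S s)‖ₑ ≤ ‖inner ℂ (normingChoice S n s) (S s)‖ₑ := by
  rw [← ofReal_norm, ← ofReal_norm]
  apply ENNReal.ofReal_le_ofReal
  cases n with
  | zero => exact le_rfl
  | succ n =>
    rw [normingChoice_succ]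
    split_ifs with h
    · exact le_rfl
    · exact not_lt.1 h

theorem eLpNorm_top_eq_iSup_normingChoice (S : ℝ → L2) (s : ℝ) :
    eLpNorm (S s) ∞ volume = ⨆ n, ‖inner ℂ (normingChoice S n s) (S s)‖ₑ := by
  apply le_antisymm
  · rw [eLpNorm_top_eq_iSup]
    exact iSup_mono fun n => enorm_inner_normingSeq_le_normingChoice S s n
  · refine iSup_le fun n => (enorm_inner_le _ _).trans ?_
    exact mul_le_of_le_one_right' (normingChoice_mem S n s)

/-- The retarded Strichartz estimate `L¹L² → L⁴L^∞`. -/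
theorem lintegral_eLpNorm_top_duhamel_le {r : ℝ → L2} (hr : Integrable r) :
    ∫⁻ s, eLpNorm (duhamel r s) ∞ volume ^ (4 : ℝ) ≤ (4 * ∫⁻ τ, ‖r τ‖ₑ) ^ (4 : ℝ) := by
  set S := duhamel r with hS
  have hSm : StronglyMeasurable S := (continuous_duhamel hr).stronglyMeasurable
  -- The time window and the norming family grow together with n. Each stage satisfies the
  -- boundedness requirements of the linearised estimate, and monotone convergence removes them.
  set F : ℕ → ℝ → ℝ≥0∞ := fun n => Set.indicator (Set.Icc (-(n : ℝ)) n)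
    fun s => ‖inner ℂ (normingChoice S n s) (S s)‖ₑ ^ (4 : ℝ) with hF
  have hmono : ∀ s, Monotone fun n => F n s := by
    intro s m n hmn
    have hmn' : (m : ℝ) ≤ n := by exact_mod_cast hmn
    simp only [hF]
    refine (Set.indicator_le_indicator_of_subset
      (Set.Icc_subset_Icc (neg_le_neg hmn') hmn') (fun _ => zero_le) s).trans ?_
    refine Set.indicator_le_indicator ?_
    exact ENNReal.rpow_le_rpow (monotone_enorm_inner_normingChoice S s hmn) (by norm_num)
  have hlim : ∀ s, eLpNorm (S s) ∞ volume ^ (4 : ℝ) = ⨆ n, F n s := by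
    intro s
    have h1 : Tendsto (fun n => F n s) atTop (𝓝 (eLpNorm (S s) ∞ volume ^ (4 : ℝ))) := by
      have h2 : Tendsto (fun n => ‖inner ℂ (normingChoice S n s) (S s)‖ₑ ^ (4 : ℝ)) atTop
          (𝓝 (eLpNorm (S s) ∞ volume ^ (4 : ℝ))) := by
        rw [eLpNorm_top_eq_iSup_normingChoice]
        exact (ENNReal.continuous_rpow_const.tendsto _).comp
          (tendsto_atTop_iSup (monotone_enorm_inner_normingChoice S s))
      refine h2.congr' ?_
      filter_upwards [eventually_ge_atTop ⌈|s|⌉₊] with n hn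
      have hn' : |s| ≤ n := (Nat.le_ceil _).trans (by exact_mod_cast hn)
      simp only [hF]
      rw [Set.indicator_of_mem (show s ∈ Set.Icc (-(n : ℝ)) n from abs_le.1 hn')]
    exact tendsto_nhds_unique h1 (tendsto_atTop_iSup (hmono s))
  simp_rw [hlim]
  rw [lintegral_iSup (fun n => ?_) (fun m n hmn s => hmono s hmn)]
  · refine iSup_le fun n => ?_
    simp only [hF]
    rw [lintegral_indicator measurableSet_Icc]
    obtain ⟨c, hc⟩ := exists_norm_normingChoice_le S n
    exact lintegral_enorm_inner_duhamel_le hr (stronglyMeasurable_normingChoice hSm n)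
      (fun s => normingChoice_mem S n s) hc measurableSet_Icc (by simp)
  · exact ((((stronglyMeasurable_normingChoice hSm n).inner hSm).enorm.pow_const
      _).indicator measurableSet_Icc)

/-! ### Test functions and integration by parts -/

/-- The derivative in the first (time) variable. -/
noncomputable def timeDeriv (φ : ℝ × ℝ → ℂ) (p : ℝ × ℝ) : ℂ := fderiv ℝ φ p (1, 0)

/-- The derivative in the second (space) variable. -/
noncomputable def spaceDeriv (φ : ℝ × ℝ → ℂ) (p : ℝ × ℝ) : ℂ := fderiv ℝ φ p (0, 1)

/-- The formal adjoint of `i ∂ₜ + ∂ₓ²`. -/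
noncomputable def adjointOp (φ : ℝ × ℝ → ℂ) (p : ℝ × ℝ) : ℂ :=
  -Complex.I * timeDeriv φ p + spaceDeriv (spaceDeriv φ) p

section Calculus

variable {φ : ℝ × ℝ → ℂ}

theorem contDiff_timeDeriv (hφ : ContDiff ℝ (⊤ : ℕ∞) φ) : ContDiff ℝ (⊤ : ℕ∞) (timeDeriv φ) :=
  (hφ.fderiv_right (by simp)).clm_apply contDiff_const

theorem contDiff_spaceDeriv (hφ : ContDiff ℝ (⊤ : ℕ∞) φ) : ContDiff ℝ (⊤ : ℕ∞) (spaceDeriv φ) :=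
  (hφ.fderiv_right (by simp)).clm_apply contDiff_const

theorem contDiff_adjointOp (hφ : ContDiff ℝ (⊤ : ℕ∞) φ) : ContDiff ℝ (⊤ : ℕ∞) (adjointOp φ) :=
  (contDiff_const.mul (contDiff_timeDeriv hφ)).add (contDiff_spaceDeriv (contDiff_spaceDeriv hφ))

theorem hasDerivAt_timeDeriv (hφ : ContDiff ℝ (⊤ : ℕ∞) φ) (t x : ℝ) :
    HasDerivAt (fun s => φ (s, x)) (timeDeriv φ (t, x)) t := by
  have h1 := (hφ.differentiable (by simp) (t, x)).hasFDerivAt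
  exact h1.comp_hasDerivAt (f := fun s => (s, x)) t
    ((hasDerivAt_id t).prodMk (hasDerivAt_const t x))

theorem hasDerivAt_spaceDeriv (hφ : ContDiff ℝ (⊤ : ℕ∞) φ) (t x : ℝ) :
    HasDerivAt (fun y => φ (t, y)) (spaceDeriv φ (t, x)) x := by
  have h1 := (hφ.differentiable (by simp) (t, x)).hasFDerivAt
  exact h1.comp_hasDerivAt (f := fun y => (t, y)) x
    ((hasDerivAt_const x t).prodMk (hasDerivAt_id x))

theorem iteratedDeriv_two_eq_spaceDeriv (hφ : ContDiff ℝ (⊤ : ℕ∞) φ) (t x : ℝ) :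
    iteratedDeriv 2 (fun y => φ (t, y)) x = spaceDeriv (spaceDeriv φ) (t, x) := by
  rw [iteratedDeriv_succ, iteratedDeriv_one]
  have : deriv (fun y => φ (t, y)) = fun y => spaceDeriv φ (t, y) := by
    ext y
    exact (hasDerivAt_spaceDeriv hφ t y).deriv
  rw [this]
  exact (hasDerivAt_spaceDeriv (contDiff_spaceDeriv hφ) t x).deriv

theorem adjointOp_eq (hφ : ContDiff ℝ (⊤ : ℕ∞) φ) (t x : ℝ) :
    -Complex.I * deriv (fun s => φ (s, x)) t + iteratedDeriv 2 (fun y => φ (t, y)) x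
      = adjointOp φ (t, x) := by
  rw [(hasDerivAt_timeDeriv hφ t x).deriv, iteratedDeriv_two_eq_spaceDeriv hφ, adjointOp]

theorem support_adjointOp_subset : Function.support (adjointOp φ) ⊆ tsupport φ := by
  intro p hp
  by_contra h
  have h1 : timeDeriv φ p = 0 := image_eq_zero_of_notMem_tsupport
    fun h' => h (tsupport_fderiv_apply_subset ℝ (1, 0) h')
  have h2 : spaceDeriv (spaceDeriv φ) p = 0 := image_eq_zero_of_notMem_tsupport
    fun h' => h (tsupport_fderiv_apply_subset ℝ (0, 1) (tsupport_fderiv_apply_subset ℝ (0, 1) h'))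
  rw [Function.mem_support, adjointOp, h1, h2] at hp
  simp at hp

theorem hasCompactSupport_adjointOp (hs : HasCompactSupport φ) :
    HasCompactSupport (adjointOp φ) := hs.mono' support_adjointOp_subset

theorem hasCompactSupport_slice {ψ : ℝ × ℝ → ℂ} (hs : HasCompactSupport ψ) (t : ℝ) :
    HasCompactSupport fun x => ψ (t, x) := by
  refine HasCompactSupport.intro (hs.image continuous_snd) fun x hx => ?_
  by_contra h
  exact hx ⟨(t, x), subset_tsupport _ h, rfl⟩

theorem integral_mul_spaceDeriv_comm {φ u : ℝ × ℝ → ℂ} (hφ : ContDiff ℝ (⊤ : ℕ∞) φ)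
    (hs : HasCompactSupport φ) (hu : ContDiff ℝ (⊤ : ℕ∞) u) (t : ℝ) :
    ∫ x, φ (t, x) * spaceDeriv (spaceDeriv u) (t, x)
      = ∫ x, spaceDeriv (spaceDeriv φ) (t, x) * u (t, x) := by
  have hint : ∀ {f g : ℝ × ℝ → ℂ}, ContDiff ℝ (⊤ : ℕ∞) f → HasCompactSupport f →
      ContDiff ℝ (⊤ : ℕ∞) g → Integrable fun x => f (t, x) * g (t, x) := by
    intro f g hf hfs hg
    have h1 := hf.continuous
    have h2 := hg.continuous
    exact (by fun_prop : Continuous fun x => f (t, x) * g (t, x)).integrable_of_hasCompactSupport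
      (hasCompactSupport_slice hfs t).mul_right
  have hφ' := contDiff_spaceDeriv hφ
  have hs' : HasCompactSupport (spaceDeriv φ) := hs.fderiv_apply ℝ (0, 1)
  have hu' := contDiff_spaceDeriv hu
  rw [integral_mul_deriv_eq_deriv_mul_of_integrable
    (fun x _ => hasDerivAt_spaceDeriv hφ t x) (fun x _ => hasDerivAt_spaceDeriv hu' t x)
    (hint hφ hs (contDiff_spaceDeriv hu')) (hint hφ' hs' hu') (hint hφ hs hu'),
    integral_mul_deriv_eq_deriv_mul_of_integrable
    (fun x _ => hasDerivAt_spaceDeriv hφ' t x) (fun x _ => hasDerivAt_spaceDeriv hu t x)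
    (hint hφ' hs' hu') (hint (contDiff_spaceDeriv hφ') (hs'.fderiv_apply ℝ (0, 1)) hu)
    (hint hφ' hs' hu), neg_neg]

/-- The time derivative of ∫ φu is ∫ (φ_t u + iφu_xx). Two integrations by parts in x move u_xx onto
φ, and φ_t + iφ_xx is i times the adjoint operator. Nothing is required of u at spatial infinity
since φ has compact support. -/
theorem integral_mul_sub_integral_mul {φ u : ℝ × ℝ → ℂ} (hφ : ContDiff ℝ (⊤ : ℕ∞) φ)
    (hs : HasCompactSupport φ) (hu : ContDiff ℝ (⊤ : ℕ∞) u)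
    (heq : ∀ p, timeDeriv u p = Complex.I * spaceDeriv (spaceDeriv u) p) {t T : ℝ} (htT : t ≤ T) :
    (∫ x, φ (T, x) * u (T, x)) - ∫ x, φ (t, x) * u (t, x)
      = ∫ τ in t..T, Complex.I * ∫ x, adjointOp φ (τ, x) * u (τ, x) := by
  have hφ1 := contDiff_timeDeriv hφ
  have hu1 := contDiff_timeDeriv hu
  have hs1 : HasCompactSupport (timeDeriv φ) := hs.fderiv_apply ℝ (1, 0)
  set G : ℝ × ℝ → ℂ := fun p => timeDeriv φ p * u p + φ p * timeDeriv u p with hG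
  have hGc : Continuous G :=
    (hφ1.continuous.mul hu.continuous).add (hφ.continuous.mul hu1.continuous)
  have hGs : HasCompactSupport G := hs1.mul_right.add hs.mul_right
  have hsl : ∀ {f g : ℝ × ℝ → ℂ}, ContDiff ℝ (⊤ : ℕ∞) f → HasCompactSupport f →
      ContDiff ℝ (⊤ : ℕ∞) g → ∀ t, Integrable fun x => f (t, x) * g (t, x) := by
    intro f g hf hfs hg t
    have h1 := hf.continuous
    have h2 := hg.continuous
    exact (by fun_prop : Continuous fun x => f (t, x) * g (t, x)).integrable_of_hasCompactSupport
      (hasCompactSupport_slice hfs t).mul_right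
  have h1 : ∀ x, ∫ τ in t..T, G (τ, x) = φ (T, x) * u (T, x) - φ (t, x) * u (t, x) := by
    intro x
    refine intervalIntegral.integral_eq_sub_of_hasDerivAt
      (f := fun τ => φ (τ, x) * u (τ, x)) (fun τ _ => ?_) ?_
    · exact (hasDerivAt_timeDeriv hφ τ x).mul (hasDerivAt_timeDeriv hu τ x)
    · exact (hGc.comp (by fun_prop)).intervalIntegrable _ _
  have h2 : ∀ τ, ∫ x, G (τ, x) = Complex.I * ∫ x, adjointOp φ (τ, x) * u (τ, x) := by
    intro τ
    have e1 : ∫ x, G (τ, x) = (∫ x, timeDeriv φ (τ, x) * u (τ, x))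
        + Complex.I * ∫ x, φ (τ, x) * spaceDeriv (spaceDeriv u) (τ, x) := by
      simp only [hG]
      rw [integral_add (hsl hφ1 hs1 hu τ) (hsl hφ hs hu1 τ), ← integral_const_mul]
      congr 2
      ext x
      rw [heq]
      ring
    rw [e1, integral_mul_spaceDeriv_comm hφ hs hu, ← integral_const_mul, ← integral_const_mul,
      ← integral_add (hsl hφ1 hs1 hu τ) ((hsl (contDiff_spaceDeriv (contDiff_spaceDeriv hφ))
        ((hs.fderiv_apply ℝ (0, 1)).fderiv_apply ℝ (0, 1)) hu τ).const_mul _)]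
    congr 1
    ext x
    rw [adjointOp]
    linear_combination (timeDeriv φ (τ, x) * u (τ, x)) * Complex.I_mul_I
  rw [← integral_sub (hsl hφ hs hu T) (hsl hφ hs hu t)]
  simp_rw [← h1, ← h2]
  simp_rw [intervalIntegral.integral_of_le htT]
  refine integral_integral_swap (f := fun x τ => G (τ, x)) ?_
  have h3 : Integrable G (volume.prod volume) := hGc.integrable_of_hasCompactSupport hGs
  have h4 : Integrable G ((volume.restrict (Set.Ioc t T)).prod volume) :=
    h3.mono_measure (Measure.prod_mono Measure.restrict_le_self le_rfl)
  exact h4.swap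

theorem exists_time_support {φ : ℝ × ℝ → ℂ}
    (hs : HasCompactSupport φ) {t₀ : ℝ} (hsupp : tsupport φ ⊆ Set.Ioi t₀ ×ˢ Set.univ) :
    ∃ α β, t₀ < α ∧ α < β ∧ ∀ t x, t ∉ Set.Ioo α β → φ (t, x) = 0 ∧ adjointOp φ (t, x) = 0 := by
  have hK : IsCompact (Prod.fst '' tsupport φ) := hs.isCompact.image continuous_fst
  have key : ∃ α β, t₀ < α ∧ α < β ∧ Prod.fst '' tsupport φ ⊆ Set.Ioo α β := by
    rcases (Prod.fst '' tsupport φ).eq_empty_or_nonempty with h | h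
    · exact ⟨t₀ + 1, t₀ + 2, by linarith, by linarith, by rw [h]; exact Set.empty_subset _⟩
    · obtain ⟨m, hm, hm'⟩ := hK.exists_isLeast h
      obtain ⟨M, hM, hM'⟩ := hK.exists_isGreatest h
      have h1 : t₀ < m := by
        obtain ⟨p, hp, rfl⟩ := hm
        exact (hsupp hp).1
      have h2 : m ≤ M := hM' hm
      refine ⟨(t₀ + m) / 2, M + 1, by linarith, by linarith, fun t ht => ⟨?_, ?_⟩⟩
      · have := hm' ht; linarith
      · have := hM' ht; linarith
  obtain ⟨α, β, h1, h2, h3⟩ := key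
  refine ⟨α, β, h1, h2, fun t x ht => ?_⟩
  have hn : (t, x) ∉ tsupport φ := fun h => ht (h3 ⟨_, h, rfl⟩)
  exact ⟨image_eq_zero_of_notMem_tsupport hn, by
    by_contra h; exact hn (support_adjointOp_subset h)⟩

/-- The path consists of the conjugates of the slices because the inner product is conjugate-linear
in its first slot. Uniform continuity and a common compact support make it continuous into L². -/
theorem exists_testPath {ψ : ℝ × ℝ → ℂ} (hc : Continuous ψ) (hs : HasCompactSupport ψ) :
    ∃ Ψ : ℝ → L2, Continuous Ψ ∧ (∀ t (f : L2), inner ℂ (Ψ t) f = ∫ x, ψ (t, x) * f x) ∧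
      ∀ t, Ψ t =ᵐ[volume] fun x => (starRingEnd ℂ) (ψ (t, x)) := by
  have hmem : ∀ t, MemLp (fun x => (starRingEnd ℂ) (ψ (t, x))) 2 volume := by
    intro t
    have h1 : Continuous fun x => (starRingEnd ℂ) (ψ (t, x)) :=
      Complex.continuous_conj.comp (by fun_prop)
    exact h1.memLp_of_hasCompactSupport
      ((hasCompactSupport_slice hs t).comp_left (g := starRingEnd ℂ) (map_zero _))
  refine ⟨fun t => (hmem t).toLp, ?_, ?_, ?_⟩
  · obtain ⟨R, hR0, hR⟩ : ∃ R : ℝ, 0 < R ∧ ∀ t x, x ∉ Set.Icc (-R) R → ψ (t, x) = 0 := by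
      obtain ⟨R, hR⟩ := (hs.isCompact.image continuous_snd).isBounded.subset_closedBall 0
      refine ⟨max R 1, by positivity, fun t x hx => ?_⟩
      by_contra h
      have h1 := hR ⟨(t, x), subset_tsupport _ h, rfl⟩
      rw [mem_closedBall_zero_iff, Real.norm_eq_abs] at h1
      exact hx (abs_le.1 (h1.trans (le_max_left _ _)))
    rw [Metric.continuous_iff]
    intro t ε hε
    have huc := hs.uniformContinuous_of_continuous hc
    -- A pointwise bound c on a window of length 2R costs c(2R)^{1/2} = ε/2 in L².
    set c := ε / (2 * (2 * R) ^ (1 / 2 : ℝ)) with hcdef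
    have hcpos : 0 < c := by positivity
    obtain ⟨δ, hδ, hδ'⟩ := Metric.uniformContinuous_iff.1 huc c hcpos
    refine ⟨δ, hδ, fun s hst => ?_⟩
    have hb : ∀ x, ‖ψ (s, x) - ψ (t, x)‖ ≤ c := by
      intro x
      rw [← dist_eq_norm]
      refine (hδ' ?_).le
      rw [Prod.dist_eq]
      simpa using hst
    rw [dist_eq_norm, ← MemLp.toLp_sub, Lp.norm_toLp]
    have h1 : eLpNorm ((fun x => (starRingEnd ℂ) (ψ (s, x))) - fun x => (starRingEnd ℂ) (ψ (t, x)))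
        2 volume ≤ ENNReal.ofReal (c * (2 * R) ^ (1 / 2 : ℝ)) := by
      have h2 : ((fun x => (starRingEnd ℂ) (ψ (s, x))) - fun x => (starRingEnd ℂ) (ψ (t, x)))
          = (Set.Icc (-R) R).indicator ((fun x => (starRingEnd ℂ) (ψ (s, x)))
            - fun x => (starRingEnd ℂ) (ψ (t, x))) := by
        ext x
        by_cases hx : x ∈ Set.Icc (-R) R
        · rw [Set.indicator_of_mem hx]
        · rw [Set.indicator_of_notMem hx, Pi.sub_apply, hR s x hx, hR t x hx, sub_self]
      rw [h2, eLpNorm_indicator_eq_eLpNorm_restrict measurableSet_Icc]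
      refine (eLpNorm_le_of_ae_bound (C := c) (Eventually.of_forall fun x => ?_)).trans
        (le_of_eq ?_)
      · rw [Pi.sub_apply, ← map_sub, RCLike.norm_conj]
        exact hb x
      · rw [Measure.restrict_apply_univ, Real.volume_Icc, ENNReal.ofReal_mul hcpos.le, mul_comm,
          ENNReal.ofReal_rpow_of_nonneg (by linarith) (by norm_num)]
        norm_num
        ring_nf
    refine (ENNReal.toReal_le_of_le_ofReal (by positivity) h1).trans_lt ?_
    rw [hcdef]
    have : 0 < (2 * R) ^ (1 / 2 : ℝ) := by positivity
    field_simp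
    norm_num
  · intro t f
    rw [L2.inner_def]
    apply integral_congr_ae
    filter_upwards [(hmem t).coeFn_toLp] with x hx
    rw [hx, RCLike.inner_apply, RCLike.conj_conj, mul_comm]
  · exact fun t => (hmem t).coeFn_toLp

theorem testPath_eq_zero {f : L2} {g : ℝ → ℂ} (h : f =ᵐ[volume] fun x => (starRingEnd ℂ) (g x))
    (hg : ∀ x, g x = 0) : f = 0 := by
  apply Lp.ext
  filter_upwards [h, Lp.coeFn_zero ℂ 2 (volume : Measure ℝ)] with x h1 h2
  rw [h1, h2, hg x]
  simp

end Calculus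

/-! ### Gaussian wave packets -/

/-- The complex width of the Gaussian wave packet at time `t`. -/
noncomputable def packetWidth (t : ℝ) : ℂ := 1 + 4 * Real.pi * t * Complex.I

theorem packetWidth_re (t : ℝ) : (packetWidth t).re = 1 := by simp [packetWidth]

theorem packetWidth_ne_zero (t : ℝ) : packetWidth t ≠ 0 := by
  intro h
  have := packetWidth_re t
  rw [h] at this
  simp at this

theorem one_le_norm_packetWidth (t : ℝ) : 1 ≤ ‖packetWidth t‖ := by
  have := Complex.abs_re_le_norm (packetWidth t)
  rwa [packetWidth_re, abs_one] at this

theorem contDiff_packetWidth : ContDiff ℝ (⊤ : ℕ∞) packetWidth := by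
  unfold packetWidth
  exact contDiff_const.add ((contDiff_const.mul Complex.ofRealCLM.contDiff).mul contDiff_const)

theorem hasDerivAt_packetWidth (t : ℝ) :
    HasDerivAt packetWidth (4 * Real.pi * Complex.I) t := by
  have h := (((Complex.ofRealCLM.hasDerivAt (x := t)).const_mul (4 * Real.pi : ℂ)).mul_const
    Complex.I).const_add 1
  exact h.congr_deriv (by simp)

/-- A Gaussian wave packet, an explicit solution of the free Schrödinger equation. -/
noncomputable def wavePacket (x₀ : ℝ) (p : ℝ × ℝ) : ℂ :=
  Complex.exp (-(1 / 2) * Complex.log (packetWidth p.1)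
    - Real.pi / packetWidth p.1 * (p.2 - x₀) ^ 2)

/-- The width has real part 1 for all t, so the principal logarithm gives one smooth branch of its
square root for all times. -/
theorem packetWidth_mem_slitPlane (t : ℝ) : packetWidth t ∈ Complex.slitPlane :=
  Or.inl (by rw [packetWidth_re]; exact one_pos)

theorem contDiff_wavePacket (x₀ : ℝ) : ContDiff ℝ (⊤ : ℕ∞) (wavePacket x₀) := by
  unfold wavePacket
  have h1 : ContDiff ℝ (⊤ : ℕ∞) fun p : ℝ × ℝ => packetWidth p.1 :=
    contDiff_packetWidth.comp contDiff_fst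
  have h2 : ContDiff ℝ (⊤ : ℕ∞) fun p : ℝ × ℝ => Complex.log (packetWidth p.1) := by
    rw [contDiff_iff_contDiffAt]
    intro p
    exact ((Complex.contDiffAt_log (packetWidth_mem_slitPlane p.1)).restrict_scalars ℝ).comp p
      h1.contDiffAt
  have h3 : ContDiff ℝ (⊤ : ℕ∞) fun p : ℝ × ℝ => ((p.2 : ℂ) - x₀) ^ 2 :=
    ((Complex.ofRealCLM.contDiff.comp contDiff_snd).sub contDiff_const).pow 2
  refine ContDiff.cexp ?_
  refine (contDiff_const.mul h2).sub (ContDiff.mul ?_ h3)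
  simp_rw [div_eq_mul_inv]
  exact contDiff_const.mul (h1.inv fun p => packetWidth_ne_zero p.1)

theorem hasDerivAt_wavePacket_time (x₀ t x : ℝ) :
    HasDerivAt (fun s => wavePacket x₀ (s, x)) (wavePacket x₀ (t, x) *
      (-2 * Real.pi * Complex.I / packetWidth t
        + 4 * Real.pi ^ 2 * Complex.I / packetWidth t ^ 2 * (x - x₀) ^ 2)) t := by
  have hb := hasDerivAt_packetWidth t
  have hb0 := packetWidth_ne_zero t
  have h1 : HasDerivAt (fun s => Complex.log (packetWidth s))
      (4 * Real.pi * Complex.I / packetWidth t) t :=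
    hb.clog_real (packetWidth_mem_slitPlane t)
  have h2 : HasDerivAt (fun s => (Real.pi : ℂ) / packetWidth s)
      (-(Real.pi * (4 * Real.pi * Complex.I)) / packetWidth t ^ 2) t := by
    have := (hasDerivAt_const t (Real.pi : ℂ)).div hb hb0
    exact this.congr_deriv (by simp)
  have h3 := ((h1.const_mul (-(1 / 2))).sub (h2.mul_const (((x : ℂ) - x₀) ^ 2))).cexp
  refine h3.congr_deriv ?_
  simp only [wavePacket]
  congr 1
  field_simp
  ring

theorem hasDerivAt_wavePacket_space (x₀ t x : ℝ) :
    HasDerivAt (fun y => wavePacket x₀ (t, y)) (wavePacket x₀ (t, x) *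
      (-2 * Real.pi / packetWidth t * (x - x₀))) x := by
  have h1 : HasDerivAt (fun y : ℝ => ((y : ℂ) - x₀) ^ 2) (2 * (x - x₀)) x := by
    have := ((Complex.ofRealCLM.hasDerivAt (x := x)).sub_const (x₀ : ℂ)).pow 2
    exact this.congr_deriv (by simp)
  have h2 := ((h1.const_mul ((Real.pi : ℂ) / packetWidth t)).const_sub
    (-(1 / 2) * Complex.log (packetWidth t))).cexp
  refine h2.congr_deriv ?_
  simp only [wavePacket]
  congr 1
  ring

theorem spaceDeriv_wavePacket (x₀ t x : ℝ) : spaceDeriv (wavePacket x₀) (t, x)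
    = wavePacket x₀ (t, x) * (-2 * Real.pi / packetWidth t * (x - x₀)) :=
  (hasDerivAt_spaceDeriv (contDiff_wavePacket x₀) t x).unique (hasDerivAt_wavePacket_space x₀ t x)

theorem timeDeriv_wavePacket (x₀ : ℝ) (p : ℝ × ℝ) :
    timeDeriv (wavePacket x₀) p = Complex.I * spaceDeriv (spaceDeriv (wavePacket x₀)) p := by
  obtain ⟨t, x⟩ := p
  have hu := contDiff_wavePacket x₀
  have hb0 := packetWidth_ne_zero t
  rw [(hasDerivAt_timeDeriv hu t x).unique (hasDerivAt_wavePacket_time x₀ t x)]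
  have h1 : HasDerivAt (fun y : ℝ => -2 * (Real.pi : ℂ) / packetWidth t * (y - x₀))
      (-2 * Real.pi / packetWidth t) x := by
    have := ((Complex.ofRealCLM.hasDerivAt (x := x)).sub_const (x₀ : ℂ)).const_mul
      (-2 * (Real.pi : ℂ) / packetWidth t)
    simpa using this
  have h2 := (hasDerivAt_wavePacket_space x₀ t x).mul h1
  have h3 := hasDerivAt_spaceDeriv (contDiff_spaceDeriv hu) t x
  rw [show (fun y => spaceDeriv (wavePacket x₀) (t, y)) = fun y => wavePacket x₀ (t, y)
    * (-2 * Real.pi / packetWidth t * (y - x₀)) from funext fun y => spaceDeriv_wavePacket x₀ t y]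
    at h3
  rw [h3.unique h2]
  field_simp
  ring

theorem norm_wavePacket_le (x₀ t x : ℝ) : ‖wavePacket x₀ (t, x)‖
    ≤ Real.exp (-(Real.pi / ‖packetWidth t‖ ^ 2 * (x - x₀) ^ 2)) := by
  rw [wavePacket, Complex.norm_exp]
  apply Real.exp_le_exp.2
  have h1 : (Complex.log (packetWidth t)).re = Real.log ‖packetWidth t‖ := Complex.log_re _
  have h2 : 0 ≤ Real.log ‖packetWidth t‖ := Real.log_nonneg (one_le_norm_packetWidth t)
  have h3 : ((Real.pi : ℂ) / packetWidth t * ((x : ℂ) - x₀) ^ 2).re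
      = Real.pi / ‖packetWidth t‖ ^ 2 * (x - x₀) ^ 2 := by
    have : (Real.pi : ℂ) / packetWidth t * ((x : ℂ) - x₀) ^ 2
        = ((Real.pi * (x - x₀) ^ 2 : ℝ) : ℂ) * (packetWidth t)⁻¹ := by
      push_cast; ring
    rw [this, Complex.re_ofReal_mul, Complex.inv_re, packetWidth_re, Complex.normSq_eq_norm_sq]
    ring
  have h4 : (-(1 / 2) * Complex.log (packetWidth t)).re = -(1 / 2) * Real.log ‖packetWidth t‖ := by
    rw [← h1, show (-(1 / 2) : ℂ) = ((-(1 / 2) : ℝ) : ℂ) by push_cast; ring, Complex.re_ofReal_mul]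
  rw [Complex.sub_re, h3, h4]
  linarith

theorem memLp_gaussian {c : ℝ} (hc : 0 < c) (x₀ : ℝ) (q : ℝ≥0∞) (hq : q = 1 ∨ q = 2) :
    MemLp (fun x : ℝ => Real.exp (-(c * (x - x₀) ^ 2))) q volume := by
  have hcont : Continuous fun x : ℝ => Real.exp (-(c * (x - x₀) ^ 2)) := by fun_prop
  have h1 : ∀ c : ℝ, 0 < c → Integrable fun x : ℝ => Real.exp (-(c * (x - x₀) ^ 2)) := by
    intro c hc
    have := (integrable_exp_neg_mul_sq hc).comp_sub_right x₀
    simpa using this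
  rcases hq with rfl | rfl
  · exact memLp_one_iff_integrable.2 (h1 c hc)
  · rw [memLp_two_iff_integrable_sq hcont.aestronglyMeasurable]
    refine (h1 (2 * c) (by positivity)).congr (Eventually.of_forall fun x => ?_)
    simp only
    rw [← Real.exp_nat_mul]
    congr 1
    push_cast
    ring

theorem memLp_wavePacket (x₀ t : ℝ) (q : ℝ≥0∞) (hq : q = 1 ∨ q = 2) :
    MemLp (fun x => wavePacket x₀ (t, x)) q volume := by
  have hpos : 0 < Real.pi / ‖packetWidth t‖ ^ 2 := by
    have := one_le_norm_packetWidth t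
    have := Real.pi_pos
    positivity
  refine (memLp_gaussian hpos x₀ q hq).mono
    (Continuous.aestronglyMeasurable ?_) (Eventually.of_forall fun x => ?_)
  · exact (contDiff_wavePacket x₀).continuous.comp (by fun_prop)
  · rw [Real.norm_of_nonneg (Real.exp_nonneg _)]
    exact norm_wavePacket_le x₀ t x

/-- The wave packet at time `t` as an element of `L²`. -/
noncomputable def packetVec (x₀ t : ℝ) : L2 := (memLp_wavePacket x₀ t 2 (Or.inr rfl)).toLp

theorem packetVec_ae (x₀ t : ℝ) :
    packetVec x₀ t =ᵐ[volume] fun x => wavePacket x₀ (t, x) := MemLp.coeFn_toLp _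

theorem fourier_packetVec (x₀ t : ℝ) : (𝓕 (packetVec x₀ t) : L2) =ᵐ[volume] fun ξ =>
    Complex.exp (-Real.pi * packetWidth t * ξ ^ 2 - 2 * Real.pi * Complex.I * x₀ * ξ) := by
  have hb0 := packetWidth_ne_zero t
  have hint : Integrable (packetVec x₀ t) :=
    (integrable_congr (packetVec_ae x₀ t)).2
      (memLp_one_iff_integrable.1 (memLp_wavePacket x₀ t 1 (Or.inl rfl)))
  refine (fourier_ae_eq_of_integrable _ hint).trans (Eventually.of_forall fun ξ => ?_)
  rw [Real.fourier_congr_ae (packetVec_ae x₀ t)]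
  set b := packetWidth t with hb
  have hbinv : 0 < (b⁻¹).re := by
    rw [Complex.inv_re, packetWidth_re]
    have : 0 < Complex.normSq b := Complex.normSq_pos.2 hb0
    positivity
  have hform : (fun x : ℝ => wavePacket x₀ (t, x)) = fun x : ℝ =>
      (Complex.exp (-(1 / 2) * Complex.log b - Real.pi / b * x₀ ^ 2)) •
        Complex.exp (-Real.pi * b⁻¹ * x ^ 2 + 2 * Real.pi * (x₀ / b) * x) := by
    ext x
    rw [wavePacket, smul_eq_mul, ← Complex.exp_add]
    congr 1
    rw [← hb]
    field_simp
    ring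
  have hcs : 𝓕 (fun x : ℝ => (Complex.exp (-(1 / 2) * Complex.log b - Real.pi / b * x₀ ^ 2)) •
        Complex.exp (-Real.pi * b⁻¹ * x ^ 2 + 2 * Real.pi * (x₀ / b) * x)) ξ
      = Complex.exp (-(1 / 2) * Complex.log b - Real.pi / b * x₀ ^ 2) *
        𝓕 (fun x : ℝ => Complex.exp (-Real.pi * b⁻¹ * x ^ 2 + 2 * Real.pi * (x₀ / b) * x)) ξ := by
    simp_rw [Real.fourier_real_eq_integral_exp_smul, smul_eq_mul]
    rw [← integral_const_mul]
    congr 1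
    ext x
    ring
  have harg : b.arg ≠ Real.pi := by
    intro h
    rw [Complex.arg_eq_pi_iff, packetWidth_re] at h
    linarith [h.1]
  have hpow : 1 / (b⁻¹) ^ (1 / 2 : ℂ) = Complex.exp (1 / 2 * Complex.log b) := by
    rw [Complex.inv_cpow _ _ harg, one_div, inv_inv, Complex.cpow_def_of_ne_zero hb0, mul_comm]
  rw [hform, hcs, fourier_gaussian_pi' hbinv, hpow]
  beta_reduce
  rw [← Complex.exp_add, ← Complex.exp_add]
  congr 1
  field_simp
  linear_combination (-(x₀ : ℂ) ^ 2 * (2 * Real.pi)) * Complex.I_sq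

/-- The transform of the packet is e^{-πb(t)ξ²} times a translation factor, and b(t) = 1 + 4πit
contributes exactly the symbol. This identifies the group, defined on the Fourier side, with a
classical solution of the equation. -/
theorem freeGroup_packetVec (x₀ t : ℝ) : freeGroup t (packetVec x₀ 0) = packetVec x₀ t := by
  apply fourier_injective
  apply Lp.ext
  filter_upwards [fourier_freeGroup t (packetVec x₀ 0), fourier_packetVec x₀ 0,
    fourier_packetVec x₀ t] with ξ h1 h2 h3
  rw [h1, h2, h3, schrodingerSymbol, ← Complex.exp_add]
  congr 1
  simp only [packetWidth]
  push_cast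
  ring

/-- By Plancherel, the inner products with all translates of the Gaussian are the values of the
Fourier transform of e^{-πξ²}f̂. If they vanish then so does f̂, as the Gaussian has no zeros.
Identities in L² can therefore be checked against packets. -/
theorem eq_zero_of_inner_packetVec (f : L2) (h : ∀ x₀, inner ℂ (packetVec x₀ 0) f = 0) : f = 0 := by
  have hE : MemLp (fun ξ : ℝ => Complex.exp (-Real.pi * ξ ^ 2)) 2 volume := by
    refine (memLp_gaussian Real.pi_pos 0 2 (Or.inr rfl)).mono
      (Continuous.aestronglyMeasurable (by fun_prop)) (Eventually.of_forall fun ξ => ?_)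
    rw [Complex.norm_exp, Real.norm_of_nonneg (Real.exp_nonneg _)]
    apply le_of_eq
    congr 1
    have : (-(Real.pi : ℂ) * ξ ^ 2) = ((-(Real.pi * ξ ^ 2) : ℝ) : ℂ) := by push_cast; ring
    rw [this, Complex.ofReal_re]
    simp
  set F : L2 := 𝓕 f with hF
  set k : ℝ → ℂ := fun ξ => Complex.exp (-Real.pi * ξ ^ 2) * F ξ with hk
  have hk1 : Integrable k := hE.integrable_mul (Lp.memLp F)
  have hk2 : MemLp k 2 volume := by
    refine (Lp.memLp F).mono (hk1.aestronglyMeasurable) (Eventually.of_forall fun ξ => ?_)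
    rw [hk, norm_mul, Complex.norm_exp]
    refine mul_le_of_le_one_left (norm_nonneg _) ?_
    rw [Real.exp_le_one_iff]
    have : (-(Real.pi : ℂ) * ξ ^ 2) = ((-(Real.pi * ξ ^ 2) : ℝ) : ℂ) := by push_cast; ring
    rw [this, Complex.ofReal_re]
    have := Real.pi_pos
    have : 0 ≤ Real.pi * ξ ^ 2 := by positivity
    linarith
  have hzero : ∀ x, 𝓕 k x = 0 := by
    intro x
    rw [← h (-x), ← Lp.inner_fourier_eq, L2.inner_def, Real.fourier_real_eq_integral_exp_smul]
    apply integral_congr_ae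
    filter_upwards [fourier_packetVec (-x) 0] with ξ h1
    rw [RCLike.inner_apply, h1, ← Complex.exp_conj, smul_eq_mul, hk]
    simp only
    rw [← mul_assoc, ← Complex.exp_add, mul_comm (F ξ)]
    congr 2
    simp only [packetWidth]
    simp [Complex.conj_ofNat]
    ring
  have hK : (𝓕 hk2.toLp : L2) = 0 := by
    apply Lp.ext
    have hi : Integrable (hk2.toLp : L2) := (integrable_congr hk2.coeFn_toLp).2 hk1
    filter_upwards [fourier_ae_eq_of_integrable _ hi, Lp.coeFn_zero ℂ 2 (volume : Measure ℝ)]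
      with ξ h1 h2
    rw [h1, h2, Real.fourier_congr_ae hk2.coeFn_toLp, hzero]
    rfl
  have hK0 : hk2.toLp = 0 := by
    rw [← norm_eq_zero, ← Lp.norm_fourier_eq, hK, norm_zero]
  have hF0 : F = 0 := by
    apply Lp.ext
    filter_upwards [hk2.coeFn_toLp, Lp.coeFn_zero ℂ 2 (volume : Measure ℝ)] with ξ h1 h2
    rw [hK0, h2] at h1
    rw [h2]
    have h3 : Complex.exp (-Real.pi * ξ ^ 2) * F ξ = 0 := h1.symm
    exact (mul_eq_zero.1 h3).resolve_left (Complex.exp_ne_zero _)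
  rw [← norm_eq_zero, ← Lp.norm_fourier_eq, ← hF, hF0, norm_zero]

/-! ### Mild solutions are weak solutions -/

/-- Duhamel's formula for `Z_t = i Z_xx + F` on `[t₀, ∞)`. -/
def IsMildSolution (t₀ : ℝ) (Z F : ℝ → L2) : Prop :=
  ∀ T, t₀ ≤ T → freeGroup (-T) (Z T)
    = freeGroup (-t₀) (Z t₀) + ∫ τ in t₀..T, freeGroup (-τ) (F τ)

/-- `Z_t = i Z_xx + F` on `(t₀, ∞) × ℝ` in the sense of distributions. -/
def IsWeakSolution (t₀ : ℝ) (Z F : ℝ → L2) : Prop :=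
  ∀ φ : ℝ × ℝ → ℂ, ContDiff ℝ (⊤ : ℕ∞) φ → HasCompactSupport φ →
    tsupport φ ⊆ Set.Ioi t₀ ×ˢ Set.univ →
      ∫ t in Set.Ioi t₀, ((∫ x, adjointOp φ (t, x) * Z t x)
        - Complex.I * ∫ x, φ (t, x) * F t x) = 0

/-- The integral of the derivative of ⟨X, Y⟩, where X vanishes outside (α, β). The derivative y of Y
is merely integrable, so Y is written as Y(β) minus an integral over the future and Fubini replaces
the product rule. The constant Y(β) drops out because x has mean zero. -/
theorem integral_inner_add_inner_eq_zero {E : Type*} [NormedAddCommGroup E]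
    [InnerProductSpace ℂ E] [CompleteSpace E] {X x Y y : ℝ → E} {t₀ α β : ℝ} (hα : t₀ < α)
    (hαβ : α < β) (hx : Integrable x) (hxs : ∀ s, s ∉ Set.Ioo α β → x s = 0)
    (hXc : Continuous X) (hX : ∀ τ, X τ = ∫ s in Set.Iio τ, x s) (hx0 : ∫ s, x s = 0)
    (hy : IntegrableOn y (Set.Ioc t₀ β)) (hY : ∀ t ∈ Set.Icc t₀ β, Y t = Y t₀ + ∫ s in t₀..t, y s) :
    ∫ t in Set.Ioi t₀, (inner ℂ (x t) (Y t) + inner ℂ (X t) (y t)) = 0 := by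
  set B : ℝ → E := (Set.Ioc t₀ β).indicator y with hB
  have hBi : Integrable B := (integrable_indicator_iff measurableSet_Ioc).2 hy
  have hXβ : ∀ t, β ≤ t → X t = 0 := by
    intro t ht
    rw [hX, ← hx0]
    refine setIntegral_eq_integral_of_forall_compl_eq_zero fun s hs => hxs s fun h => hs ?_
    exact h.2.trans_le ht
  have hYs : ∀ s ∈ Set.Ioo α β, Y s = Y β - ∫ τ in Set.Ioi s, B τ := by
    intro s hs
    have h1 : ∫ τ in Set.Ioi s, B τ = ∫ τ in s..β, y τ := by
      rw [hB, setIntegral_indicator measurableSet_Ioc, intervalIntegral.integral_of_le hs.2.le]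
      congr 2
      ext τ
      simp only [Set.mem_inter_iff, Set.mem_Ioi, Set.mem_Ioc]
      exact ⟨fun h => ⟨h.1, h.2.2⟩, fun h => ⟨h.1, (hα.trans hs.1).trans h.1, h.2⟩⟩
    have h2 : ∀ a b, t₀ ≤ a → a ≤ b → b ≤ β → IntervalIntegrable y volume a b := by
      intro a b h1 h2 h3
      rw [intervalIntegrable_iff_integrableOn_Ioc_of_le h2]
      exact hy.mono_set (Set.Ioc_subset_Ioc h1 h3)
    rw [h1, hY s ⟨(hα.trans hs.1).le, hs.2.le⟩, hY β ⟨(hα.trans hαβ).le, le_rfl⟩,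
      ← intervalIntegral.integral_add_adjacent_intervals
        (h2 t₀ s le_rfl (hα.trans hs.1).le hs.2.le) (h2 s β (hα.trans hs.1).le hs.2.le le_rfl)]
    abel
  have i1 : Integrable fun t => inner ℂ (x t) (Y β) := hx.inner_const _
  have i2 : Integrable fun t => inner ℂ (x t) (∫ τ in Set.Ioi t, B τ) := by
    refine (hx.norm.mul_const (∫ τ, ‖B τ‖)).mono (hx.aestronglyMeasurable.inner
      (continuous_integral_Ioi hBi).aestronglyMeasurable) (Eventually.of_forall fun t => ?_)
    have h1 : ‖∫ τ in Set.Ioi t, B τ‖ ≤ ∫ τ, ‖B τ‖ :=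
      (norm_integral_le_integral_norm _).trans
        (setIntegral_le_integral hBi.norm (Eventually.of_forall fun _ => norm_nonneg _))
    have h2 : 0 ≤ ∫ τ, ‖B τ‖ := integral_nonneg fun _ => norm_nonneg _
    rw [norm_mul, norm_norm, Real.norm_of_nonneg h2]
    exact (norm_inner_le_norm _ _).trans (mul_le_mul_of_nonneg_left h1 (norm_nonneg _))
  have i3 : Integrable fun t => inner ℂ (X t) (B t) := by
    refine (hBi.norm.const_mul (∫ τ, ‖x τ‖)).mono (hXc.aestronglyMeasurable.inner
      hBi.aestronglyMeasurable) (Eventually.of_forall fun t => ?_)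
    have h1 : ‖X t‖ ≤ ∫ τ, ‖x τ‖ := by
      rw [hX]
      exact (norm_integral_le_integral_norm _).trans
        (setIntegral_le_integral hx.norm (Eventually.of_forall fun _ => norm_nonneg _))
    have h2 : 0 ≤ ∫ τ, ‖x τ‖ := integral_nonneg fun _ => norm_nonneg _
    rw [norm_mul, norm_norm, Real.norm_of_nonneg h2]
    exact (norm_inner_le_norm _ _).trans (mul_le_mul_of_nonneg_right h1 (norm_nonneg _))
  have hmain : ∫ t in Set.Ioi t₀, (inner ℂ (x t) (Y t) + inner ℂ (X t) (y t))
      = ∫ t, (inner ℂ (x t) (Y β) - inner ℂ (x t) (∫ τ in Set.Ioi t, B τ)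
          + inner ℂ (X t) (B t)) := by
    rw [← integral_indicator measurableSet_Ioi]
    congr 1
    ext t
    by_cases ht : t ∈ Set.Ioi t₀
    · rw [Set.indicator_of_mem ht]
      congr 1
      · by_cases hs : t ∈ Set.Ioo α β
        · rw [hYs t hs, inner_sub_right]
        · rw [hxs t hs]; simp
      · rcases le_or_gt t β with h | h
        · rw [hB, Set.indicator_of_mem (show t ∈ Set.Ioc t₀ β from ⟨ht, h⟩)]
        · rw [hXβ t h.le]; simp
    · rw [Set.indicator_of_notMem ht, hB, Set.indicator_of_notMem (fun h => ht h.1),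
        hxs t (fun h => ht (hα.trans h.1))]
      simp
  have i12 : Integrable fun t => inner ℂ (x t) (Y β) - inner ℂ (x t) (∫ τ in Set.Ioi t, B τ) :=
    i1.sub i2
  rw [hmain, integral_add i12 i3, integral_sub i1 i2, integral_inner_right hx, hx0,
    integral_inner_integral_Ioi hx hBi]
  simp_rw [← hX]
  simp

/-- Differentiation of a test function in the interaction picture. Paired with a packet, which moves
by the group and solves the free equation pointwise, it becomes the classical identity
`integral_mul_sub_integral_mul`; totality of the packets finishes. -/
theorem integral_freeGroup_testPath {φ : ℝ × ℝ → ℂ} (hφ : ContDiff ℝ (⊤ : ℕ∞) φ)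
    (hs : HasCompactSupport φ) {Φ Ψ : ℝ → L2} (hΨc : Continuous Ψ)
    (hΦ : ∀ t (f : L2), inner ℂ (Φ t) f = ∫ x, φ (t, x) * f x)
    (hΨ : ∀ t (f : L2), inner ℂ (Ψ t) f = ∫ x, adjointOp φ (t, x) * f x) {t T : ℝ} (htT : t ≤ T) :
    freeGroup (-T) (Φ T) - freeGroup (-t) (Φ t)
      = ∫ τ in t..T, -Complex.I • freeGroup (-τ) (Ψ τ) := by
  rw [← sub_eq_zero]
  refine eq_zero_of_inner_packetVec _ fun x₀ => ?_
  have hcont : Continuous fun τ => -Complex.I • freeGroup (-τ) (Ψ τ) :=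
    (Continuous.freeGroup continuous_neg hΨc).const_smul (-Complex.I)
  have h1 : ∀ (τ : ℝ) (f : L2), inner ℂ (packetVec x₀ 0) (freeGroup (-τ) f)
      = (starRingEnd ℂ) (inner ℂ f (packetVec x₀ τ)) := by
    intro τ f
    rw [inner_freeGroup_neg, freeGroup_packetVec, inner_conj_symm]
  have h2 : ∀ (ψ : ℝ × ℝ → ℂ) τ, ∫ x, ψ (τ, x) * packetVec x₀ τ x
      = ∫ x, ψ (τ, x) * wavePacket x₀ (τ, x) := by
    intro ψ τ
    apply integral_congr_ae
    filter_upwards [packetVec_ae x₀ τ] with x hx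
    rw [hx]
  rw [inner_sub_right, inner_sub_right, h1, h1, hΦ, hΦ, h2, h2, ← map_sub,
    integral_mul_sub_integral_mul hφ hs (contDiff_wavePacket x₀) (timeDeriv_wavePacket x₀) htT,
    intervalIntegral.integral_of_le htT, intervalIntegral.integral_of_le htT,
    ← integral_inner ((intervalIntegrable_iff_integrableOn_Ioc_of_le htT).1
      (hcont.intervalIntegrable _ _)), ← integral_conj, sub_eq_zero]
  congr 1
  ext τ
  rw [inner_smul_right, h1, hΨ, h2, map_mul, Complex.conj_I]

/-- After pulling everything back by e^{-it∂ₓ²}, the solution is a primitive of the pulled-back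
forcing and the test path is a primitive of the pulled-back adjoint expression. By unitarity the
weak integrand is -i times the derivative of their inner product. -/
theorem IsMildSolution.isWeakSolution {t₀ : ℝ} {Z F : ℝ → L2} (h : IsMildSolution t₀ Z F)
    (hF : ∀ T, IntegrableOn F (Set.Ioc t₀ T)) : IsWeakSolution t₀ Z F := by
  intro φ hφ hs hsupp
  obtain ⟨Φ, hΦc, hΦ, hΦae⟩ := exists_testPath hφ.continuous hs
  obtain ⟨Ψ, hΨc, hΨ, hΨae⟩ := exists_testPath (contDiff_adjointOp hφ).continuous
    (hasCompactSupport_adjointOp hs)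
  obtain ⟨α, β, hα, hαβ, hzero⟩ := exists_time_support hs hsupp
  have hΦ0 : ∀ t, t ∉ Set.Ioo α β → Φ t = 0 := fun t ht =>
    testPath_eq_zero (hΦae t) fun x => (hzero t x ht).1
  have hΨ0 : ∀ t, t ∉ Set.Ioo α β → Ψ t = 0 := fun t ht =>
    testPath_eq_zero (hΨae t) fun x => (hzero t x ht).2
  set X : ℝ → L2 := fun t => freeGroup (-t) (Φ t) with hX
  set x : ℝ → L2 := fun t => -Complex.I • freeGroup (-t) (Ψ t) with hx
  have hXc : Continuous X := Continuous.freeGroup continuous_neg hΦc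
  have hxc : Continuous x := (Continuous.freeGroup continuous_neg hΨc).const_smul (-Complex.I)
  have hX0 : ∀ t, t ∉ Set.Ioo α β → X t = 0 := fun t ht => by
    simp only [hX]; rw [hΦ0 t ht, map_zero]
  have hx0 : ∀ t, t ∉ Set.Ioo α β → x t = 0 := fun t ht => by
    simp only [hx]; rw [hΨ0 t ht, map_zero, smul_zero]
  have hxi : Integrable x := hxc.integrable_of_hasCompactSupport
    (HasCompactSupport.intro (isCompact_Icc (a := α) (b := β)) fun t ht =>
      hx0 t fun h => ht (Set.Ioo_subset_Icc_self h))
  have hdiff : ∀ t T, t ≤ T → X T - X t = ∫ τ in t..T, x τ := fun t T htT =>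
    integral_freeGroup_testPath hφ hs hΨc hΦ hΨ htT
  have hXint : ∀ τ, X τ = ∫ s in Set.Iio τ, x s := by
    intro τ
    have h1 : ∫ s in Set.Iic (min τ α), x s = 0 := by
      rw [← integral_zero ℝ L2 (μ := volume.restrict (Set.Iic (min τ α)))]
      refine setIntegral_congr_fun measurableSet_Iic fun s hs => hx0 s fun h => ?_
      exact absurd h.1 (not_lt.2 ((show s ≤ min τ α from hs).trans (min_le_right _ _)))
    have h2 := hdiff (min τ α) τ (min_le_left _ _)
    rw [hX0 (min τ α) (fun h => absurd h.1 (not_lt.2 (min_le_right _ _))), sub_zero,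
      ← intervalIntegral.integral_Iic_sub_Iic hxi.integrableOn hxi.integrableOn, h1, sub_zero] at h2
    rw [h2, integral_Iic_eq_integral_Iio]
  have hxint : ∫ s, x s = 0 := by
    rw [← hX0 β (fun h => lt_irrefl _ h.2), hXint]
    exact (setIntegral_eq_integral_of_forall_compl_eq_zero fun s hs =>
      hx0 s fun h => hs h.2).symm
  have key := integral_inner_add_inner_eq_zero (Y := fun t => freeGroup (-t) (Z t))
    (y := fun t => freeGroup (-t) (F t)) hα hαβ hxi hx0 hXc hXint hxint
    (integrable_freeGroup_neg (hF β)) (fun t ht => h t ht.1)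
  have hfinal : ∀ t, (∫ x, adjointOp φ (t, x) * Z t x) - Complex.I * ∫ x, φ (t, x) * F t x
      = -Complex.I * (inner ℂ (x t) (freeGroup (-t) (Z t))
        + inner ℂ (X t) (freeGroup (-t) (F t))) := by
    intro t
    simp only [hx, hX]
    rw [inner_smul_left, LinearIsometry.inner_map_map, LinearIsometry.inner_map_map, hΦ, hΨ,
      map_neg, Complex.conj_I, neg_neg, mul_add, ← mul_assoc, neg_mul, Complex.I_mul_I]
    ring
  simp_rw [hfinal]
  rw [integral_const_mul, key, mul_zero]

/-! ### Weak solutions are mild solutions -/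

/-- The du Bois-Reymond lemma on a half-line. -/
theorem exists_eq_const_of_integral_deriv_mul_eq_zero {t₀ : ℝ} {e : ℝ → ℂ}
    (he : ContinuousOn e (Set.Ici t₀))
    (h : ∀ χ : ℝ → ℝ, ContDiff ℝ (⊤ : ℕ∞) χ → HasCompactSupport χ → tsupport χ ⊆ Set.Ioi t₀ →
      ∫ t in Set.Ioi t₀, ((deriv χ t : ℝ) : ℂ) * e t = 0) :
    ∃ c, ∀ t, t₀ ≤ t → e t = c := by
  obtain ⟨ρ, hρs, hρc, hρ, hρ1⟩ : ∃ ρ : ℝ → ℝ, tsupport ρ ⊆ Set.Ioi t₀ ∧ HasCompactSupport ρ ∧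
      ContDiff ℝ (⊤ : ℕ∞) ρ ∧ ∫ t, ρ t = 1 := by
    let b : ContDiffBump (t₀ + 2) := ⟨1 / 2, 1, by norm_num, by norm_num⟩
    refine ⟨b.normed volume, ?_, b.hasCompactSupport_normed, b.contDiff_normed,
      b.integral_normed⟩
    rw [b.tsupport_normed_eq]
    intro t ht
    rw [Metric.mem_closedBall, Real.dist_eq, abs_le] at ht
    have : (b.rOut : ℝ) = 1 := rfl
    rw [this] at ht
    show t₀ < t
    linarith [ht.1]
  set c : ℂ := ∫ t in Set.Ioi t₀, (ρ t : ℂ) * e t with hc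
  have hloc : LocallyIntegrableOn (fun t => e t - c) (Set.Ioi t₀) volume :=
    ((he.mono Set.Ioi_subset_Ici_self).sub continuousOn_const).locallyIntegrableOn
      measurableSet_Ioi
  have hint : ∀ g : ℝ → ℝ, ContDiff ℝ (⊤ : ℕ∞) g → HasCompactSupport g → tsupport g ⊆ Set.Ioi t₀ →
      IntegrableOn (fun t => (g t : ℂ) * e t) (Set.Ioi t₀) := by
    intro g hg hgc hgs
    have h1 : IntegrableOn (fun t => (g t : ℂ) * e t) (tsupport g) := by
      refine ContinuousOn.integrableOn_compact hgc.isCompact ?_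
      exact (Complex.continuous_ofReal.comp hg.continuous).continuousOn.mul
        (he.mono (hgs.trans Set.Ioi_subset_Ici_self))
    refine (integrableOn_iff_integrable_of_support_subset ?_).1 h1 |>.integrableOn
    intro t ht
    refine subset_tsupport _ fun h => ht ?_
    simp [h]
  have hae : ∀ᵐ t, t ∈ Set.Ioi t₀ → e t - c = 0 := by
    refine isOpen_Ioi.ae_eq_zero_of_integral_contDiff_smul_eq_zero hloc fun g hg hgc hgs => ?_
    set m : ℝ := ∫ t, g t with hm
    -- Subtracting m times the normalised bump makes the mean zero, so k is the derivative of a test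
    -- function supported in (t₀, ∞). The hypothesis for that test function says ∫ g(e - c) = 0.
    set k : ℝ → ℝ := fun t => g t - m * ρ t with hk
    have hkd : ContDiff ℝ (⊤ : ℕ∞) k := hg.sub (contDiff_const.mul hρ)
    have hgi : Integrable g := hg.continuous.integrable_of_hasCompactSupport hgc
    have hρi : Integrable ρ := hρ.continuous.integrable_of_hasCompactSupport hρc
    have hki : Integrable k := hgi.sub (hρi.const_mul m)
    have hk0 : ∫ t, k t = 0 := by
      simp only [hk]
      rw [integral_sub hgi (hρi.const_mul m), integral_const_mul, hρ1, ← hm]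
      ring
    set K := tsupport g ∪ tsupport ρ with hK
    have hKc : IsCompact K := hgc.isCompact.union hρc.isCompact
    have hKs : K ⊆ Set.Ioi t₀ := Set.union_subset hgs hρs
    have hkK : ∀ t, t ∉ K → k t = 0 := by
      intro t ht
      have h1 : t ∉ tsupport g := fun h => ht (Or.inl h)
      have h2 : t ∉ tsupport ρ := fun h => ht (Or.inr h)
      simp only [hk]
      rw [image_eq_zero_of_notMem_tsupport h1, image_eq_zero_of_notMem_tsupport h2]
      ring
    obtain ⟨α, β, hα, hKαβ⟩ : ∃ α β, t₀ < α ∧ K ⊆ Set.Icc α β := by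
      rcases K.eq_empty_or_nonempty with h0 | h0
      · exact ⟨t₀ + 1, t₀ + 2, by linarith, by rw [h0]; exact Set.empty_subset _⟩
      · obtain ⟨a, ha, ha'⟩ := hKc.exists_isLeast h0
        obtain ⟨b, hb, hb'⟩ := hKc.exists_isGreatest h0
        exact ⟨a, b, hKs ha, fun t ht => ⟨ha' ht, hb' ht⟩⟩
    set χ : ℝ → ℝ := fun t => ∫ s in α..t, k s with hχ
    have hχd : ∀ t, HasDerivAt χ (k t) t := fun t =>
      intervalIntegral.integral_hasDerivAt_right (hkd.continuous.intervalIntegrable _ _)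
        (hkd.continuous.stronglyMeasurableAtFilter _ _) hkd.continuous.continuousAt
    have hderiv : deriv χ = k := funext fun t => (hχd t).deriv
    have hχc : ContDiff ℝ (⊤ : ℕ∞) χ := by
      rw [contDiff_infty_iff_deriv]
      exact ⟨fun t => (hχd t).differentiableAt, by rw [hderiv]; exact hkd⟩
    have hχ0 : ∀ t, t ∉ Set.Icc α β → χ t = 0 := by
      intro t ht
      rw [Set.mem_Icc, not_and_or, not_le, not_le] at ht
      rcases ht with ht | ht
      · simp only [hχ]
        rw [intervalIntegral.integral_congr (g := fun _ => 0), intervalIntegral.integral_zero]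
        intro s hs
        rw [Set.uIcc_of_ge ht.le] at hs
        rcases eq_or_lt_of_le hs.2 with h1 | h1
        -- The endpoint α may belong to the support; there k vanishes by continuity from the left.
        · have hcl : k α = 0 := by
            have : closure (Set.Iio α) ⊆ {s | k s = 0} :=
              closure_minimal (fun s hs => hkK s fun h => absurd (hKαβ h).1 (not_le.2 hs))
                (isClosed_eq hkd.continuous continuous_const)
            rw [closure_Iio] at this
            exact this (Set.mem_Iic.2 le_rfl)
          simp only [h1, hcl]
        · exact hkK s fun h => absurd (hKαβ h).1 (not_le.2 h1)
      · simp only [hχ]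
        have h1 : ∫ s in Set.Iic α, k s = 0 := by
          rw [integral_Iic_eq_integral_Iio, ← integral_zero ℝ ℝ
            (μ := volume.restrict (Set.Iio α))]
          exact setIntegral_congr_fun measurableSet_Iio fun s hs =>
            hkK s fun h => absurd (hKαβ h).1 (not_le.2 hs)
        rw [← intervalIntegral.integral_Iic_sub_Iic hki.integrableOn hki.integrableOn, h1, sub_zero,
          ← hk0]
        exact setIntegral_eq_integral_of_forall_compl_eq_zero fun s hs =>
          hkK s fun h => hs ((hKαβ h).2.trans ht.le)
    have hχs : tsupport χ ⊆ Set.Icc α β :=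
      closure_minimal (fun t ht => by_contra fun h' => ht (hχ0 t h')) isClosed_Icc
    have h1 := h χ hχc (HasCompactSupport.intro isCompact_Icc hχ0)
      (hχs.trans fun t ht => hα.trans_le ht.1)
    rw [hderiv] at h1
    have h2 : ∫ t in Set.Ioi t₀, (k t : ℂ) * e t
        = (∫ t in Set.Ioi t₀, (g t : ℂ) * e t) - m * c := by
      rw [hc, ← integral_const_mul, ← integral_sub (hint g hg hgc hgs)
        ((hint ρ hρ hρc hρs).const_mul _)]
      congr 1
      ext t
      simp only [hk]
      push_cast
      ring
    rw [h2, sub_eq_zero] at h1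
    have hgz : ∀ t, t ∉ Set.Ioi t₀ → g t = 0 := fun t ht =>
      image_eq_zero_of_notMem_tsupport fun h => ht (hgs h)
    have h3 : ∫ t, g t • (e t - c) = ∫ t in Set.Ioi t₀, ((g t : ℂ) * e t - g t * c) := by
      rw [← setIntegral_eq_integral_of_forall_compl_eq_zero (s := Set.Ioi t₀)
        (fun t ht => by rw [hgz t ht, zero_smul])]
      congr 1
      ext t
      rw [Complex.real_smul]
      ring
    have h4 : ∫ t in Set.Ioi t₀, (g t : ℂ) = m := by
      rw [setIntegral_eq_integral_of_forall_compl_eq_zero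
        (fun t ht => by rw [hgz t ht, Complex.ofReal_zero]), hm, integral_complex_ofReal]
    have hgc' : IntegrableOn (fun t => (g t : ℂ) * c) (Set.Ioi t₀) :=
      (hgi.ofReal.mul_const c).integrableOn
    rw [h3, integral_sub (hint g hg hgc hgs) hgc', h1,
      integral_mul_const, h4, sub_self]
  refine ⟨c, fun t ht => ?_⟩
  have hd : ∀ t ∈ Set.Ioi t₀, e t = c := by
    have h1 : e =ᵐ[volume.restrict (Set.Ioi t₀)] fun _ => c := by
      rw [EventuallyEq, ae_restrict_iff' measurableSet_Ioi]
      filter_upwards [hae] with t ht h using sub_eq_zero.1 (ht h)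
    exact Measure.eqOn_open_of_ae_eq h1 isOpen_Ioi (he.mono Set.Ioi_subset_Ici_self)
      continuousOn_const
  have hcl : Set.EqOn e (fun _ => c) (Set.Ici t₀) :=
    Set.EqOn.of_subset_closure hd he continuousOn_const Set.Ioi_subset_Ici_self
      (by rw [closure_Ioi])
  exact hcl ht

theorem spaceDeriv_eq_of_hasDerivAt {φ : ℝ × ℝ → ℂ} (hφ : ContDiff ℝ (⊤ : ℕ∞) φ) {t x : ℝ} {d : ℂ}
    (h : HasDerivAt (fun y => φ (t, y)) d x) : spaceDeriv φ (t, x) = d :=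
  (hasDerivAt_spaceDeriv hφ t x).unique h

theorem timeDeriv_eq_of_hasDerivAt {φ : ℝ × ℝ → ℂ} (hφ : ContDiff ℝ (⊤ : ℕ∞) φ) {t x : ℝ} {d : ℂ}
    (h : HasDerivAt (fun s => φ (s, x)) d t) : timeDeriv φ (t, x) = d :=
  (hasDerivAt_timeDeriv hφ t x).unique h

section Cutoff

variable {χ g : ℝ → ℝ} {w : ℝ × ℝ → ℂ}

theorem contDiff_cutoff (hχ : ContDiff ℝ (⊤ : ℕ∞) χ) (hg : ContDiff ℝ (⊤ : ℕ∞) g)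
    (hw : ContDiff ℝ (⊤ : ℕ∞) w) :
    ContDiff ℝ (⊤ : ℕ∞) fun p : ℝ × ℝ => (χ p.1 : ℂ) * (g p.2 * w p) :=
  (Complex.ofRealCLM.contDiff.comp (hχ.comp contDiff_fst)).mul
    ((Complex.ofRealCLM.contDiff.comp (hg.comp contDiff_snd)).mul hw)

theorem adjointOp_cutoff (hχ : ContDiff ℝ (⊤ : ℕ∞) χ) (hg : ContDiff ℝ (⊤ : ℕ∞) g)
    (hw : ContDiff ℝ (⊤ : ℕ∞) w) (t x : ℝ) :
    adjointOp (fun p : ℝ × ℝ => (χ p.1 : ℂ) * (g p.2 * w p)) (t, x)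
      = -Complex.I * deriv χ t * g x * w (t, x)
        + χ t * ((deriv (deriv g) x : ℝ) * w (t, x)
            + 2 * (deriv g x : ℝ) * spaceDeriv w (t, x))
        + χ t * g x * adjointOp w (t, x) := by
  have hφ := contDiff_cutoff hχ hg hw
  have hg' : ContDiff ℝ (⊤ : ℕ∞) (deriv g) := (contDiff_infty_iff_deriv.1 hg).2
  have dχ : HasDerivAt (fun s => (χ s : ℂ)) (deriv χ t : ℝ) t :=
    ((hχ.differentiable (by simp)) t).hasDerivAt.ofReal_comp
  have dg : ∀ x, HasDerivAt (fun y => (g y : ℂ)) (deriv g x : ℝ) x := fun x =>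
    ((hg.differentiable (by simp)) x).hasDerivAt.ofReal_comp
  have dg' : HasDerivAt (fun y => ((deriv g y : ℝ) : ℂ)) (deriv (deriv g) x : ℝ) x :=
    ((hg'.differentiable (by simp)) x).hasDerivAt.ofReal_comp
  have ht : timeDeriv (fun p : ℝ × ℝ => (χ p.1 : ℂ) * (g p.2 * w p)) (t, x)
      = (deriv χ t : ℝ) * (g x * w (t, x)) + χ t * (g x * timeDeriv w (t, x)) := by
    apply timeDeriv_eq_of_hasDerivAt hφ
    exact dχ.mul ((hasDerivAt_timeDeriv hw t x).const_mul (g x : ℂ))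
  have hx1 : ∀ x, spaceDeriv (fun p : ℝ × ℝ => (χ p.1 : ℂ) * (g p.2 * w p)) (t, x)
      = χ t * ((deriv g x : ℝ) * w (t, x) + g x * spaceDeriv w (t, x)) := by
    intro x
    apply spaceDeriv_eq_of_hasDerivAt hφ
    exact ((dg x).mul (hasDerivAt_spaceDeriv hw t x)).const_mul (χ t : ℂ)
  have hx2 : spaceDeriv (spaceDeriv (fun p : ℝ × ℝ => (χ p.1 : ℂ) * (g p.2 * w p))) (t, x)
      = χ t * (((deriv (deriv g) x : ℝ) * w (t, x) + (deriv g x : ℝ) * spaceDeriv w (t, x))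
        + ((deriv g x : ℝ) * spaceDeriv w (t, x) + g x * spaceDeriv (spaceDeriv w) (t, x))) := by
    apply spaceDeriv_eq_of_hasDerivAt (contDiff_spaceDeriv hφ)
    rw [funext hx1]
    exact ((dg'.mul (hasDerivAt_spaceDeriv hw t x)).add
      ((dg x).mul (hasDerivAt_spaceDeriv (contDiff_spaceDeriv hw) t x))).const_mul (χ t : ℂ)
  rw [adjointOp, ht, hx2, adjointOp]
  ring

end Cutoff

/-- Smooth compactly supported cutoffs with uniformly bounded derivatives. -/
theorem exists_cutoff : ∃ (g : ℕ → ℝ → ℝ) (C : ℝ), 1 ≤ C ∧ ∀ n,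
    ContDiff ℝ (⊤ : ℕ∞) (g n) ∧ HasCompactSupport (g n) ∧ (∀ x, |g n x| ≤ C) ∧
    (∀ x, |deriv (g n) x| ≤ C) ∧ (∀ x, |deriv (deriv (g n)) x| ≤ C) ∧
    ∀ x : ℝ, |x| < n → g n x = 1 ∧ deriv (g n) x = 0 ∧ deriv (deriv (g n)) x = 0 := by
  let b : ContDiffBump (0 : ℝ) := ⟨1, 2, by norm_num, by norm_num⟩
  have hb : ContDiff ℝ (⊤ : ℕ∞) b := b.contDiff
  have hb1 : ContDiff ℝ (⊤ : ℕ∞) (deriv b) := (contDiff_infty_iff_deriv.1 hb).2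
  have hb2 : ContDiff ℝ (⊤ : ℕ∞) (deriv (deriv b)) := (contDiff_infty_iff_deriv.1 hb1).2
  have hbs : HasCompactSupport (b : ℝ → ℝ) := b.hasCompactSupport
  obtain ⟨C0, hC0⟩ := hbs.exists_bound_of_continuous hb.continuous
  obtain ⟨C1, hC1⟩ := hbs.deriv.exists_bound_of_continuous hb1.continuous
  obtain ⟨C2, hC2⟩ := hbs.deriv.deriv.exists_bound_of_continuous hb2.continuous
  -- Dilations of one fixed bump. The shift by 1 covers n = 0 and keeps the factor at most 1, so
  -- derivatives stay uniformly bounded.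
  set c : ℕ → ℝ := fun n => ((n : ℝ) + 1)⁻¹ with hc
  have hcpos : ∀ n, 0 < c n := fun n => by simp only [hc]; positivity
  have hcle : ∀ n, c n ≤ 1 := fun n => by
    simp only [hc]
    exact inv_le_one_of_one_le₀ (by linarith [Nat.cast_nonneg (α := ℝ) n])
  have d1 : ∀ n, deriv (fun x => b (c n * x)) = fun x => c n * deriv b (c n * x) := fun n =>
    funext fun x => by rw [deriv_comp_mul_left (c n) b x, smul_eq_mul]
  have d2 : ∀ n, deriv (deriv (fun x => b (c n * x)))
      = fun x => c n * (c n * deriv (deriv b) (c n * x)) := fun n =>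
    funext fun x => by
      rw [d1, deriv_const_mul_field, deriv_comp_mul_left (c n) (deriv b) x, smul_eq_mul]
  refine ⟨fun n x => b (c n * x), max (max C0 C1) (max C2 1), ?_, fun n => ⟨?_, ?_, ?_, ?_, ?_, ?_⟩⟩
  · exact (le_max_right _ _).trans (le_max_right _ _)
  · exact hb.comp (contDiff_const.mul contDiff_id)
  · exact hbs.comp_homeomorph (Homeomorph.mulLeft₀ (c n) (hcpos n).ne')
  · intro x
    exact (hC0 _).trans ((le_max_left _ _).trans (le_max_left _ _))
  · intro x
    rw [d1, abs_mul, abs_of_pos (hcpos n)]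
    exact (mul_le_of_le_one_left (abs_nonneg _) (hcle n)).trans
      ((hC1 _).trans ((le_max_right _ _).trans (le_max_left _ _)))
  · intro x
    rw [d2, abs_mul, abs_mul, abs_of_pos (hcpos n)]
    refine (mul_le_of_le_one_left (by have := (hcpos n).le; positivity) (hcle n)).trans ?_
    exact (mul_le_of_le_one_left (abs_nonneg _) (hcle n)).trans
      ((hC2 _).trans ((le_max_left _ _).trans (le_max_right _ _)))
  · intro x hx
    have hone : ∀ y : ℝ, |y| < n → b (c n * y) = 1 := by
      intro y hy
      apply b.one_of_mem_closedBall
      rw [mem_closedBall_zero_iff, Real.norm_eq_abs, abs_mul, abs_of_pos (hcpos n)]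
      show c n * |y| ≤ 1
      simp only [hc]
      rw [inv_mul_le_iff₀ (by positivity)]
      linarith
    have hev : ∀ y : ℝ, |y| < n → (fun x => b (c n * x)) =ᶠ[𝓝 y] fun _ => 1 := by
      intro y hy
      filter_upwards [(isOpen_lt continuous_abs continuous_const).mem_nhds hy] with z hz
      exact hone z hz
    have hder : ∀ y : ℝ, |y| < n → deriv (fun x => b (c n * x)) y = 0 := by
      intro y hy
      rw [(hev y hy).deriv_eq, deriv_const]
    refine ⟨hone x hx, hder x hx, ?_⟩
    have : deriv (fun x => b (c n * x)) =ᶠ[𝓝 x] fun _ => 0 := by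
      filter_upwards [(isOpen_lt continuous_abs continuous_const).mem_nhds hx] with z hz
      exact hder z hz
    rw [this.deriv_eq, deriv_const]

/-- The complex conjugate of a wave packet, which is annihilated by `adjointOp`. -/
noncomputable def conjPacket (x₀ : ℝ) (p : ℝ × ℝ) : ℂ := (starRingEnd ℂ) (wavePacket x₀ p)

theorem contDiff_conjPacket (x₀ : ℝ) : ContDiff ℝ (⊤ : ℕ∞) (conjPacket x₀) :=
  Complex.conjCLE.contDiff.comp (contDiff_wavePacket x₀)

theorem spaceDeriv_conj {u : ℝ × ℝ → ℂ} (hu : ContDiff ℝ (⊤ : ℕ∞) u) (p : ℝ × ℝ) :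
    spaceDeriv (fun p => (starRingEnd ℂ) (u p)) p = (starRingEnd ℂ) (spaceDeriv u p) := by
  obtain ⟨t, x⟩ := p
  apply spaceDeriv_eq_of_hasDerivAt (Complex.conjCLE.contDiff.comp hu)
  exact (hasDerivAt_spaceDeriv hu t x).star

theorem timeDeriv_conj {u : ℝ × ℝ → ℂ} (hu : ContDiff ℝ (⊤ : ℕ∞) u) (p : ℝ × ℝ) :
    timeDeriv (fun p => (starRingEnd ℂ) (u p)) p = (starRingEnd ℂ) (timeDeriv u p) := by
  obtain ⟨t, x⟩ := p
  apply timeDeriv_eq_of_hasDerivAt (Complex.conjCLE.contDiff.comp hu)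
  exact (hasDerivAt_timeDeriv hu t x).star

theorem adjointOp_conjPacket (x₀ : ℝ) (p : ℝ × ℝ) : adjointOp (conjPacket x₀) p = 0 := by
  have hu := contDiff_wavePacket x₀
  have h1 : spaceDeriv (conjPacket x₀) = fun p => (starRingEnd ℂ) (spaceDeriv (wavePacket x₀) p) :=
    funext fun p => spaceDeriv_conj hu p
  rw [adjointOp, h1, spaceDeriv_conj (contDiff_spaceDeriv hu)]
  show -Complex.I * timeDeriv (fun p => (starRingEnd ℂ) (wavePacket x₀ p)) p + _ = 0
  rw [timeDeriv_conj hu, timeDeriv_wavePacket, map_mul, Complex.conj_I]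
  linear_combination (starRingEnd ℂ) (spaceDeriv (spaceDeriv (wavePacket x₀)) p) * Complex.I_mul_I

theorem exists_conjPacket_bound (x₀ T : ℝ) : ∃ c K : ℝ, 0 < c ∧ 0 < K ∧ ∀ t x, |t| ≤ T →
    ‖conjPacket x₀ (t, x)‖ ≤ K * Real.exp (-(c * (x - x₀) ^ 2)) ∧
    ‖spaceDeriv (conjPacket x₀) (t, x)‖ ≤ K * Real.exp (-(c * (x - x₀) ^ 2)) := by
  have hπ := Real.pi_pos
  set M : ℝ := 1 + 4 * Real.pi * |T| with hM
  have hMpos : 0 < M := by positivity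
  have hbM : ∀ t, |t| ≤ T → ‖packetWidth t‖ ≤ M := by
    intro t ht
    rw [packetWidth]
    refine (norm_add_le _ _).trans ?_
    simp only [norm_one, norm_mul, Complex.norm_I, Complex.norm_real, Complex.norm_ofNat,
      Real.norm_eq_abs, abs_of_pos hπ, mul_one, hM]
    have := ht.trans (le_abs_self T)
    nlinarith
  set d : ℝ := Real.pi / M ^ 2 with hd
  have hdpos : 0 < d := by positivity
  have hu : ∀ t x, |t| ≤ T → ‖wavePacket x₀ (t, x)‖ ≤ Real.exp (-(d * (x - x₀) ^ 2)) := by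
    intro t x ht
    refine (norm_wavePacket_le x₀ t x).trans (Real.exp_le_exp.2 (neg_le_neg ?_))
    have h1 := hbM t ht
    have h2 := one_le_norm_packetWidth t
    rw [hd]
    gcongr
  refine ⟨d / 2, 1 + 2 * Real.pi * (1 + 2 / d), by positivity, by positivity, fun t x ht => ?_⟩
  set y := x - x₀ with hy
  -- Half of the Gaussian decay is spent on the factor |y| produced by the space derivative.
  have e1 : Real.exp (-(d * y ^ 2)) = Real.exp (-(d / 2 * y ^ 2)) * Real.exp (-(d / 2 * y ^ 2)) := by
    rw [← Real.exp_add]; congr 1; ring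
  have e2 : Real.exp (-(d / 2 * y ^ 2)) ≤ 1 := by
    rw [Real.exp_le_one_iff]
    have : 0 ≤ d / 2 * y ^ 2 := by positivity
    linarith
  have e3 : |y| * Real.exp (-(d / 2 * y ^ 2)) ≤ 1 + 2 / d := by
    rw [Real.exp_neg, ← div_eq_mul_inv, div_le_iff₀ (Real.exp_pos _)]
    have h1 := Real.add_one_le_exp (d / 2 * y ^ 2)
    have h2 : |y| ≤ 1 + y ^ 2 := by
      have := sq_abs y
      nlinarith [sq_nonneg (|y| - 1), abs_nonneg y]
    have h3 : 1 + y ^ 2 ≤ (1 + 2 / d) * (d / 2 * y ^ 2 + 1) := by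
      have : (1 + 2 / d) * (d / 2 * y ^ 2 + 1) = 1 + y ^ 2 + d / 2 * y ^ 2 + 2 / d := by
        field_simp
        ring
      rw [this]
      have : 0 ≤ d / 2 * y ^ 2 := by positivity
      have : 0 < 2 / d := by positivity
      linarith
    refine h2.trans (h3.trans ?_)
    have : 0 < 1 + 2 / d := by positivity
    gcongr
  have e4 := Real.exp_pos (-(d / 2 * y ^ 2))
  have hK : 0 ≤ 2 * Real.pi * (1 + 2 / d) := by positivity
  constructor
  · rw [conjPacket, RCLike.norm_conj]
    refine (hu t x ht).trans ?_
    rw [e1]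
    refine (mul_le_of_le_one_left e4.le e2).trans ?_
    exact le_mul_of_one_le_left e4.le (by linarith)
  · have h1 : spaceDeriv (conjPacket x₀) (t, x)
        = (starRingEnd ℂ) (spaceDeriv (wavePacket x₀) (t, x)) :=
      spaceDeriv_conj (contDiff_wavePacket x₀) _
    rw [h1, RCLike.norm_conj, spaceDeriv_wavePacket, norm_mul]
    have h2 : ‖-2 * (Real.pi : ℂ) / packetWidth t * ((x : ℂ) - x₀)‖ ≤ 2 * Real.pi * |y| := by
      rw [norm_mul, norm_div, norm_mul, norm_neg, Complex.norm_real, Complex.norm_ofNat,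
        Real.norm_of_nonneg hπ.le, ← Complex.ofReal_sub, Complex.norm_real, Real.norm_eq_abs, ← hy]
      gcongr
      exact div_le_self (by positivity) (one_le_norm_packetWidth t)
    calc _ ≤ Real.exp (-(d * y ^ 2)) * (2 * Real.pi * |y|) :=
          mul_le_mul (hu t x ht) h2 (norm_nonneg _) (Real.exp_nonneg _)
      _ = 2 * Real.pi * (|y| * Real.exp (-(d / 2 * y ^ 2))) * Real.exp (-(d / 2 * y ^ 2)) := by
          rw [e1]; ring
      _ ≤ 2 * Real.pi * (1 + 2 / d) * Real.exp (-(d / 2 * y ^ 2)) := by gcongr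
      _ ≤ _ := by gcongr; linarith

theorem inner_packetVec (x₀ t : ℝ) (f : L2) :
    inner ℂ (packetVec x₀ t) f = ∫ x, conjPacket x₀ (t, x) * f x := by
  rw [L2.inner_def]
  apply integral_congr_ae
  filter_upwards [packetVec_ae x₀ t] with x hx
  rw [hx, RCLike.inner_apply, mul_comm, conjPacket]

theorem inner_packetVec_zero_freeGroup_neg (x₀ t : ℝ) (f : L2) :
    inner ℂ (packetVec x₀ 0) (freeGroup (-t) f) = inner ℂ (packetVec x₀ t) f := by
  rw [inner_freeGroup_neg, freeGroup_packetVec]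

theorem continuous_packetVec (x₀ : ℝ) : Continuous (packetVec x₀) := by
  have := continuous_freeGroup_left (packetVec x₀ 0)
  simp_rw [freeGroup_packetVec] at this
  exact this

theorem continuousOn_primitive_Ici {E : Type*} [NormedAddCommGroup E] [NormedSpace ℝ E]
    {t₀ : ℝ} {p : ℝ → E} (hp : ∀ T, IntegrableOn p (Set.Ioc t₀ T)) :
    ContinuousOn (fun T => ∫ τ in t₀..T, p τ) (Set.Ici t₀) := by
  intro t ht
  have ht' : t₀ ≤ t := ht
  have h1 := intervalIntegral.continuousOn_primitive_interval (μ := volume) (f := p) (a := t₀)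
    (b := t + 1) (by
      rw [Set.uIcc_of_le (by linarith), integrableOn_Icc_iff_integrableOn_Ioc]
      exact hp _)
  rw [Set.uIcc_of_le (by linarith)] at h1
  refine (h1 t ⟨ht, by linarith⟩).mono_of_mem_nhdsWithin ?_
  rw [mem_nhdsWithin]
  exact ⟨Set.Iio (t + 1), isOpen_Iio, by simp, fun s hs => ⟨hs.2, le_of_lt hs.1⟩⟩

/-- The conjugate packet is annihilated by the adjoint operator but is not compactly supported. It
is tested after multiplication by χ(t) and a cutoff in x. As the cutoff widens, its derivatives
vanish pointwise while everything stays below one Gaussian, so only the term with χ' survives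
besides the forcing. -/
theorem IsWeakSolution.integral_deriv_mul_inner_packetVec {t₀ : ℝ} {Z F : ℝ → L2}
    (h : IsWeakSolution t₀ Z F) (hZ : Continuous Z) (hF : ∀ T, IntegrableOn F (Set.Ioc t₀ T))
    (x₀ : ℝ) {χ : ℝ → ℝ} (hχ : ContDiff ℝ (⊤ : ℕ∞) χ) (hχc : HasCompactSupport χ)
    (hχs : tsupport χ ⊆ Set.Ioi t₀) :
    ∫ t in Set.Ioi t₀, (((deriv χ t : ℝ) : ℂ) * inner ℂ (packetVec x₀ t) (Z t)
      + χ t * inner ℂ (packetVec x₀ t) (F t)) = 0 := by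
  obtain ⟨g, C, hC1, hg⟩ := exists_cutoff
  have hw := contDiff_conjPacket x₀
  obtain ⟨T, hT⟩ : ∃ T, ∀ t ∈ tsupport χ, |t| ≤ T := by
    obtain ⟨T, hT⟩ := hχc.isCompact.isBounded.subset_closedBall 0
    exact ⟨T, fun t ht => by simpa using hT ht⟩
  have hχ1 : Continuous (deriv χ) := (contDiff_infty_iff_deriv.1 hχ).2.continuous
  obtain ⟨C0, hC0⟩ := hχc.exists_bound_of_continuous hχ.continuous
  obtain ⟨C1, hC1'⟩ := hχc.deriv.exists_bound_of_continuous hχ1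
  set D : ℝ := max C0 C1 with hD
  have hDχ : ∀ t, |χ t| ≤ D := fun t => (hC0 t).trans (le_max_left _ _)
  have hDχ' : ∀ t, |deriv χ t| ≤ D := fun t => (hC1' t).trans (le_max_right _ _)
  have hD0 : 0 ≤ D := (abs_nonneg _).trans (hDχ 0)
  have hχz : ∀ t, t ∉ tsupport χ → χ t = 0 ∧ deriv χ t = 0 := fun t ht =>
    ⟨image_eq_zero_of_notMem_tsupport ht, by
      by_contra h'
      exact ht (support_deriv_subset h')⟩
  obtain ⟨c, K, hc, hK, hbd⟩ := exists_conjPacket_bound x₀ T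
  set E : ℝ → ℝ := fun x => Real.exp (-(c * (x - x₀) ^ 2)) with hE
  have hE0 : ∀ x, 0 ≤ E x := fun x => Real.exp_nonneg _
  -- The factor 4 = 1 + 1 + 2 counts the terms χ'gw, χg''w and 2χg'w_x of the adjoint operator.
  set K0 : ℝ := 4 * (D * (C * K)) with hK0
  have hK0' : 0 ≤ K0 := by positivity
  have hEmem : MemLp (fun x => ((K0 * E x : ℝ) : ℂ)) 2 volume :=
    ((memLp_gaussian hc x₀ 2 (Or.inr rfl)).const_mul K0).ofReal
  set φ : ℕ → ℝ × ℝ → ℂ := fun n p => (χ p.1 : ℂ) * (g n p.2 * conjPacket x₀ p) with hφdef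
  have hφ : ∀ n, ContDiff ℝ (⊤ : ℕ∞) (φ n) := fun n => contDiff_cutoff hχ (hg n).1 hw
  have hφs : ∀ n, HasCompactSupport (φ n) := by
    intro n
    refine HasCompactSupport.intro (hχc.isCompact.prod (hg n).2.1.isCompact) fun p hp => ?_
    rw [Set.mem_prod, not_and_or] at hp
    simp only [hφdef]
    rcases hp with hp | hp
    · rw [(hχz _ hp).1]; simp
    · rw [image_eq_zero_of_notMem_tsupport hp]; simp
  have hφt : ∀ n, tsupport (φ n) ⊆ Set.Ioi t₀ ×ˢ Set.univ := by
    intro n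
    refine (closure_minimal (t := tsupport χ ×ˢ Set.univ) ?_
      ((isClosed_tsupport χ).prod isClosed_univ)).trans (Set.prod_mono hχs le_rfl)
    intro p hp
    refine ⟨by_contra fun h' => hp ?_, trivial⟩
    simp only [hφdef]
    rw [(hχz _ h').1]
    simp
  have hadj : ∀ n t x, adjointOp (φ n) (t, x) = -Complex.I * deriv χ t * g n x * conjPacket x₀ (t, x)
      + χ t * ((deriv (deriv (g n)) x : ℝ) * conjPacket x₀ (t, x)
          + 2 * (deriv (g n) x : ℝ) * spaceDeriv (conjPacket x₀) (t, x)) := by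
    intro n t x
    simp only [hφdef]
    rw [adjointOp_cutoff hχ (hg n).1 hw, adjointOp_conjPacket]
    ring
  have hbφ : ∀ n t x, ‖φ n (t, x)‖ ≤ K0 * E x := by
    intro n t x
    by_cases ht : t ∈ tsupport χ
    · have h1 := (hbd t x (hT t ht)).1
      simp only [hφdef]
      rw [norm_mul, norm_mul, Complex.norm_real, Complex.norm_real]
      calc ‖χ t‖ * (‖g n x‖ * ‖conjPacket x₀ (t, x)‖) ≤ D * (C * (K * E x)) := by
            gcongr
            · exact hDχ t
            · exact (hg n).2.2.1 x
        _ ≤ K0 * E x := by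
            have : 0 ≤ D * (C * (K * E x)) := by have := hE0 x; positivity
            rw [hK0]; linarith
    · simp only [hφdef]
      rw [(hχz t ht).1]
      have := hE0 x
      simp only [Complex.ofReal_zero, zero_mul, norm_zero]
      positivity
  have hbadj : ∀ n t x, ‖adjointOp (φ n) (t, x)‖ ≤ K0 * E x := by
    intro n t x
    rw [hadj]
    by_cases ht : t ∈ tsupport χ
    · obtain ⟨h1, h2⟩ := hbd t x (hT t ht)
      refine (norm_add_le _ _).trans ?_
      have e1 : ‖-Complex.I * deriv χ t * g n x * conjPacket x₀ (t, x)‖ ≤ D * C * (K * E x) := by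
        rw [norm_mul, norm_mul, norm_mul, norm_neg, Complex.norm_I, one_mul, Complex.norm_real,
          Complex.norm_real]
        gcongr
        · exact hDχ' t
        · exact (hg n).2.2.1 x
      have e2 : ‖(χ t : ℂ) * ((deriv (deriv (g n)) x : ℝ) * conjPacket x₀ (t, x)
          + 2 * (deriv (g n) x : ℝ) * spaceDeriv (conjPacket x₀) (t, x))‖
          ≤ D * (C * (K * E x) + 2 * C * (K * E x)) := by
        rw [norm_mul, Complex.norm_real]
        have e3 := norm_add_le (((deriv (deriv (g n)) x : ℝ) : ℂ) * conjPacket x₀ (t, x))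
          (2 * (deriv (g n) x : ℝ) * spaceDeriv (conjPacket x₀) (t, x))
        rw [norm_mul, norm_mul, norm_mul, Complex.norm_real, Complex.norm_real,
          Complex.norm_ofNat] at e3
        have e4 := (hg n).2.2.2.1 x
        have e5 := (hg n).2.2.2.2.1 x
        refine mul_le_mul (hDχ t) (e3.trans ?_) (norm_nonneg _) hD0
        rw [Real.norm_eq_abs, Real.norm_eq_abs]
        gcongr
      refine (add_le_add e1 e2).trans (le_of_eq ?_)
      rw [hK0]
      ring
    · rw [(hχz t ht).1, (hχz t ht).2]
      have := hE0 x
      simp only [Complex.ofReal_zero, zero_mul, mul_zero, add_zero, norm_zero]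
      positivity
  have hDint : ∀ f : L2, Integrable fun x => K0 * E x * ‖f x‖ := fun f =>
    ((memLp_gaussian hc x₀ 2 (Or.inr rfl)).const_mul K0).integrable_mul (Lp.memLp f).norm
  have hlim1 : ∀ t (f : L2), Tendsto (fun n => ∫ x, adjointOp (φ n) (t, x) * f x) atTop
      (𝓝 (∫ x, -Complex.I * deriv χ t * conjPacket x₀ (t, x) * f x)) := by
    intro t f
    refine tendsto_integral_of_dominated_convergence _ (fun n => ?_) (hDint f) (fun n => ?_) ?_
    · exact (((contDiff_adjointOp (hφ n)).continuous.comp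
        (Continuous.prodMk_right t)).aestronglyMeasurable).mul (Lp.aestronglyMeasurable f)
    · refine Eventually.of_forall fun x => ?_
      rw [norm_mul]
      exact mul_le_mul_of_nonneg_right (hbadj n t x) (norm_nonneg _)
    · refine Eventually.of_forall fun x => tendsto_const_nhds.congr' ?_
      filter_upwards [eventually_gt_atTop ⌈|x|⌉₊] with n hn
      have hn' : |x| < n := (Nat.le_ceil _).trans_lt (by exact_mod_cast hn)
      obtain ⟨h1, h2, h3⟩ := (hg n).2.2.2.2.2 x hn'
      rw [hadj, h1, h2, h3]
      simp
  have hlim2 : ∀ t (f : L2), Tendsto (fun n => ∫ x, φ n (t, x) * f x) atTop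
      (𝓝 (∫ x, χ t * conjPacket x₀ (t, x) * f x)) := by
    intro t f
    refine tendsto_integral_of_dominated_convergence _ (fun n => ?_) (hDint f) (fun n => ?_) ?_
    · exact (((hφ n).continuous.comp
        (Continuous.prodMk_right t)).aestronglyMeasurable).mul (Lp.aestronglyMeasurable f)
    · refine Eventually.of_forall fun x => ?_
      rw [norm_mul]
      exact mul_le_mul_of_nonneg_right (hbφ n t x) (norm_nonneg _)
    · refine Eventually.of_forall fun x => tendsto_const_nhds.congr' ?_
      filter_upwards [eventually_gt_atTop ⌈|x|⌉₊] with n hn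
      have hn' : |x| < n := (Nat.le_ceil _).trans_lt (by exact_mod_cast hn)
      obtain ⟨h1, -, -⟩ := (hg n).2.2.2.2.2 x hn'
      simp only [hφdef]
      rw [h1]
      simp
  choose Φ hΦc hΦ hΦae using fun n => exists_testPath (hφ n).continuous (hφs n)
  choose Ψ hΨc hΨ hΨae using fun n => exists_testPath (contDiff_adjointOp (hφ n)).continuous
    (hasCompactSupport_adjointOp (hφs n))
  set V : L2 := hEmem.toLp with hV
  have hnorm : ∀ (f : L2) (k : ℝ → ℂ), (f =ᵐ[volume] fun x => (starRingEnd ℂ) (k x)) →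
      (∀ x, ‖k x‖ ≤ K0 * E x) → ‖f‖ ≤ ‖V‖ := by
    intro f k hf hk
    refine Lp.norm_le_norm_of_ae_le ?_
    filter_upwards [hf, hEmem.coeFn_toLp] with x h1 h2
    rw [h1, h2, RCLike.norm_conj, Complex.norm_real]
    exact (hk x).trans (le_abs_self _)
  have hFm : AEStronglyMeasurable F (volume.restrict (Set.Ioi t₀)) := by
    have : Set.Ioi t₀ = ⋃ n : ℕ, Set.Ioc t₀ (t₀ + n) := by
      ext t
      simp only [Set.mem_Ioi, Set.mem_iUnion, Set.mem_Ioc]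
      refine ⟨fun ht => ?_, fun ⟨n, hn⟩ => hn.1⟩
      obtain ⟨n, hn⟩ := exists_nat_ge (t - t₀)
      exact ⟨n, ht, by linarith⟩
    rw [this]
    exact AEStronglyMeasurable.iUnion fun n => (hF _).aestronglyMeasurable
  set A : ℕ → ℝ → ℂ := fun n t => (∫ x, adjointOp (φ n) (t, x) * Z t x)
    - Complex.I * ∫ x, φ n (t, x) * F t x with hA
  have hAeq : ∀ n t, A n t = inner ℂ (Ψ n t) (Z t) - Complex.I * inner ℂ (Φ n t) (F t) := by
    intro n t
    rw [hΨ, hΦ]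
  set bound : ℝ → ℝ := (Set.Ioc t₀ T).indicator fun t => ‖V‖ * (‖Z t‖ + ‖F t‖) with hbound
  have hlim : Tendsto (fun n => ∫ t in Set.Ioi t₀, A n t) atTop
      (𝓝 (∫ t in Set.Ioi t₀, ((∫ x, -Complex.I * deriv χ t * conjPacket x₀ (t, x) * Z t x)
        - Complex.I * ∫ x, χ t * conjPacket x₀ (t, x) * F t x))) := by
    refine tendsto_integral_of_dominated_convergence bound (fun n => ?_) ?_ (fun n => ?_) ?_
    · rw [show A n = fun t => inner ℂ (Ψ n t) (Z t) - Complex.I * inner ℂ (Φ n t) (F t) from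
        funext (hAeq n)]
      exact ((hΨc n).inner hZ).aestronglyMeasurable.sub
        (((hΦc n).aestronglyMeasurable.inner hFm).const_mul _)
    · rw [hbound]
      refine Integrable.integrableOn ((integrable_indicator_iff measurableSet_Ioc).2 ?_)
      refine Integrable.const_mul (Integrable.add ?_ (hF T).norm) _
      exact (hZ.norm.integrableOn_Icc (a := t₀) (b := T)).mono_set Set.Ioc_subset_Icc_self
    · filter_upwards [ae_restrict_mem measurableSet_Ioi] with t ht
      by_cases hs : t ∈ tsupport χ
      · rw [hbound, Set.indicator_of_mem (show t ∈ Set.Ioc t₀ T from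
          ⟨ht, (le_abs_self t).trans (hT t hs)⟩), hAeq, mul_add]
        refine (norm_sub_le _ _).trans (add_le_add ?_ ?_)
        · exact (norm_inner_le_norm _ _).trans (mul_le_mul_of_nonneg_right
            (hnorm _ _ (hΨae n t) (hbadj n t)) (norm_nonneg _))
        · rw [norm_mul, Complex.norm_I, one_mul]
          exact (norm_inner_le_norm _ _).trans (mul_le_mul_of_nonneg_right
            (hnorm _ _ (hΦae n t) (hbφ n t)) (norm_nonneg _))
      · have h0 : A n t = 0 := by
          simp only [hA]
          simp_rw [hadj]
          simp only [hφdef]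
          rw [(hχz t hs).1, (hχz t hs).2]
          simp
        rw [h0, norm_zero]
        exact Set.indicator_nonneg (fun _ _ => by positivity) _
    · exact Eventually.of_forall fun t => (hlim1 t (Z t)).sub ((hlim2 t (F t)).const_mul _)
  have hzero : ∀ n, ∫ t in Set.Ioi t₀, A n t = 0 := fun n => h (φ n) (hφ n) (hφs n) (hφt n)
  have hfin := tendsto_nhds_unique hlim (tendsto_const_nhds.congr fun n => (hzero n).symm)
  have hid : ∀ t, (∫ x, -Complex.I * deriv χ t * conjPacket x₀ (t, x) * Z t x)
        - Complex.I * ∫ x, χ t * conjPacket x₀ (t, x) * F t x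
      = -Complex.I * (((deriv χ t : ℝ) : ℂ) * inner ℂ (packetVec x₀ t) (Z t)
        + χ t * inner ℂ (packetVec x₀ t) (F t)) := by
    intro t
    simp_rw [mul_assoc]
    rw [integral_const_mul, integral_const_mul, integral_const_mul, inner_packetVec,
      inner_packetVec]
    ring
  simp_rw [hid] at hfin
  rw [integral_const_mul] at hfin
  exact (mul_eq_zero.1 hfin).resolve_left (neg_ne_zero.2 Complex.I_ne_zero)

/-- For each packet, its inner product with Z, minus the primitive of its inner product with F, has
zero derivative as a distribution and is continuous on [t₀, ∞), hence constant. This is Duhamel's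
formula tested against the packet, and packets are total. -/
theorem IsWeakSolution.isMildSolution {t₀ : ℝ} {Z F : ℝ → L2} (h : IsWeakSolution t₀ Z F)
    (hZ : Continuous Z) (hF : ∀ T, IntegrableOn F (Set.Ioc t₀ T)) : IsMildSolution t₀ Z F := by
  intro T hT
  rw [← sub_eq_zero]
  refine eq_zero_of_inner_packetVec _ fun x₀ => ?_
  set q : ℝ → ℂ := fun t => inner ℂ (packetVec x₀ t) (Z t) with hq
  set p : ℝ → ℂ := fun t => inner ℂ (packetVec x₀ t) (F t) with hp
  have hqc : Continuous q := (continuous_packetVec x₀).inner hZ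
  have hpi : ∀ T, IntegrableOn p (Set.Ioc t₀ T) := by
    intro T
    have h1 := (integrable_freeGroup_neg (hF T)).const_inner (𝕜 := ℂ) (packetVec x₀ 0)
    simp_rw [inner_packetVec_zero_freeGroup_neg] at h1
    exact h1
  set P : ℝ → ℂ := fun T => ∫ τ in t₀..T, p τ with hP
  have hPc : ContinuousOn P (Set.Ici t₀) := continuousOn_primitive_Ici hpi
  obtain ⟨c, hc⟩ := exists_eq_const_of_integral_deriv_mul_eq_zero (t₀ := t₀)
    (e := fun t => q t - P t) (hqc.continuousOn.sub hPc) (fun χ hχ hχc hχs => by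
      have h1 := h.integral_deriv_mul_inner_packetVec hZ hF x₀ hχ hχc hχs
      have hχ1 : Continuous (deriv χ) := (contDiff_infty_iff_deriv.1 hχ).2.continuous
      obtain ⟨α, β, hα, hαβ, hz⟩ : ∃ α β, t₀ < α ∧ α < β ∧
          ∀ t, t ∉ Set.Ioo α β → χ t = 0 ∧ deriv χ t = 0 := by
        have key : ∃ α β, t₀ < α ∧ α < β ∧ tsupport χ ⊆ Set.Ioo α β := by
          rcases (tsupport χ).eq_empty_or_nonempty with h0 | h0
          · exact ⟨t₀ + 1, t₀ + 2, by linarith, by linarith, by rw [h0]; exact Set.empty_subset _⟩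
          · obtain ⟨m, hm, hm'⟩ := hχc.isCompact.exists_isLeast h0
            obtain ⟨M, hM, hM'⟩ := hχc.isCompact.exists_isGreatest h0
            have h1 : t₀ < m := hχs hm
            have h2 : m ≤ M := hM' hm
            refine ⟨(t₀ + m) / 2, M + 1, by linarith, by linarith, fun t ht => ⟨?_, ?_⟩⟩
            · have := hm' ht; linarith
            · have := hM' ht; linarith
        obtain ⟨α, β, h1, h2, h3⟩ := key
        exact ⟨α, β, h1, h2, fun t ht => ⟨image_eq_zero_of_notMem_tsupport fun h' => ht (h3 h'),
          by_contra fun h' => ht (h3 (support_deriv_subset h'))⟩⟩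
      have hd : ∀ t, HasDerivAt (fun t => (χ t : ℂ)) ((deriv χ t : ℝ) : ℂ) t := fun t =>
        ((hχ.differentiable (by simp)) t).hasDerivAt.ofReal_comp
      have hdc : Continuous fun t => ((deriv χ t : ℝ) : ℂ) := Complex.continuous_ofReal.comp hχ1
      have hdi : Integrable fun t => ((deriv χ t : ℝ) : ℂ) :=
        (hχ1.integrable_of_hasCompactSupport hχc.deriv).ofReal
      have hdiff : ∀ s t, ∫ τ in s..t, ((deriv χ τ : ℝ) : ℂ) = χ t - χ s := fun s t =>
        intervalIntegral.integral_eq_sub_of_hasDerivAt (fun τ _ => hd τ)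
          (hdc.intervalIntegrable _ _)
      have hXint : ∀ τ, (χ τ : ℂ) = ∫ s in Set.Iio τ, ((deriv χ s : ℝ) : ℂ) := by
        intro τ
        have e1 : ∫ s in Set.Iic α, ((deriv χ s : ℝ) : ℂ) = 0 := by
          rw [← integral_zero ℝ ℂ (μ := volume.restrict (Set.Iic α))]
          exact setIntegral_congr_fun measurableSet_Iic fun s hs => by
            simp only [(hz s fun h => absurd h.1 (not_lt.2 hs)).2, Complex.ofReal_zero]
        have e2 := hdiff α τ
        rw [(hz α fun h => lt_irrefl _ h.1).1, Complex.ofReal_zero, sub_zero,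
          ← intervalIntegral.integral_Iic_sub_Iic hdi.integrableOn hdi.integrableOn, e1,
          sub_zero] at e2
        rw [← e2, integral_Iic_eq_integral_Iio]
      have hint0 : ∫ s, ((deriv χ s : ℝ) : ℂ) = 0 := by
        rw [← Complex.ofReal_zero, ← (hz β fun h => lt_irrefl _ h.2).1, hXint]
        exact (setIntegral_eq_integral_of_forall_compl_eq_zero fun s hs => by
          rw [(hz s fun h => hs h.2).2, Complex.ofReal_zero]).symm
      -- The same integration by parts on scalars trades ∫ χp for -∫ χ'P.
      have h2 := integral_inner_add_inner_eq_zero (X := fun t => (χ t : ℂ))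
        (x := fun t => ((deriv χ t : ℝ) : ℂ)) (Y := P) (y := p) hα hαβ hdi
        (fun s hs => by rw [(hz s hs).2, Complex.ofReal_zero])
        (Complex.continuous_ofReal.comp hχ.continuous) hXint hint0 (hpi β) (fun t _ => by
          simp only [hP, intervalIntegral.integral_same, zero_add])
      have hconj : ∀ (r : ℝ) (z : ℂ), inner ℂ (r : ℂ) z = r * z := fun r z => by
        rw [RCLike.inner_apply, Complex.conj_ofReal, mul_comm]
      simp_rw [hconj] at h2
      have i1 : ∀ {k : ℝ → ℂ}, ContinuousOn k (Set.Ici t₀) →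
          IntegrableOn (fun t => ((deriv χ t : ℝ) : ℂ) * k t) (Set.Ioi t₀) := by
        intro k hk
        have : IntegrableOn (fun t => ((deriv χ t : ℝ) : ℂ) * k t) (Set.Icc α β) :=
          ContinuousOn.integrableOn_compact isCompact_Icc
            (hdc.continuousOn.mul (hk.mono fun t ht => (hα.trans_le ht.1).le))
        refine ((integrableOn_iff_integrable_of_support_subset fun t ht => ?_).1 this).integrableOn
        by_contra h'
        refine ht ?_
        simp only [(hz t fun h => h' (Set.Ioo_subset_Icc_self h)).2, Complex.ofReal_zero, zero_mul]
      have i2 : IntegrableOn (fun t => (χ t : ℂ) * p t) (Set.Ioi t₀) := by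
        obtain ⟨C0, hC0⟩ := hχc.exists_bound_of_continuous hχ.continuous
        have e1 : IntegrableOn (fun t => (χ t : ℂ) * p t) (Set.Ioc t₀ β) :=
          (hpi β).bdd_mul (c := C0)
            (Complex.continuous_ofReal.comp hχ.continuous).aestronglyMeasurable
            (Eventually.of_forall fun t => by rw [Complex.norm_real]; exact hC0 t)
        refine ((integrableOn_iff_integrable_of_support_subset fun t ht => ?_).1 e1).integrableOn
        by_contra h'
        refine ht ?_
        have : t ∉ Set.Ioo α β := fun h => h' ⟨hα.trans h.1, h.2.le⟩
        simp only [(hz t this).1, Complex.ofReal_zero, zero_mul]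
      have h3 : ∀ t, ((deriv χ t : ℝ) : ℂ) * (q t - P t) = (((deriv χ t : ℝ) : ℂ) * q t + χ t * p t)
          - (((deriv χ t : ℝ) : ℂ) * P t + χ t * p t) := fun t => by ring
      simp_rw [h3]
      have i3 := i1 hqc.continuousOn
      have i4 := i1 hPc
      have i5 : IntegrableOn (fun t => ((deriv χ t : ℝ) : ℂ) * q t + χ t * p t) (Set.Ioi t₀) :=
        i3.add i2
      have i6 : IntegrableOn (fun t => ((deriv χ t : ℝ) : ℂ) * P t + χ t * p t) (Set.Ioi t₀) :=
        i4.add i2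
      rw [integral_sub i5 i6]
      rw [h2]
      simp only [hq, hp] at h1 ⊢
      rw [h1, sub_zero])
  have h4 := hc T hT
  have h5 := hc t₀ le_rfl
  simp only [hP, intervalIntegral.integral_same, sub_zero] at h4 h5
  rw [inner_sub_right, inner_add_right, inner_packetVec_zero_freeGroup_neg,
    inner_packetVec_zero_freeGroup_neg, intervalIntegral.integral_of_le hT,
    ← integral_inner (integrable_freeGroup_neg (hF T))]
  simp_rw [inner_packetVec_zero_freeGroup_neg]
  rw [← intervalIntegral.integral_of_le hT]
  show q T - (q t₀ + ∫ τ in t₀..T, p τ) = 0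
  linear_combination h4 - h5

/-! ### The nonlinearity and its superposition operator -/

/-- The nonlinearity of the equation for the perturbation `z = v - a`. -/
noncomputable def cubic (a : ℝ) (z : ℂ) : ℂ := ((‖a + z‖ ^ 2 - a ^ 2 : ℝ) : ℂ) * (a + z)

theorem cubic_zero (a : ℝ) : cubic a 0 = 0 := by simp [cubic]

theorem continuous_cubic (a : ℝ) : Continuous (cubic a) := by
  unfold cubic
  fun_prop

/-- With V = a + z and W = a + w, the difference is (|V|² - a²)(V - W) + (|V|² - |W|²)W. Its
Lipschitz factor is at most a² + (3/2)(|V|² + |W|²), and |V|² ≤ 2a² + 2|z|² and likewise for W give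
a² + 3a² + 3a² = 7a². -/
theorem norm_cubic_sub_le (a : ℝ) (z w : ℂ) :
    ‖cubic a z - cubic a w‖ ≤ (7 * a ^ 2 + 3 * ‖z‖ ^ 2 + 3 * ‖w‖ ^ 2) * ‖z - w‖ := by
  set V := (a : ℂ) + z with hV
  set W := (a : ℂ) + w with hW
  have hsub : V - W = z - w := by rw [hV, hW]; ring
  have h1 : cubic a z - cubic a w = ((‖V‖ ^ 2 - a ^ 2 : ℝ) : ℂ) * (V - W)
      + ((‖V‖ ^ 2 - ‖W‖ ^ 2 : ℝ) : ℂ) * W := by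
    simp only [cubic, ← hV, ← hW]
    push_cast
    ring
  have hd : |‖V‖ - ‖W‖| ≤ ‖z - w‖ := hsub ▸ abs_norm_sub_norm_le V W
  have hVn : ‖V‖ ≤ |a| + ‖z‖ := (norm_add_le _ _).trans (by simp)
  have hWn : ‖W‖ ≤ |a| + ‖w‖ := (norm_add_le _ _).trans (by simp)
  have h2 : |‖V‖ ^ 2 - a ^ 2| ≤ ‖V‖ ^ 2 + a ^ 2 :=
    abs_sub_le_iff.2 ⟨by nlinarith [sq_nonneg a], by nlinarith [sq_nonneg ‖V‖]⟩
  have h3 : |‖V‖ ^ 2 - ‖W‖ ^ 2| ≤ ‖z - w‖ * (‖V‖ + ‖W‖) := by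
    rw [show ‖V‖ ^ 2 - ‖W‖ ^ 2 = (‖V‖ - ‖W‖) * (‖V‖ + ‖W‖) by ring, abs_mul,
      abs_of_nonneg (by positivity : 0 ≤ ‖V‖ + ‖W‖)]
    gcongr
  rw [h1]
  refine (norm_add_le _ _).trans ?_
  rw [norm_mul, norm_mul, Complex.norm_real, Complex.norm_real, Real.norm_eq_abs, Real.norm_eq_abs,
    hsub]
  have h4 : |‖V‖ ^ 2 - a ^ 2| * ‖z - w‖ + |‖V‖ ^ 2 - ‖W‖ ^ 2| * ‖W‖
      ≤ (‖V‖ ^ 2 + a ^ 2 + (‖V‖ + ‖W‖) * ‖W‖) * ‖z - w‖ := by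
    have := mul_le_mul_of_nonneg_right h2 (norm_nonneg (z - w))
    have := mul_le_mul_of_nonneg_right h3 (norm_nonneg W)
    nlinarith
  refine h4.trans (mul_le_mul_of_nonneg_right ?_ (norm_nonneg _))
  have hV2 : ‖V‖ ^ 2 ≤ 2 * a ^ 2 + 2 * ‖z‖ ^ 2 := by
    have := pow_le_pow_left₀ (norm_nonneg V) hVn 2
    nlinarith [sq_nonneg (|a| - ‖z‖), sq_abs a]
  have hW2 : ‖W‖ ^ 2 ≤ 2 * a ^ 2 + 2 * ‖w‖ ^ 2 := by
    have := pow_le_pow_left₀ (norm_nonneg W) hWn 2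
    nlinarith [sq_nonneg (|a| - ‖w‖), sq_abs a]
  nlinarith [sq_nonneg (‖V‖ - ‖W‖)]

theorem norm_cubic_le (a : ℝ) (z : ℂ) : ‖cubic a z‖ ≤ (7 * a ^ 2 + 3 * ‖z‖ ^ 2) * ‖z‖ := by
  have := norm_cubic_sub_le a z 0
  simpa [cubic_zero] using this

/-- The remainder is exactly a|z|² + (2a Re z + |z|²)z; the linear part is a²(z + z̄) = 2a² Re z. -/
theorem norm_cubic_sub_linear_le {a : ℝ} (ha : 0 ≤ a) (z : ℂ) :
    ‖cubic a z - (a : ℂ) ^ 2 * z - (a : ℂ) ^ 2 * (starRingEnd ℂ) z‖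
      ≤ (3 * a * ‖z‖ + ‖z‖ ^ 2) * ‖z‖ := by
  have h1 : ‖(a : ℂ) + z‖ ^ 2 - a ^ 2 = 2 * a * z.re + ‖z‖ ^ 2 := by
    rw [← Complex.normSq_eq_norm_sq, ← Complex.normSq_eq_norm_sq, Complex.normSq_apply,
      Complex.normSq_apply]
    simp
    ring
  have h2 : cubic a z - (a : ℂ) ^ 2 * z - (a : ℂ) ^ 2 * (starRingEnd ℂ) z
      = ((a * ‖z‖ ^ 2 : ℝ) : ℂ) + ((2 * a * z.re + ‖z‖ ^ 2 : ℝ) : ℂ) * z := by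
    have h3 : (starRingEnd ℂ) z = 2 * (z.re : ℂ) - z := by
      have := Complex.add_conj z
      push_cast at this
      linear_combination this
    rw [cubic, h1, h3]
    push_cast
    ring
  rw [h2]
  refine (norm_add_le _ _).trans ?_
  rw [norm_mul, Complex.norm_real, Complex.norm_real, Real.norm_of_nonneg (by positivity)]
  have h4 : ‖2 * a * z.re + ‖z‖ ^ 2‖ ≤ 2 * a * ‖z‖ + ‖z‖ ^ 2 := by
    refine (norm_add_le _ _).trans (add_le_add ?_ (by simp))
    rw [norm_mul, Real.norm_of_nonneg (by positivity : 0 ≤ 2 * a)]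
    exact mul_le_mul_of_nonneg_left (Complex.abs_re_le_norm z) (by positivity)
  nlinarith [mul_le_mul_of_nonneg_right h4 (norm_nonneg z)]

/-- The `L^∞` norm of an element of `L²`. -/
noncomputable abbrev supNorm (f : L2) : ℝ≥0∞ := eLpNorm f ∞ volume

theorem ae_norm_le_supNorm {f : L2} (hf : supNorm f ≠ ∞) :
    ∀ᵐ x, ‖f x‖ ≤ (supNorm f).toReal := by
  filter_upwards [ae_le_eLpNormEssSup (f := f) (μ := volume)] with x hx
  rw [← eLpNorm_exponent_top] at hx
  rw [← toReal_enorm]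
  exact ENNReal.toReal_mono hf hx

theorem memLp_cubic (a : ℝ) {f : L2} (hf : supNorm f ≠ ∞) :
    MemLp (fun x => cubic a (f x)) 2 volume := by
  refine (Lp.memLp f).of_le_mul (c := 7 * a ^ 2 + 3 * (supNorm f).toReal ^ 2)
    ((continuous_cubic a).comp_aestronglyMeasurable (Lp.aestronglyMeasurable f)) ?_
  filter_upwards [ae_norm_le_supNorm hf] with x hx
  refine (norm_cubic_le a _).trans ?_
  gcongr

open Classical in
/-- The superposition operator of `cubic a` on `L²` (zero where it is not defined). -/
noncomputable def nonlinearity (a : ℝ) (f : L2) : L2 :=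
  if h : MemLp (fun x => cubic a (f x)) 2 volume then h.toLp else 0

theorem nonlinearity_ae (a : ℝ) {f : L2} (hf : supNorm f ≠ ∞) :
    nonlinearity a f =ᵐ[volume] fun x => cubic a (f x) := by
  rw [nonlinearity, dif_pos (memLp_cubic a hf)]
  exact MemLp.coeFn_toLp _

theorem supNorm_zero : supNorm 0 = 0 := by
  rw [supNorm, eLpNorm_congr_ae (Lp.coeFn_zero ℂ 2 volume)]
  exact eLpNorm_zero

theorem nonlinearity_zero (a : ℝ) : nonlinearity a 0 = 0 := by
  apply Lp.ext
  filter_upwards [nonlinearity_ae a (f := 0) (by rw [supNorm_zero]; exact ENNReal.zero_ne_top),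
    Lp.coeFn_zero ℂ 2 (volume : Measure ℝ)] with x h1 h2
  rw [h1, h2]
  exact cubic_zero a

/-- No finiteness is required: if a sup norm is infinite and f ≠ g, the right side is infinite. -/
theorem enorm_nonlinearity_sub_le (a : ℝ) (f g : L2) :
    ‖nonlinearity a f - nonlinearity a g‖ₑ
      ≤ (ENNReal.ofReal (7 * a ^ 2) + 3 * supNorm f ^ 2 + 3 * supNorm g ^ 2) * ‖f - g‖ₑ := by
  rcases eq_or_ne f g with rfl | hfg
  · simp
  have hne : ‖f - g‖ₑ ≠ 0 := by rwa [enorm_ne_zero, sub_ne_zero]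
  by_cases hf : supNorm f = ∞
  · rw [hf]; simp [ENNReal.top_mul hne]
  by_cases hg : supNorm g = ∞
  · rw [hg]; simp [ENNReal.top_mul hne]
  have h : ‖nonlinearity a f - nonlinearity a g‖
      ≤ (7 * a ^ 2 + 3 * (supNorm f).toReal ^ 2 + 3 * (supNorm g).toReal ^ 2) * ‖f - g‖ := by
    apply Lp.norm_le_mul_norm_of_ae_le_mul
    filter_upwards [nonlinearity_ae a hf, nonlinearity_ae a hg, Lp.coeFn_sub f g,
      Lp.coeFn_sub (nonlinearity a f) (nonlinearity a g), ae_norm_le_supNorm hf,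
      ae_norm_le_supNorm hg] with x h1 h2 h3 h4 h5 h6
    rw [h3, h4, Pi.sub_apply, Pi.sub_apply, h1, h2]
    refine (norm_cubic_sub_le a _ _).trans ?_
    gcongr
  rw [← ofReal_norm, ← ofReal_norm]
  refine (ENNReal.ofReal_le_ofReal h).trans (le_of_eq ?_)
  rw [ENNReal.ofReal_mul (by positivity), ENNReal.ofReal_add (by positivity) (by positivity),
    ENNReal.ofReal_add (by positivity) (by positivity), ENNReal.ofReal_mul (by norm_num : (0:ℝ) ≤ 3),
    ENNReal.ofReal_mul (by norm_num : (0:ℝ) ≤ 3), ENNReal.ofReal_pow ENNReal.toReal_nonneg,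
    ENNReal.ofReal_pow ENNReal.toReal_nonneg, ENNReal.ofReal_toReal hf, ENNReal.ofReal_toReal hg]
  norm_num

/-- Complex conjugation on `L²`. -/
noncomputable def conjL2 : L2 →L[ℝ] L2 :=
  Complex.conjCLE.toContinuousLinearMap.compLpL 2 volume

theorem conjL2_ae (f : L2) : conjL2 f =ᵐ[volume] fun x => (starRingEnd ℂ) (f x) :=
  ContinuousLinearMap.coeFn_compLpL _ f

theorem eLpNorm_conjL2 (f : L2) (p : ℝ≥0∞) : eLpNorm (conjL2 f) p volume = eLpNorm f p volume := by
  apply eLpNorm_congr_norm_ae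
  filter_upwards [conjL2_ae f] with x hx
  simp [hx]

theorem inner_conjL2_conjL2 (f g : L2) :
    inner ℂ (conjL2 f) (conjL2 g) = (starRingEnd ℂ) (inner ℂ f g) := by
  rw [L2.inner_def, L2.inner_def, ← integral_conj]
  apply integral_congr_ae
  filter_upwards [conjL2_ae f, conjL2_ae g] with x h1 h2
  rw [h1, h2]
  simp

theorem conjL2_packetVec (x₀ t : ℝ) : conjL2 (packetVec x₀ t) = packetVec x₀ (-t) := by
  apply Lp.ext
  filter_upwards [conjL2_ae (packetVec x₀ t), packetVec_ae x₀ t, packetVec_ae x₀ (-t)]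
    with x h1 h2 h3
  have hw : (starRingEnd ℂ) (packetWidth t) = packetWidth (-t) := by
    simp [packetWidth, Complex.conj_ofNat]
  have hl : (starRingEnd ℂ) (Complex.log (packetWidth t)) = Complex.log (packetWidth (-t)) := by
    rw [← hw, Complex.log_conj _ (Complex.mem_slitPlane_iff_arg.1 (packetWidth_mem_slitPlane t)).1]
  rw [h1, h2, h3, wavePacket, wavePacket, ← Complex.exp_conj]
  simp only [map_sub, map_mul, map_div₀, map_pow, hl, hw, Complex.conj_ofReal, map_neg, map_one,
    Complex.conj_ofNat]

/-- Conjugation reverses time. This is visible on packets, as the conjugate of the packet at time t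
is the packet at time -t, and it passes to L² by duality and totality. -/
theorem conjL2_freeGroup (t : ℝ) (f : L2) : conjL2 (freeGroup t f) = freeGroup (-t) (conjL2 f) := by
  rw [← sub_eq_zero]
  refine eq_zero_of_inner_packetVec _ fun x₀ => ?_
  have h0 : packetVec x₀ 0 = conjL2 (packetVec x₀ 0) := by rw [conjL2_packetVec, neg_zero]
  have h1 : freeGroup t (packetVec x₀ 0) = conjL2 (freeGroup (-t) (packetVec x₀ 0)) := by
    rw [freeGroup_packetVec, freeGroup_packetVec, conjL2_packetVec, neg_neg]
  rw [inner_sub_right, sub_eq_zero, inner_freeGroup_neg, h1, inner_conjL2_conjL2]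
  nth_rw 1 [h0]
  rw [inner_conjL2_conjL2, ← inner_freeGroup_neg, neg_neg]

theorem enorm_nonlinearity_sub_linear_le {a : ℝ} (ha : 0 ≤ a) (f : L2) :
    ‖nonlinearity a f - (a : ℂ) ^ 2 • f - (a : ℂ) ^ 2 • conjL2 f‖ₑ
      ≤ (ENNReal.ofReal (3 * a) * supNorm f + supNorm f ^ 2) * ‖f‖ₑ := by
  rcases eq_or_ne f 0 with rfl | hf0
  · simp [nonlinearity_zero]
  have hne : ‖f‖ₑ ≠ 0 := by rwa [enorm_ne_zero]
  by_cases hf : supNorm f = ∞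
  · rw [hf]; simp [ENNReal.top_mul hne]
  have h : ‖nonlinearity a f - (a : ℂ) ^ 2 • f - (a : ℂ) ^ 2 • conjL2 f‖
      ≤ (3 * a * (supNorm f).toReal + (supNorm f).toReal ^ 2) * ‖f‖ := by
    apply Lp.norm_le_mul_norm_of_ae_le_mul
    filter_upwards [nonlinearity_ae a hf, Lp.coeFn_smul ((a : ℂ) ^ 2) f, conjL2_ae f,
      Lp.coeFn_smul ((a : ℂ) ^ 2) (conjL2 f),
      Lp.coeFn_sub (nonlinearity a f) ((a : ℂ) ^ 2 • f),
      Lp.coeFn_sub (nonlinearity a f - (a : ℂ) ^ 2 • f) ((a : ℂ) ^ 2 • conjL2 f),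
      ae_norm_le_supNorm hf] with x h1 h2 h3 h4 h5 h6 h7
    rw [h6, Pi.sub_apply, h5, Pi.sub_apply, h4, Pi.smul_apply, h3, h2, Pi.smul_apply, h1]
    refine (norm_cubic_sub_linear_le ha _).trans ?_
    gcongr
  rw [← ofReal_norm, ← ofReal_norm]
  refine (ENNReal.ofReal_le_ofReal h).trans (le_of_eq ?_)
  rw [ENNReal.ofReal_mul (by positivity), ENNReal.ofReal_add (by positivity) (by positivity),
    ENNReal.ofReal_mul (by positivity), ENNReal.ofReal_pow ENNReal.toReal_nonneg,
    ENNReal.ofReal_toReal hf]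

/-- Truncation of the real and imaginary parts at height `M`. -/
noncomputable def clamp (M : ℝ) (z : ℂ) : ℂ :=
  ((max (-M) (min M z.re) : ℝ) : ℂ) + ((max (-M) (min M z.im) : ℝ) : ℂ) * Complex.I

theorem clamp_eq_self {M : ℝ} {z : ℂ} (h : ‖z‖ ≤ M) : clamp M z = z := by
  have h1 := abs_le.1 ((Complex.abs_re_le_norm z).trans h)
  have h2 := abs_le.1 ((Complex.abs_im_le_norm z).trans h)
  rw [clamp, min_eq_right h1.2, min_eq_right h2.2, max_eq_right h1.1, max_eq_right h2.1,
    Complex.re_add_im]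

theorem abs_clamp_real_sub_le (M x y : ℝ) :
    |max (-M) (min M x) - max (-M) (min M y)| ≤ |x - y| := by
  rw [max_comm, max_comm (-M) (min M y)]
  refine (abs_max_sub_max_le_abs _ _ _).trans ?_
  simpa using abs_min_sub_min_le_max M x M y

theorem norm_clamp_sub_le (M : ℝ) (z w : ℂ) : ‖clamp M z - clamp M w‖ ≤ 2 * ‖z - w‖ := by
  have h : clamp M z - clamp M w
      = ((max (-M) (min M z.re) - max (-M) (min M w.re) : ℝ) : ℂ)
        + ((max (-M) (min M z.im) - max (-M) (min M w.im) : ℝ) : ℂ) * Complex.I := by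
    simp only [clamp]
    push_cast
    ring
  rw [h]
  refine (norm_add_le _ _).trans ?_
  rw [norm_mul, Complex.norm_I, mul_one, Complex.norm_real, Complex.norm_real, two_mul]
  exact add_le_add
    ((abs_clamp_real_sub_le M _ _).trans (by simpa using Complex.abs_re_le_norm (z - w)))
    ((abs_clamp_real_sub_le M _ _).trans (by simpa using Complex.abs_im_le_norm (z - w)))

theorem norm_clamp_le {M : ℝ} (hM : 0 ≤ M) (z : ℂ) : ‖clamp M z‖ ≤ 2 * M := by
  have h : ∀ x : ℝ, |max (-M) (min M x)| ≤ M := fun x =>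
    abs_le.2 ⟨le_max_left _ _, max_le (by linarith) (min_le_left _ _)⟩
  refine (norm_add_le _ _).trans ?_
  rw [norm_mul, Complex.norm_I, mul_one, Complex.norm_real, Complex.norm_real, two_mul]
  exact add_le_add (h _) (h _)

theorem lipschitzWith_cubic_clamp (a : ℝ) {M : ℝ} (hM : 0 ≤ M) :
    LipschitzWith (Real.toNNReal ((7 * a ^ 2 + 6 * (2 * M) ^ 2) * 2))
      (fun z => cubic a (clamp M z)) := by
  refine LipschitzWith.of_dist_le_mul fun z w => ?_
  rw [dist_eq_norm, dist_eq_norm, Real.coe_toNNReal _ (by positivity), mul_assoc]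
  refine (norm_cubic_sub_le a _ _).trans ?_
  refine mul_le_mul ?_ (norm_clamp_sub_le M z w) (norm_nonneg _) (by positivity)
  have h1 := pow_le_pow_left₀ (norm_nonneg _) (norm_clamp_le hM z) 2
  have h2 := pow_le_pow_left₀ (norm_nonneg _) (norm_clamp_le hM w) 2
  linarith

theorem clamp_zero {M : ℝ} (hM : 0 ≤ M) : clamp M 0 = 0 :=
  clamp_eq_self (by simpa using hM)

/-- With its argument truncated, the nonlinearity is globally Lipschitz, so its superposition
operator is continuous on L² and preserves measurability. At a point where the L^∞ norm is finite,
the truncations are eventually inactive. -/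
theorem aestronglyMeasurable_nonlinearity (a : ℝ) {X : Type*} [MeasurableSpace X] {μ : Measure X}
    {Z : X → L2} (hZ : AEStronglyMeasurable Z μ) (hfin : ∀ᵐ x ∂μ, supNorm (Z x) ≠ ∞) :
    AEStronglyMeasurable (fun x => nonlinearity a (Z x)) μ := by
  have h0 : ∀ n : ℕ, (fun z => cubic a (clamp n z)) 0 = 0 := fun n => by
    simp only [clamp_zero n.cast_nonneg, cubic_zero]
  refine aestronglyMeasurable_of_tendsto_ae atTop (f := fun n x =>
    (lipschitzWith_cubic_clamp a (Nat.cast_nonneg n)).compLp (h0 n) (Z x)) (fun n => ?_) ?_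
  · exact (LipschitzWith.continuous_compLp _ (h0 n)).comp_aestronglyMeasurable hZ
  · filter_upwards [hfin] with x hx
    refine tendsto_const_nhds.congr' ?_
    filter_upwards [eventually_ge_atTop ⌈(supNorm (Z x)).toReal⌉₊] with n hn
    symm
    apply Lp.ext
    filter_upwards [LipschitzWith.coeFn_compLp (lipschitzWith_cubic_clamp a (Nat.cast_nonneg n))
      (h0 n) (Z x), nonlinearity_ae a hx, ae_norm_le_supNorm hx] with y h1 h2 h3
    rw [h1, h2, Function.comp_apply, clamp_eq_self (h3.trans ((Nat.le_ceil _).trans (by exact_mod_cast hn)))]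

/-! ### The distributional equation for the perturbation -/

/-- The forcing term of the equation for the perturbation `z = v - a`. -/
noncomputable def forcing (σ a : ℝ) (Z : ℝ → L2) (t : ℝ) : L2 :=
  (Complex.I * ((σ / t : ℝ) : ℂ)) • nonlinearity a (Z t)

theorem integrable_slice_mul {ψ : ℝ × ℝ → ℂ} (hc : Continuous ψ) (hs : HasCompactSupport ψ)
    (t : ℝ) (f : L2) : Integrable fun x => ψ (t, x) * f x := by
  have h1 : MemLp (fun x => ψ (t, x)) 2 volume :=
    (by fun_prop : Continuous fun x => ψ (t, x)).memLp_of_hasCompactSupport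
      (hasCompactSupport_slice hs t)
  exact h1.integrable_mul (Lp.memLp f)

/-- The constant function 1 solves the free equation, so the general identity for φu applies with u
= 1 and both boundary terms vanish. -/
theorem integral_integral_adjointOp {φ : ℝ × ℝ → ℂ} (hφ : ContDiff ℝ (⊤ : ℕ∞) φ)
    (hs : HasCompactSupport φ) {t₀ : ℝ} (hsupp : tsupport φ ⊆ Set.Ioi t₀ ×ˢ Set.univ) :
    IntegrableOn (fun t => ∫ x, adjointOp φ (t, x)) (Set.Ioi t₀) ∧
      ∫ t in Set.Ioi t₀, ∫ x, adjointOp φ (t, x) = 0 := by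
  have hint : Integrable (fun t => ∫ x, adjointOp φ (t, x)) := by
    have h : Integrable (adjointOp φ) (volume.prod volume) :=
      (contDiff_adjointOp hφ).continuous.integrable_of_hasCompactSupport
        (hasCompactSupport_adjointOp hs)
    exact h.integral_prod_left
  refine ⟨hint.integrableOn, ?_⟩
  obtain ⟨α, β, hα, hαβ, hzero⟩ := exists_time_support hs hsupp
  have hout : ∀ t, t ∉ Set.Ioo α β → ∫ x, adjointOp φ (t, x) = 0 := by
    intro t ht
    simp only [(hzero t _ ht).2, integral_zero]
  have h0 : ∀ t, t ∉ Set.Ioo α β → ∫ x, φ (t, x) = 0 := by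
    intro t ht
    simp only [(hzero t _ ht).1, integral_zero]
  have h1 := integral_mul_sub_integral_mul (u := fun _ => 1) hφ hs contDiff_const
    (fun p => by
      have : spaceDeriv (fun _ => (1 : ℂ)) = fun _ => 0 := by ext p; simp [spaceDeriv]
      rw [this]
      simp [timeDeriv, spaceDeriv]) hαβ.le
  simp only [mul_one] at h1
  rw [h0 α (fun h => lt_irrefl _ h.1), h0 β (fun h => lt_irrefl _ h.2), sub_zero,
    intervalIntegral.integral_const_mul] at h1
  have h2 : ∫ τ in α..β, ∫ x, adjointOp φ (τ, x) = 0 :=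
    (mul_eq_zero.1 h1.symm).resolve_left Complex.I_ne_zero
  rw [intervalIntegral.integral_of_le hαβ.le] at h2
  rw [← h2]
  exact setIntegral_eq_of_subset_of_forall_sdiff_eq_zero measurableSet_Ioi
    (fun t ht => hα.trans ht.1) fun t ht => hout t fun h => ht.2 ⟨h.1, h.2.le⟩

theorem integrableOn_weak_integrand {t₀ : ℝ} {Z F : ℝ → L2} (hZ : Continuous Z)
    (hF : ∀ T, IntegrableOn F (Set.Ioc t₀ T)) {φ : ℝ × ℝ → ℂ} (hφ : ContDiff ℝ (⊤ : ℕ∞) φ)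
    (hs : HasCompactSupport φ) (hsupp : tsupport φ ⊆ Set.Ioi t₀ ×ˢ Set.univ) :
    IntegrableOn (fun t => (∫ x, adjointOp φ (t, x) * Z t x)
      - Complex.I * ∫ x, φ (t, x) * F t x) (Set.Ioi t₀) := by
  obtain ⟨Φ, hΦc, hΦ, hΦae⟩ := exists_testPath hφ.continuous hs
  obtain ⟨Ψ, hΨc, hΨ, hΨae⟩ := exists_testPath (contDiff_adjointOp hφ).continuous
    (hasCompactSupport_adjointOp hs)
  obtain ⟨α, β, hα, hαβ, hzero⟩ := exists_time_support hs hsupp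
  have hΦ0 : ∀ t, t ∉ Set.Ioo α β → Φ t = 0 := fun t ht =>
    testPath_eq_zero (hΦae t) fun x => (hzero t x ht).1
  have hΨ0 : ∀ t, t ∉ Set.Ioo α β → Ψ t = 0 := fun t ht =>
    testPath_eq_zero (hΨae t) fun x => (hzero t x ht).2
  simp_rw [← hΦ, ← hΨ]
  refine Integrable.sub ?_ (Integrable.const_mul ?_ _)
  · refine Integrable.integrableOn ((hΨc.inner hZ).integrable_of_hasCompactSupport
      (HasCompactSupport.intro (isCompact_Icc (a := α) (b := β)) fun t ht => ?_))
    rw [hΨ0 t fun h => ht (Set.Ioo_subset_Icc_self h), inner_zero_left]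
  · obtain ⟨C, hC⟩ := hΦc.bounded_above_of_compact_support
      (HasCompactSupport.intro (isCompact_Icc (a := α) (b := β)) fun t ht =>
        hΦ0 t fun h => ht (Set.Ioo_subset_Icc_self h))
    have h1 : IntegrableOn (fun t => inner ℂ (Φ t) (F t)) (Set.Ioc t₀ β) := by
      refine Integrable.mono' ((hF β).norm.const_mul C)
        (hΦc.aestronglyMeasurable.inner (hF β).aestronglyMeasurable)
        (Eventually.of_forall fun t => (norm_inner_le_norm _ _).trans ?_)
      exact mul_le_mul_of_nonneg_right (hC t) (norm_nonneg _)
    refine h1.of_forall_sdiff_eq_zero measurableSet_Ioi fun t ht => ?_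
    rw [hΦ0 t fun h => ht.2 ⟨ht.1, h.2.le⟩, inner_zero_left]

/-- The constant part a of v contributes nothing, and -i times the forcing is (σ/t)N(Z). Since the
L^∞ norm of Z(t) is finite for almost every t, the nonlinearity as an L² vector is the pointwise
expression there; integrability of the forcing justifies splitting the integrals. -/
theorem isDistributionalSolution_iff {σ a t₀ : ℝ} {v : ℝ → ℝ → ℂ} {Z : ℝ → L2}
    (hZ : Continuous Z) (hv : ∀ t, t₀ < t → v t =ᵐ[volume] fun x => a + Z t x)
    (hfin : ∀ᵐ t ∂volume.restrict (Set.Ioi t₀), supNorm (Z t) ≠ ∞)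
    (hF : ∀ T, IntegrableOn (forcing σ a Z) (Set.Ioc t₀ T)) :
    IsDistributionalSolution σ a t₀ v ↔ IsWeakSolution t₀ Z (forcing σ a Z) := by
  refine forall_congr' fun φ => forall_congr' fun hφ => forall_congr' fun hs =>
    forall_congr' fun hsupp => ?_
  obtain ⟨h1, h2⟩ := integral_integral_adjointOp hφ hs hsupp
  have h3 := integrableOn_weak_integrand hZ hF hφ hs hsupp
  have key : ∫ t in Set.Ioi t₀, ∫ x : ℝ,
        (v t x * (-Complex.I * deriv (fun s => φ (s, x)) t
            + iteratedDeriv 2 (fun y => φ (t, y)) x)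
          + (σ / t : ℝ) * ((‖v t x‖ ^ 2 - a ^ 2 : ℝ) : ℂ) * v t x * φ (t, x))
      = ∫ t in Set.Ioi t₀, ((a : ℂ) * (∫ x, adjointOp φ (t, x))
        + ((∫ x, adjointOp φ (t, x) * Z t x)
          - Complex.I * ∫ x, φ (t, x) * forcing σ a Z t x)) := by
    refine integral_congr_ae ?_
    filter_upwards [hfin, ae_restrict_mem measurableSet_Ioi] with t ht htt
    have hadj := contDiff_adjointOp hφ
    have hadjs := hasCompactSupport_adjointOp hs
    have i1 : Integrable fun x => (a : ℂ) * adjointOp φ (t, x) :=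
      (((by have := hadj.continuous; fun_prop : Continuous fun x => adjointOp φ (t, x))
        ).integrable_of_hasCompactSupport (hasCompactSupport_slice hadjs t)).const_mul _
    have i2 := integrable_slice_mul hadj.continuous hadjs t (Z t)
    have i3 := (integrable_slice_mul hφ.continuous hs t (forcing σ a Z t)).const_mul Complex.I
    rw [← integral_const_mul, ← integral_const_mul, ← integral_sub i2 i3]
    refine Eq.trans ?_ (integral_add i1 (i2.sub i3))
    refine integral_congr_ae ?_
    filter_upwards [hv t htt, nonlinearity_ae a ht,
      Lp.coeFn_smul (Complex.I * ((σ / t : ℝ) : ℂ)) (nonlinearity a (Z t))] with x h1 h2 h3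
    rw [adjointOp_eq hφ, h1, forcing, h3, Pi.smul_apply, h2, cubic, smul_eq_mul]
    linear_combination (((σ / t : ℝ) : ℂ) * ((‖(a : ℂ) + Z t x‖ ^ 2 - a ^ 2 : ℝ) : ℂ)
      * ((a : ℂ) + Z t x) * φ (t, x)) * Complex.I_mul_I
  rw [key, integral_add (h1.const_mul _) h3, integral_const_mul, h2, mul_zero, zero_add]

/-! ### The profile -/

/-- The oscillating phase of the profile. -/
noncomputable def phase (σ a t : ℝ) : ℂ :=
  Complex.exp (Complex.I * ((σ * a ^ 2 * Real.log t : ℝ) : ℂ))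

theorem norm_phase (σ a t : ℝ) : ‖phase σ a t‖ = 1 := by
  rw [phase, mul_comm]
  exact Complex.norm_exp_ofReal_mul_I _

theorem hasDerivAt_phase (σ a : ℝ) {t : ℝ} (ht : t ≠ 0) : HasDerivAt (phase σ a)
    (Complex.I * ((σ / t : ℝ) : ℂ) * ((a : ℂ) ^ 2 * phase σ a t)) t := by
  have h1 := (((Real.hasDerivAt_log ht).const_mul (σ * a ^ 2)).ofReal_comp.const_mul
    Complex.I).cexp
  refine h1.congr_deriv ?_
  rw [phase]
  push_cast
  ring

/-- The dispersive part `v₁ - a` of the profile. -/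
noncomputable def freePart (σ a : ℝ) (u : L2) (t : ℝ) : L2 := phase σ a t • freeGroup t u

theorem profile_ae (σ a : ℝ) (u : L2) (t : ℝ) :
    profile σ a u t =ᵐ[volume] fun x => a + freePart σ a u t x := by
  filter_upwards [Lp.coeFn_smul (phase σ a t) (freeGroup t u)] with x hx
  rw [freePart, hx]
  rfl

theorem continuousOn_freePart (σ a : ℝ) (u : L2) : ContinuousOn (freePart σ a u) (Set.Ioi 0) :=
  ContinuousOn.smul
    (fun _ ht => (hasDerivAt_phase σ a (ne_of_gt ht)).continuousAt.continuousWithinAt)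
    (continuous_freeGroup_left u).continuousOn

theorem norm_freePart (σ a : ℝ) (u : L2) (t : ℝ) : ‖freePart σ a u t‖ = ‖u‖ := by
  rw [freePart, norm_smul, norm_phase, one_mul, LinearIsometry.norm_map]

theorem supNorm_smul (c : ℂ) (f : L2) : supNorm (c • f) = ‖c‖ₑ * supNorm f := by
  rw [supNorm, eLpNorm_congr_ae (Lp.coeFn_smul c f)]
  exact eLpNorm_const_smul c f _ _

theorem supNorm_freePart_le (σ a : ℝ) {u : L2} (hu : eLpNorm u 1 volume ≠ ∞) {t : ℝ}
    (ht : t ≠ 0) : supNorm (freePart σ a u t) ≤ dispersiveKernel t * eLpNorm u 1 volume := by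
  rw [freePart, supNorm_smul, ← ofReal_norm, norm_phase, ENNReal.ofReal_one, one_mul]
  exact eLpNorm_top_freeGroup_le ht u hu

/-- The profile solves the equation with the forcing `i σ a² z / t`. -/
theorem freePart_mild (σ a : ℝ) (u : L2) {t T : ℝ} (ht : 0 < t) (htT : t ≤ T) :
    freeGroup (-T) (freePart σ a u T) = freeGroup (-t) (freePart σ a u t)
      + ∫ τ in t..T, freeGroup (-τ)
        ((Complex.I * ((σ / τ : ℝ) : ℂ)) • (a : ℂ) ^ 2 • freePart σ a u τ) := by
  -- In the interaction picture the profile is a scalar phase times the fixed vector u, so the claim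
  -- is the ODE of the phase.
  have h1 : ∀ τ, freeGroup (-τ) (freePart σ a u τ) = phase σ a τ • u := fun τ => by
    rw [freePart, map_smul, freeGroup_neg_apply_self]
  have h2 : ∀ τ, freeGroup (-τ) ((Complex.I * ((σ / τ : ℝ) : ℂ)) • (a : ℂ) ^ 2 • freePart σ a u τ)
      = (Complex.I * ((σ / τ : ℝ) : ℂ) * ((a : ℂ) ^ 2 * phase σ a τ)) • u := fun τ => by
    rw [map_smul, map_smul, h1, smul_smul, smul_smul, mul_assoc]
  have hpos : ∀ τ ∈ Set.uIcc t T, τ ≠ 0 := fun τ hτ => by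
    rw [Set.uIcc_of_le htT] at hτ
    exact (ht.trans_le hτ.1).ne'
  simp_rw [h1, h2]
  rw [intervalIntegral.integral_smul_const, intervalIntegral.integral_eq_sub_of_hasDerivAt
    (fun τ hτ => hasDerivAt_phase σ a (hpos τ hτ)), sub_smul]
  · abel
  · apply ContinuousOn.intervalIntegrable
    refine ContinuousOn.mul (continuousOn_const.mul (Complex.continuous_ofReal.comp_continuousOn
      (continuousOn_const.div continuousOn_id hpos))) (continuousOn_const.mul fun τ hτ =>
        (hasDerivAt_phase σ a (hpos τ hτ)).continuousAt.continuousWithinAt)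

/-! ### Weighted integrals of the Lipschitz factor -/

theorem lintegral_Ioi_rpow {p t : ℝ} (hp : p < -1) (ht : 0 < t) :
    ∫⁻ τ in Set.Ioi t, ENNReal.ofReal (τ ^ p) = ENNReal.ofReal (t ^ (p + 1) / -(p + 1)) := by
  rw [← ofReal_integral_eq_lintegral_ofReal (integrableOn_Ioi_rpow_of_lt hp ht),
    integral_Ioi_rpow_of_lt hp ht, neg_div, div_neg]
  filter_upwards [ae_restrict_mem measurableSet_Ioi] with τ hτ
  exact Real.rpow_nonneg (ht.trans hτ).le _

theorem lintegral_Ioi_rpow_five_quarters {t : ℝ} (ht : 0 < t) :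
    ∫⁻ τ in Set.Ioi t, ENNReal.ofReal (τ ^ (-(5 / 4) : ℝ))
      = ENNReal.ofReal (4 * t ^ (-(1 / 4) : ℝ)) := by
  rw [lintegral_Ioi_rpow (by norm_num) ht]
  congr 1
  norm_num
  ring

/-- Cauchy–Schwarz in time, with ‖τ⁻¹‖_{L²(t,∞)} = t^{-1/2}. -/
theorem lintegral_Ioi_inv_mul_sq_le {g : ℝ → ℝ≥0∞} {t : ℝ} (ht : 0 < t)
    (hg : AEMeasurable g (volume.restrict (Set.Ioi t))) :
    ∫⁻ τ in Set.Ioi t, ENNReal.ofReal τ⁻¹ * g τ ^ 2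
      ≤ ENNReal.ofReal (t ^ (-(1 / 2) : ℝ)) * (∫⁻ τ in Set.Ioi t, g τ ^ (4 : ℝ)) ^ (1 / 2 : ℝ) := by
  refine (ENNReal.lintegral_mul_le_Lp_mul_Lq _ Real.HolderConjugate.two_two
    (f := fun τ => ENNReal.ofReal τ⁻¹) (g := fun τ => g τ ^ 2)
    (measurable_inv.ennreal_ofReal.aemeasurable) (hg.pow_const 2)).trans (le_of_eq ?_)
  congr 1
  · have : ∫⁻ τ in Set.Ioi t, ENNReal.ofReal τ⁻¹ ^ (2 : ℝ) = ENNReal.ofReal t⁻¹ := by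
      have h1 : ∫⁻ τ in Set.Ioi t, ENNReal.ofReal τ⁻¹ ^ (2 : ℝ)
          = ∫⁻ τ in Set.Ioi t, ENNReal.ofReal (τ ^ (-2 : ℝ)) := by
        refine setLIntegral_congr_fun measurableSet_Ioi fun τ hτ => ?_
        have hτ0 : 0 < τ := ht.trans hτ
        rw [ENNReal.ofReal_rpow_of_nonneg (by positivity) (by norm_num), ← Real.rpow_neg_one,
          ← Real.rpow_mul hτ0.le]
        norm_num
      rw [h1, lintegral_Ioi_rpow (by norm_num) ht]
      norm_num
      rw [Real.rpow_neg_one]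
    rw [this, ENNReal.ofReal_rpow_of_nonneg (by positivity) (by norm_num), ← Real.rpow_neg_one,
      ← Real.rpow_mul ht.le]
    norm_num
  · congr 1
    refine lintegral_congr fun τ => ?_
    rw [← ENNReal.rpow_natCast, ← ENNReal.rpow_mul]
    norm_num

theorem add_sq_le_two_mul_ennreal (x y : ℝ≥0∞) : (x + y) ^ 2 ≤ 2 * (x ^ 2 + y ^ 2) := by
  have h := ENNReal.rpow_add_le_mul_rpow_add_rpow x y (p := 2) (by norm_num)
  norm_num at h
  exact h

/-- The Lipschitz factor of the forcing between the paths `Z` and `Y`. -/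
noncomputable def lipFactor (a : ℝ) (Z Y : ℝ → L2) (τ : ℝ) : ℝ≥0∞ :=
  ENNReal.ofReal τ⁻¹
    * (ENNReal.ofReal (7 * a ^ 2) + 3 * supNorm (Z τ) ^ 2 + 3 * supNorm (Y τ) ^ 2)

theorem enorm_I_mul_div {σ : ℝ} (hσ : |σ| = 1) {τ : ℝ} (hτ : 0 < τ) :
    ‖Complex.I * ((σ / τ : ℝ) : ℂ)‖ₑ = ENNReal.ofReal τ⁻¹ := by
  rw [← ofReal_norm, norm_mul, Complex.norm_I, one_mul, Complex.norm_real, Real.norm_eq_abs,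
    abs_div, hσ, abs_of_pos hτ, one_div]

theorem enorm_forcing_sub_le {σ : ℝ} (hσ : |σ| = 1) (a : ℝ) (Z Y : ℝ → L2) {τ : ℝ} (hτ : 0 < τ) :
    ‖forcing σ a Z τ - forcing σ a Y τ‖ₑ ≤ lipFactor a Z Y τ * ‖Z τ - Y τ‖ₑ := by
  rw [forcing, forcing, ← smul_sub, enorm_smul, enorm_I_mul_div hσ hτ, lipFactor, mul_assoc]
  gcongr
  exact enorm_nonlinearity_sub_le a _ _

/-- The quantity that decides both contraction and uniqueness. Squaring the two-term bound on each
path costs a factor 2, so the bounded part of the Lipschitz factor is (7a² + 12ε²/t₀)/τ; since ∫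
τ^{-5/4} over (t,∞) is 4t^{-1/4}, this yields 28a² + 48ε²/t₀. The L⁴ parts f and g are handled by
Cauchy–Schwarz and gain t^{-1/2}. -/
theorem lintegral_lipFactor_le (a : ℝ) {ε t₀ t : ℝ} (hε : 0 ≤ ε) (ht₀ : 0 < t₀) (htt : t₀ ≤ t)
    {Z Y : ℝ → L2} {f g : ℝ → ℝ≥0∞}
    (hZ : ∀ τ, t₀ < τ → supNorm (Z τ) ≤ ENNReal.ofReal (ε * τ ^ (-(1 / 2) : ℝ)) + f τ)
    (hY : ∀ τ, t₀ < τ → supNorm (Y τ) ≤ ENNReal.ofReal (ε * τ ^ (-(1 / 2) : ℝ)) + g τ)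
    (hf : AEMeasurable f (volume.restrict (Set.Ioi t)))
    (hg : AEMeasurable g (volume.restrict (Set.Ioi t))) :
    ∫⁻ τ in Set.Ioi t, lipFactor a Z Y τ * ENNReal.ofReal (τ ^ (-(1 / 4) : ℝ))
      ≤ ENNReal.ofReal (t ^ (-(1 / 4) : ℝ)) * (ENNReal.ofReal (28 * a ^ 2 + 48 * ε ^ 2 / t₀)
        + 6 * ENNReal.ofReal (t ^ (-(1 / 2) : ℝ))
          * ((∫⁻ τ in Set.Ioi t, f τ ^ (4 : ℝ)) ^ (1 / 2 : ℝ)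
            + (∫⁻ τ in Set.Ioi t, g τ ^ (4 : ℝ)) ^ (1 / 2 : ℝ))) := by
  have ht : 0 < t := ht₀.trans_le htt
  have hsq : ∀ {τ : ℝ} {x y : ℝ≥0∞}, t₀ < τ → x ≤ ENNReal.ofReal (ε * τ ^ (-(1 / 2) : ℝ)) + y →
      3 * x ^ 2 ≤ ENNReal.ofReal (6 * ε ^ 2 / t₀) + 6 * y ^ 2 := by
    intro τ x y hτ hx
    have hτ0 : 0 < τ := ht₀.trans hτ
    calc 3 * x ^ 2 ≤ 3 * (ENNReal.ofReal (ε * τ ^ (-(1 / 2) : ℝ)) + y) ^ 2 := by gcongr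
      _ ≤ 3 * (2 * (ENNReal.ofReal (ε * τ ^ (-(1 / 2) : ℝ)) ^ 2 + y ^ 2)) := by
        gcongr; exact add_sq_le_two_mul_ennreal _ _
      _ = ENNReal.ofReal (6 * (ε ^ 2 / τ)) + 6 * y ^ 2 := by
        have : (ε * τ ^ (-(1 / 2) : ℝ)) ^ 2 = ε ^ 2 / τ := by
          rw [mul_pow, ← Real.rpow_natCast (τ ^ _), ← Real.rpow_mul hτ0.le]
          norm_num
          rw [Real.rpow_neg_one, div_eq_mul_inv]
        rw [← ENNReal.ofReal_pow (by positivity), this, ENNReal.ofReal_mul (by norm_num)]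
        norm_num
        ring
      _ ≤ _ := by
        rw [mul_div_assoc]
        gcongr
  have hpt : ∀ τ ∈ Set.Ioi t, lipFactor a Z Y τ * ENNReal.ofReal (τ ^ (-(1 / 4) : ℝ))
      ≤ ENNReal.ofReal (7 * a ^ 2 + 12 * ε ^ 2 / t₀) * ENNReal.ofReal (τ ^ (-(5 / 4) : ℝ))
        + 6 * ENNReal.ofReal (t ^ (-(1 / 4) : ℝ)) * (ENNReal.ofReal τ⁻¹ * f τ ^ 2
          + ENNReal.ofReal τ⁻¹ * g τ ^ 2) := by
    intro τ hτ
    have hτ0 : 0 < τ := ht.trans hτ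
    have hτt : t₀ < τ := htt.trans_lt hτ
    calc lipFactor a Z Y τ * ENNReal.ofReal (τ ^ (-(1 / 4) : ℝ))
        ≤ ENNReal.ofReal τ⁻¹ * (ENNReal.ofReal (7 * a ^ 2)
          + (ENNReal.ofReal (6 * ε ^ 2 / t₀) + 6 * f τ ^ 2)
          + (ENNReal.ofReal (6 * ε ^ 2 / t₀) + 6 * g τ ^ 2))
          * ENNReal.ofReal (τ ^ (-(1 / 4) : ℝ)) := by
          rw [lipFactor]
          gcongr
          · exact hsq hτt (hZ τ hτt)
          · exact hsq hτt (hY τ hτt)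
      _ = ENNReal.ofReal (7 * a ^ 2 + 12 * ε ^ 2 / t₀)
            * (ENNReal.ofReal τ⁻¹ * ENNReal.ofReal (τ ^ (-(1 / 4) : ℝ)))
          + 6 * ENNReal.ofReal (τ ^ (-(1 / 4) : ℝ)) * (ENNReal.ofReal τ⁻¹ * f τ ^ 2
          + ENNReal.ofReal τ⁻¹ * g τ ^ 2) := by
          rw [show 7 * a ^ 2 + 12 * ε ^ 2 / t₀ = 7 * a ^ 2 + 6 * ε ^ 2 / t₀ + 6 * ε ^ 2 / t₀ by ring,
            ENNReal.ofReal_add (by positivity) (by positivity),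
            ENNReal.ofReal_add (by positivity) (by positivity)]
          ring
      _ ≤ _ := by
          have h1 : ENNReal.ofReal τ⁻¹ * ENNReal.ofReal (τ ^ (-(1 / 4) : ℝ))
              = ENNReal.ofReal (τ ^ (-(5 / 4) : ℝ)) := by
            rw [← ENNReal.ofReal_mul (by positivity), ← Real.rpow_neg_one, ← Real.rpow_add hτ0]
            norm_num
          have h2 : τ ^ (-(1 / 4) : ℝ) ≤ t ^ (-(1 / 4) : ℝ) :=
            Real.rpow_le_rpow_of_nonpos ht (le_of_lt hτ) (by norm_num)
          rw [h1]
          gcongr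
  refine (setLIntegral_mono' measurableSet_Ioi hpt).trans ?_
  rw [lintegral_add_left (by fun_prop), lintegral_const_mul _ (by fun_prop),
    lintegral_const_mul' _ _ (by finiteness), lintegral_add_left' (by fun_prop),
    lintegral_Ioi_rpow_five_quarters ht]
  have h1 := lintegral_Ioi_inv_mul_sq_le ht hf
  have h2 := lintegral_Ioi_inv_mul_sq_le ht hg
  calc _ ≤ ENNReal.ofReal (7 * a ^ 2 + 12 * ε ^ 2 / t₀) * ENNReal.ofReal (4 * t ^ (-(1 / 4) : ℝ))
        + 6 * ENNReal.ofReal (t ^ (-(1 / 4) : ℝ)) *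
          (ENNReal.ofReal (t ^ (-(1 / 2) : ℝ)) * (∫⁻ τ in Set.Ioi t, f τ ^ (4 : ℝ)) ^ (1 / 2 : ℝ)
          + ENNReal.ofReal (t ^ (-(1 / 2) : ℝ))
            * (∫⁻ τ in Set.Ioi t, g τ ^ (4 : ℝ)) ^ (1 / 2 : ℝ)) := by gcongr
    _ = _ := by
      rw [ENNReal.ofReal_mul (by norm_num : (0 : ℝ) ≤ 4),
        show 28 * a ^ 2 + 48 * ε ^ 2 / t₀ = 4 * (7 * a ^ 2 + 12 * ε ^ 2 / t₀) by ring,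
        ENNReal.ofReal_mul (by norm_num : (0 : ℝ) ≤ 4)]
      ring

/-! ### Uniqueness -/

/-- A backward Grönwall lemma. -/
theorem eq_zero_of_le_lintegral_Ioi {t₀ T : ℝ} {h k : ℝ → ℝ≥0∞}
    (hk : ∫⁻ τ in Set.Ioc t₀ T, k τ ≠ ∞) {M : ℝ≥0∞} (hM : M ≠ ∞) (hhM : ∀ t, t₀ ≤ t → h t ≤ M)
    (hT : ∀ t, T < t → h t = 0) (hle : ∀ t, t₀ ≤ t → h t ≤ ∫⁻ τ in Set.Ioi t, k τ * h τ) {t : ℝ}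
    (ht : t₀ ≤ t) : h t = 0 := by
  -- The infimum S of A is the earliest time after which h vanishes. If S > t₀, then k has mass
  -- below 1/2 on some (s, S], so the supremum of h beyond s is at most half of itself. Hence h
  -- vanishes beyond s < S, a contradiction.
  set A : Set ℝ := {s | t₀ ≤ s ∧ ∀ τ, s < τ → h τ = 0} with hA
  have hAb : BddBelow A := ⟨t₀, fun s hs => hs.1⟩
  have hAne : (max t₀ T) ∈ A := ⟨le_max_left _ _, fun τ hτ => hT τ ((le_max_right _ _).trans_lt hτ)⟩
  set S := sInf A with hS
  have hS0 : t₀ ≤ S := le_csInf ⟨_, hAne⟩ fun s hs => hs.1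
  have hST : S ≤ max t₀ T := csInf_le hAb hAne
  have hSz : ∀ τ, S < τ → h τ = 0 := fun τ hτ => by
    obtain ⟨s, hs, hsτ⟩ := exists_lt_of_csInf_lt ⟨_, hAne⟩ hτ
    exact hs.2 τ hsτ
  have hcut : ∀ s, t₀ ≤ s → s ≤ S → ∀ N, N ≠ ∞ → (∀ τ, s < τ → h τ ≤ N) →
      ∀ τ, s ≤ τ → h τ ≤ (∫⁻ τ in Set.Ioc s S, k τ) * N := by
    intro s hs hsS N hNfin hN τ hτ
    by_cases hτS : S < τ
    · rw [hSz τ hτS]; exact zero_le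
    refine (hle τ (hs.trans hτ)).trans ?_
    rw [← Set.Ioc_union_Ioi_eq_Ioi (not_lt.1 hτS), lintegral_union measurableSet_Ioi
      (Set.Ioc_disjoint_Ioi le_rfl), setLIntegral_congr_fun measurableSet_Ioi
      (g := fun _ => 0) (fun x hx => by simp only [hSz x hx, mul_zero]),
      lintegral_zero, add_zero]
    calc ∫⁻ x in Set.Ioc τ S, k x * h x ≤ ∫⁻ x in Set.Ioc τ S, k x * N :=
          setLIntegral_mono' measurableSet_Ioc fun x hx => by
            gcongr
            exact hN x (hτ.trans_lt hx.1)
      _ = (∫⁻ x in Set.Ioc τ S, k x) * N := lintegral_mul_const' _ _ hNfin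
      _ ≤ _ := by
          gcongr
  have hSeq : S = t₀ := by
    by_contra hne
    have hlt : t₀ < S := lt_of_le_of_ne hS0 (Ne.symm hne)
    have hST' : S ≤ T := (le_max_iff.1 hST).resolve_left (not_le.2 hlt)
    have htend : Tendsto (fun s => ∫⁻ τ in Set.Ioc s S, k τ ∂(volume.restrict (Set.Ioc t₀ T)))
        (𝓝[<] S) (𝓝 0) := by
      refine tendsto_setLIntegral_zero hk ?_
      have h1 : Tendsto (fun s : ℝ => ENNReal.ofReal (S - s)) (𝓝[<] S) (𝓝 0) := by
        have h2 : Continuous fun s : ℝ => ENNReal.ofReal (S - s) :=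
          ENNReal.continuous_ofReal.comp (by fun_prop)
        have h3 := h2.tendsto S
        rw [sub_self, ENNReal.ofReal_zero] at h3
        exact h3.mono_left nhdsWithin_le_nhds
      refine tendsto_of_tendsto_of_tendsto_of_le_of_le tendsto_const_nhds h1
        (fun _ => zero_le) fun s => ?_
      exact (Measure.restrict_apply_le _ _).trans (le_of_eq Real.volume_Ioc)
    obtain ⟨s, hs1, hs2, hs3⟩ := ((htend.eventually_le_const (show (0 : ℝ≥0∞) < 2⁻¹ by simp)).and
      ((eventually_mem_nhdsWithin).and (Ioo_mem_nhdsLT hlt))).exists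
    rw [Measure.restrict_restrict measurableSet_Ioc, Set.inter_eq_left.2
      (Set.Ioc_subset_Ioc hs3.1.le hST')] at hs1
    set N : ℝ≥0∞ := ⨆ τ ∈ Set.Ioi s, h τ with hN
    have hNM : N ≤ M := iSup₂_le fun τ hτ => hhM τ (hs3.1.le.trans (le_of_lt hτ))
    have hNfin : N ≠ ∞ := ne_top_of_le_ne_top hM hNM
    have hNle : ∀ τ, s < τ → h τ ≤ N := fun τ hτ => le_iSup₂ (f := fun τ _ => h τ) τ hτ
    have hN2 : N ≤ 2⁻¹ * N := iSup₂_le fun τ hτ =>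
      (hcut s hs3.1.le hs3.2.le N hNfin hNle τ (le_of_lt hτ)).trans (by gcongr)
    have hN0 : N = 0 := by
      by_contra h
      refine absurd hN2 (not_le.2 ?_)
      rw [mul_comm, ← div_eq_mul_inv]
      exact ENNReal.half_lt_self h hNfin
    have hsA : s ∈ A := ⟨hs3.1.le, fun τ hτ => le_antisymm ((hNle τ hτ).trans hN0.le) zero_le⟩
    exact absurd (csInf_le hAb hsA) (not_le.2 hs3.2)
  -- With S = t₀ the interval of integration is empty, which also covers the endpoint t = t₀.
  have h0 := hcut t₀ le_rfl hS0 M hM (fun τ hτ => hhM τ hτ.le) t ht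
  rw [hSeq, Set.Ioc_self] at h0
  simpa using h0

/-- The path `v₁ - a + w`, with the profile frozen before time `t₀`. -/
noncomputable def perturbedPath (σ a t₀ : ℝ) (u : L2) (w : ℝ → L2) (t : ℝ) : L2 :=
  freePart σ a u (max t₀ t) + w t

theorem perturbedPath_of_le {σ a t₀ : ℝ} {u : L2} {w : ℝ → L2} {t : ℝ} (ht : t₀ ≤ t) :
    perturbedPath σ a t₀ u w t = freePart σ a u t + w t := by
  rw [perturbedPath, max_eq_right ht]

theorem continuous_perturbedPath {σ a t₀ : ℝ} (ht₀ : 0 < t₀) {u : L2} {w : ℝ → L2}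
    (hw : Continuous w) : Continuous (perturbedPath σ a t₀ u w) := by
  refine Continuous.add ?_ hw
  exact (continuousOn_freePart σ a u).comp_continuous (by fun_prop)
    fun t => ht₀.trans_le (le_max_left _ _)

theorem supNorm_freePart_le_rpow (σ a : ℝ) {ε : ℝ} (hε : 0 ≤ ε) {u : L2}
    (hu : eLpNorm u 1 volume ≤ ENNReal.ofReal ε) {t : ℝ} (ht : 0 < t) :
    supNorm (freePart σ a u t) ≤ ENNReal.ofReal (ε * t ^ (-(1 / 2) : ℝ)) := by
  refine (supNorm_freePart_le σ a (ne_top_of_le_ne_top ENNReal.ofReal_ne_top hu) ht.ne').trans ?_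
  rw [ENNReal.ofReal_mul hε, dispersiveKernel, abs_of_pos ht, mul_comm]
  gcongr

theorem supNorm_perturbedPath_le {σ a t₀ ε : ℝ} (ht₀ : 0 < t₀) (hε : 0 ≤ ε) {u : L2}
    (hu : eLpNorm u 1 volume ≤ ENNReal.ofReal ε) (w : ℝ → L2) {τ : ℝ} (hτ : t₀ < τ) :
    supNorm (perturbedPath σ a t₀ u w τ)
      ≤ ENNReal.ofReal (ε * τ ^ (-(1 / 2) : ℝ)) + supNorm (w τ) := by
  rw [perturbedPath_of_le hτ.le]
  exact (eLpNorm_top_add_le _ _).trans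
    (add_le_add_left (supNorm_freePart_le_rpow σ a hε hu (ht₀.trans hτ)) _)

theorem ae_supNorm_perturbedPath_ne_top {σ a t₀ ε : ℝ} (ht₀ : 0 < t₀) (hε : 0 ≤ ε) {u : L2}
    (hu : eLpNorm u 1 volume ≤ ENNReal.ofReal ε) {w : ℝ → L2} (hw : Continuous w)
    (hw4 : ∫⁻ τ in Set.Ioi t₀, supNorm (w τ) ^ (4 : ℝ) ≠ ∞) :
    ∀ᵐ τ ∂volume.restrict (Set.Ioi t₀), supNorm (perturbedPath σ a t₀ u w τ) ≠ ∞ := by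
  have hm : AEMeasurable (fun τ => supNorm (w τ) ^ (4 : ℝ)) (volume.restrict (Set.Ioi t₀)) :=
    (aemeasurable_eLpNorm_top hw.aestronglyMeasurable).pow_const _
  filter_upwards [ae_lt_top' hm hw4, ae_restrict_mem measurableSet_Ioi] with τ h1 h2
  refine ne_top_of_le_ne_top ?_ (supNorm_perturbedPath_le ht₀ hε hu w h2)
  refine ENNReal.add_ne_top.2 ⟨ENNReal.ofReal_ne_top, fun h => ?_⟩
  rw [h, ENNReal.top_rpow_of_pos (by norm_num)] at h1
  exact lt_irrefl _ h1

theorem lintegral_lipFactor_perturbedPath_le (σ a : ℝ) {ε t₀ t : ℝ} (hε : 0 ≤ ε) (ht₀ : 0 < t₀)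
    (htt : t₀ ≤ t) {u : L2} (hu : eLpNorm u 1 volume ≤ ENNReal.ofReal ε) {w y : ℝ → L2}
    (hw : Continuous w) (hy : Continuous y) :
    ∫⁻ τ in Set.Ioi t, lipFactor a (perturbedPath σ a t₀ u w) (perturbedPath σ a t₀ u y) τ
        * ENNReal.ofReal (τ ^ (-(1 / 4) : ℝ))
      ≤ ENNReal.ofReal (t ^ (-(1 / 4) : ℝ)) * (ENNReal.ofReal (28 * a ^ 2 + 48 * ε ^ 2 / t₀)
        + 6 * ENNReal.ofReal (t ^ (-(1 / 2) : ℝ))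
          * ((∫⁻ τ in Set.Ioi t, supNorm (w τ) ^ (4 : ℝ)) ^ (1 / 2 : ℝ)
            + (∫⁻ τ in Set.Ioi t, supNorm (y τ) ^ (4 : ℝ)) ^ (1 / 2 : ℝ))) :=
  lintegral_lipFactor_le a hε ht₀ htt (fun _ h => supNorm_perturbedPath_le ht₀ hε hu w h)
    (fun _ h => supNorm_perturbedPath_le ht₀ hε hu y h)
    (aemeasurable_eLpNorm_top hw.aestronglyMeasurable)
    (aemeasurable_eLpNorm_top hy.aestronglyMeasurable)

theorem lintegral_Ioc_ne_top_of_weighted {t₀ T : ℝ} (ht₀ : 0 < t₀) {k : ℝ → ℝ≥0∞}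
    (hk : ∫⁻ τ in Set.Ioi t₀, k τ * ENNReal.ofReal (τ ^ (-(1 / 4) : ℝ)) ≠ ∞) :
    ∫⁻ τ in Set.Ioc t₀ T, k τ ≠ ∞ := by
  have h1 : ∫⁻ τ in Set.Ioc t₀ T, k τ ≤ ∫⁻ τ in Set.Ioc t₀ T,
      k τ * ENNReal.ofReal (τ ^ (-(1 / 4) : ℝ)) * ENNReal.ofReal (T ^ (1 / 4 : ℝ)) := by
    refine setLIntegral_mono' measurableSet_Ioc fun τ hτ => ?_
    have hτ0 : 0 < τ := ht₀.trans hτ.1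
    rw [mul_assoc, ← ENNReal.ofReal_mul (by positivity)]
    refine le_mul_of_one_le_right' ?_
    rw [ENNReal.one_le_ofReal, Real.rpow_neg hτ0.le, ← div_eq_inv_mul,
      one_le_div (by positivity)]
    exact Real.rpow_le_rpow hτ0.le hτ.2 (by norm_num)
  refine ne_top_of_le_ne_top ?_ h1
  rw [lintegral_mul_const' _ _ ENNReal.ofReal_ne_top]
  exact ENNReal.mul_ne_top (ne_top_of_le_ne_top hk
    (lintegral_mono_set Set.Ioc_subset_Ioi_self)) ENNReal.ofReal_ne_top

theorem weighted_bound_ne_top {c s t : ℝ} {x y : ℝ≥0∞} (hx : x ≠ ∞) (hy : y ≠ ∞) :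
    ENNReal.ofReal c * (ENNReal.ofReal s + 6 * ENNReal.ofReal t
      * (x ^ (1 / 2 : ℝ) + y ^ (1 / 2 : ℝ))) ≠ ∞ := by
  have h1 : x ^ (1 / 2 : ℝ) ≠ ∞ := ENNReal.rpow_ne_top_of_nonneg (by norm_num) hx
  have h2 : y ^ (1 / 2 : ℝ) ≠ ∞ := ENNReal.rpow_ne_top_of_nonneg (by norm_num) hy
  finiteness

theorem forcing_zero (σ a τ : ℝ) : forcing σ a (fun _ => 0) τ = 0 := by
  rw [forcing, nonlinearity_zero, smul_zero]

theorem aestronglyMeasurable_forcing (σ a : ℝ) {Z : ℝ → L2} {μ : Measure ℝ}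
    (hZ : AEStronglyMeasurable Z μ) (hfin : ∀ᵐ τ ∂μ, supNorm (Z τ) ≠ ∞) :
    AEStronglyMeasurable (forcing σ a Z) μ :=
  (Measurable.aestronglyMeasurable (f := fun τ : ℝ => Complex.I * ((σ / τ : ℝ) : ℂ))
    (by fun_prop)).smul (aestronglyMeasurable_nonlinearity a hZ hfin)

/-- The Lipschitz estimate is applied against the zero path, whose forcing is zero; on a bounded
time interval the path is bounded in L². -/
theorem integrableOn_forcing {σ a t₀ ε : ℝ} (hσ : |σ| = 1) (ht₀ : 0 < t₀) (hε : 0 ≤ ε) {u : L2}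
    (hu : eLpNorm u 1 volume ≤ ENNReal.ofReal ε) {w : ℝ → L2} (hw : Continuous w)
    (hw4 : ∫⁻ τ in Set.Ioi t₀, supNorm (w τ) ^ (4 : ℝ) ≠ ∞) (T : ℝ) :
    IntegrableOn (forcing σ a (perturbedPath σ a t₀ u w)) (Set.Ioc t₀ T) := by
  have hZ := continuous_perturbedPath (σ := σ) (a := a) ht₀ (u := u) hw
  refine ⟨aestronglyMeasurable_forcing σ a hZ.aestronglyMeasurable
    (ae_restrict_of_ae_restrict_of_subset Set.Ioc_subset_Ioi_self
      (ae_supNorm_perturbedPath_ne_top ht₀ hε hu hw hw4)), ?_⟩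
  obtain ⟨M, hM⟩ := isCompact_Icc.exists_bound_of_continuousOn
    (hZ.continuousOn (s := Set.Icc t₀ T))
  set Z := perturbedPath σ a t₀ u w with hZdef
  have hk : ∫⁻ τ in Set.Ioi t₀, lipFactor a Z (fun _ => 0) τ * ENNReal.ofReal (τ ^ (-(1 / 4) : ℝ))
      ≠ ∞ := by
    refine ne_top_of_le_ne_top ?_ (lintegral_lipFactor_le a hε ht₀ le_rfl
      (fun _ h => supNorm_perturbedPath_le ht₀ hε hu w h)
      (fun _ _ => by rw [supNorm_zero]; exact zero_le)
      (aemeasurable_eLpNorm_top hw.aestronglyMeasurable) (g := fun _ => 0) aemeasurable_const)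
    refine weighted_bound_ne_top hw4 ?_
    simp
  have hk' := lintegral_Ioc_ne_top_of_weighted (T := T) ht₀ hk
  refine lt_of_le_of_lt (b := ∫⁻ τ in Set.Ioc t₀ T, lipFactor a Z (fun _ => 0) τ * ENNReal.ofReal M)
    (setLIntegral_mono' measurableSet_Ioc fun τ hτ => ?_) ?_
  · have h1 := enorm_forcing_sub_le hσ a Z (fun _ => 0) (ht₀.trans hτ.1)
    rw [forcing_zero, sub_zero, sub_zero] at h1
    refine h1.trans ?_
    gcongr
    rw [← ofReal_norm]
    exact ENNReal.ofReal_le_ofReal (hM τ ⟨hτ.1.le, hτ.2⟩)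
  · rw [lintegral_mul_const' _ _ ENNReal.ofReal_ne_top]
    exact ENNReal.mul_lt_top hk'.lt_top ENNReal.ofReal_lt_top

theorem IsMildSolution.enorm_sub_le_add_lintegral {t₀ : ℝ} {Z Y F G : ℝ → L2} (hZ : IsMildSolution t₀ Z F)
    (hY : IsMildSolution t₀ Y G) (hF : ∀ T, IntegrableOn F (Set.Ioc t₀ T))
    (hG : ∀ T, IntegrableOn G (Set.Ioc t₀ T)) {t T : ℝ} (ht : t₀ ≤ t) (htT : t ≤ T) :
    ‖Z t - Y t‖ₑ ≤ ‖Z T - Y T‖ₑ + ∫⁻ τ in Set.Ioi t, ‖F τ - G τ‖ₑ := by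
  have hFi : ∀ {F : ℝ → L2}, (∀ T, IntegrableOn F (Set.Ioc t₀ T)) → ∀ T, t₀ ≤ T →
      IntervalIntegrable (fun τ => freeGroup (-τ) (F τ)) volume t₀ T := fun hF T hT =>
    (intervalIntegrable_iff_integrableOn_Ioc_of_le hT).2 (integrable_freeGroup_neg (hF T))
  have hT : t₀ ≤ T := ht.trans htT
  have key : freeGroup (-t) (Z t - Y t) = freeGroup (-T) (Z T - Y T)
      - ∫ τ in t..T, freeGroup (-τ) (F τ - G τ) := by
    have h1 : ∀ τ, freeGroup (-τ) (F τ - G τ) = freeGroup (-τ) (F τ) - freeGroup (-τ) (G τ) :=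
      fun τ => map_sub _ _ _
    simp_rw [h1]
    rw [← intervalIntegral.integral_interval_sub_left ((hFi hF T hT).sub (hFi hG T hT))
      ((hFi hF t ht).sub (hFi hG t ht)), intervalIntegral.integral_sub (hFi hF T hT) (hFi hG T hT),
      intervalIntegral.integral_sub (hFi hF t ht) (hFi hG t ht), map_sub, map_sub,
      hZ t ht, hY t ht, hZ T hT, hY T hT]
    abel
  rw [← LinearIsometry.enorm_map (freeGroup (-t)), key]
  refine (enorm_sub_le).trans ?_
  rw [LinearIsometry.enorm_map, intervalIntegral.integral_of_le htT]
  gcongr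
  refine (enorm_integral_le_lintegral_enorm _).trans ?_
  simp_rw [LinearIsometry.enorm_map]
  exact lintegral_mono_set Set.Ioc_subset_Ioi_self

/-- Both perturbations vanish at infinity, so the two Duhamel formulas give h(t) ≤ ∫_t^∞ k h for h =
‖w - y‖. The assumed decay makes t^{1/4}h bounded near infinity, and there the weighted integral of
k is at most 1/2, forcing h = 0. The backward Grönwall lemma treats the remaining bounded interval,
where no smallness is available. -/
theorem perturbedPath_unique {σ a t₀ ε : ℝ} (hσ : |σ| = 1) (ht₀ : 0 < t₀) (hε : 0 ≤ ε)
    (hsmall : 28 * a ^ 2 + 48 * ε ^ 2 / t₀ ≤ 1 / 4) {u : L2}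
    (hu : eLpNorm u 1 volume ≤ ENNReal.ofReal ε) {w y : ℝ → L2} (hw : Continuous w)
    (hy : Continuous y) (hw4 : ∫⁻ τ in Set.Ioi t₀, supNorm (w τ) ^ (4 : ℝ) ≠ ∞)
    (hy4 : ∫⁻ τ in Set.Ioi t₀, supNorm (y τ) ^ (4 : ℝ) ≠ ∞)
    {C : ℝ} (hwC : ∀ᶠ t in atTop, ‖w t‖ₑ ≤ ENNReal.ofReal (C * t ^ (-(1 / 4) : ℝ)))
    (hyC : ∀ᶠ t in atTop, ‖y t‖ₑ ≤ ENNReal.ofReal (C * t ^ (-(1 / 4) : ℝ)))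
    (hwm : IsMildSolution t₀ (perturbedPath σ a t₀ u w)
      (forcing σ a (perturbedPath σ a t₀ u w)))
    (hym : IsMildSolution t₀ (perturbedPath σ a t₀ u y)
      (forcing σ a (perturbedPath σ a t₀ u y))) {t : ℝ} (ht : t₀ ≤ t) : w t = y t := by
  set Z := perturbedPath σ a t₀ u w with hZ
  set Y := perturbedPath σ a t₀ u y with hY
  set h : ℝ → ℝ≥0∞ := fun t => ‖w t - y t‖ₑ with hh
  set k := lipFactor a Z Y with hk
  have hZY : ∀ t, Z t - Y t = w t - y t := fun t => by
    rw [hZ, hY, perturbedPath, perturbedPath, add_sub_add_left_eq_sub]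
  have hdecay : ∀ᶠ t in atTop, h t ≤ ENNReal.ofReal (2 * |C|) * ENNReal.ofReal (t ^ (-(1 / 4) : ℝ)) := by
    filter_upwards [hwC, hyC, eventually_gt_atTop 0] with t h1 h2 h3
    rw [← ENNReal.ofReal_mul (by positivity), two_mul, add_mul,
      ENNReal.ofReal_add (by positivity) (by positivity)]
    have h4 : C * t ^ (-(1 / 4) : ℝ) ≤ |C| * t ^ (-(1 / 4) : ℝ) := by
      gcongr
      exact le_abs_self C
    exact enorm_sub_le.trans (add_le_add (h1.trans (ENNReal.ofReal_le_ofReal h4))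
      (h2.trans (ENNReal.ofReal_le_ofReal h4)))
  have hpow0 : ∀ p : ℝ, 0 < p → Tendsto (fun t : ℝ => ENNReal.ofReal (t ^ (-p))) atTop (𝓝 0) := by
    intro p hp
    have := ENNReal.tendsto_ofReal (tendsto_rpow_neg_atTop hp)
    rwa [ENNReal.ofReal_zero] at this
  have hlim : Tendsto h atTop (𝓝 0) := by
    refine tendsto_of_tendsto_of_tendsto_of_le_of_le' tendsto_const_nhds ?_
      (Eventually.of_forall fun _ => zero_le) hdecay
    have := ENNReal.Tendsto.const_mul (hpow0 (1 / 4) (by norm_num))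
      (Or.inr (ENNReal.ofReal_ne_top (r := 2 * |C|)))
    rwa [mul_zero] at this
  have hle : ∀ t, t₀ ≤ t → h t ≤ ∫⁻ τ in Set.Ioi t, k τ * h τ := by
    intro t ht
    have h1 : ∀ᶠ T in atTop, h t ≤ h T + ∫⁻ τ in Set.Ioi t, k τ * h τ := by
      filter_upwards [eventually_ge_atTop t] with T hT
      have h2 := hwm.enorm_sub_le_add_lintegral hym (integrableOn_forcing hσ ht₀ hε hu hw hw4)
        (integrableOn_forcing hσ ht₀ hε hu hy hy4) ht hT
      rw [hZY, hZY] at h2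
      refine h2.trans (add_le_add le_rfl (setLIntegral_mono' measurableSet_Ioi fun τ hτ => ?_))
      have h3 := enorm_forcing_sub_le hσ a Z Y (ht₀.trans (ht.trans_lt hτ))
      rwa [hZY] at h3
    have h2 := hlim.add_const (∫⁻ τ in Set.Ioi t, k τ * h τ)
    rw [zero_add] at h2
    exact ge_of_tendsto h2 h1
  set L : ℝ≥0∞ := (∫⁻ τ in Set.Ioi t₀, supNorm (w τ) ^ (4 : ℝ)) ^ (1 / 2 : ℝ)
    + (∫⁻ τ in Set.Ioi t₀, supNorm (y τ) ^ (4 : ℝ)) ^ (1 / 2 : ℝ) with hL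
  have hLfin : L ≠ ∞ := by
    have h1 := ENNReal.rpow_ne_top_of_nonneg (y := 1 / 2) (by norm_num) hw4
    have h2 := ENNReal.rpow_ne_top_of_nonneg (y := 1 / 2) (by norm_num) hy4
    exact ENNReal.add_ne_top.2 ⟨h1, h2⟩
  have hweight : ∀ t, t₀ ≤ t → ∫⁻ τ in Set.Ioi t, k τ * ENNReal.ofReal (τ ^ (-(1 / 4) : ℝ))
      ≤ ENNReal.ofReal (t ^ (-(1 / 4) : ℝ))
        * (ENNReal.ofReal (1 / 4) + 6 * L * ENNReal.ofReal (t ^ (-(1 / 2) : ℝ))) := by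
    intro t ht
    refine (lintegral_lipFactor_perturbedPath_le σ a hε ht₀ ht hu hw hy).trans ?_
    rw [mul_right_comm 6 L, mul_assoc 6]
    have hs : Set.Ioi t ⊆ Set.Ioi t₀ := Set.Ioi_subset_Ioi ht
    rw [mul_assoc 6]
    gcongr
    rw [hL]
    gcongr
  have hsmallT : ∀ᶠ t in atTop, 6 * L * ENNReal.ofReal (t ^ (-(1 / 2) : ℝ)) ≤ ENNReal.ofReal (1 / 4) := by
    have h1 := ENNReal.Tendsto.const_mul (hpow0 (1 / 2) (by norm_num))
      (Or.inr (ENNReal.mul_ne_top (by norm_num : (6 : ℝ≥0∞) ≠ ∞) hLfin))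
    rw [mul_zero] at h1
    exact h1.eventually_le_const (by simp)
  -- Beyond T the L⁴L^∞ contribution is at most 1/4, however large the constant L. Together with the
  -- 1/4 from the smallness of a and ε the total factor is 1/2.
  obtain ⟨T, hT⟩ := ((hdecay.and hsmallT).and (eventually_ge_atTop t₀)).exists_forall_of_atTop
  have hzero : ∀ t, T < t → h t = 0 := by
    set H : ℝ≥0∞ := ⨆ s ∈ Set.Ioi T, h s * ENNReal.ofReal (s ^ (1 / 4 : ℝ)) with hH
    have hcancel : ∀ s, 0 < s → ENNReal.ofReal (s ^ (-(1 / 4) : ℝ)) * ENNReal.ofReal (s ^ (1 / 4 : ℝ))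
        = 1 := by
      intro s hs
      rw [← ENNReal.ofReal_mul (by positivity), ← Real.rpow_add hs]
      norm_num
    have hHfin : H ≠ ∞ := by
      refine ne_top_of_le_ne_top (ENNReal.ofReal_ne_top (r := 2 * |C|)) (iSup₂_le fun s hs => ?_)
      have hs' := hT s (le_of_lt hs)
      calc h s * ENNReal.ofReal (s ^ (1 / 4 : ℝ))
          ≤ ENNReal.ofReal (2 * |C|) * ENNReal.ofReal (s ^ (-(1 / 4) : ℝ))
            * ENNReal.ofReal (s ^ (1 / 4 : ℝ)) := by
            gcongr
            exact hs'.1.1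
        _ = _ := by rw [mul_assoc, hcancel s (ht₀.trans_le hs'.2), mul_one]
    have hHle : ∀ s, T < s → h s ≤ ENNReal.ofReal (s ^ (-(1 / 4) : ℝ)) * H := by
      intro s hs
      have hs0 := ht₀.trans_le (hT s hs.le).2
      calc h s = ENNReal.ofReal (s ^ (-(1 / 4) : ℝ)) * (h s * ENNReal.ofReal (s ^ (1 / 4 : ℝ))) := by
            rw [mul_left_comm, hcancel s hs0, mul_one]
        _ ≤ _ := by
            gcongr
            exact le_iSup₂ (f := fun s _ => h s * ENNReal.ofReal (s ^ (1 / 4 : ℝ))) s hs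
    have hH2 : H ≤ 2⁻¹ * H := by
      refine iSup₂_le fun s hs => ?_
      have hs' := hT s (le_of_lt hs)
      have hs0 := ht₀.trans_le hs'.2
      calc h s * ENNReal.ofReal (s ^ (1 / 4 : ℝ))
          ≤ (∫⁻ τ in Set.Ioi s, k τ * ENNReal.ofReal (τ ^ (-(1 / 4) : ℝ)) * H)
            * ENNReal.ofReal (s ^ (1 / 4 : ℝ)) := by
            gcongr
            refine (hle s hs'.2).trans (setLIntegral_mono' measurableSet_Ioi fun τ hτ => ?_)
            rw [mul_assoc]
            gcongr
            exact hHle τ (lt_trans hs hτ)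
        _ ≤ ENNReal.ofReal (s ^ (-(1 / 4) : ℝ)) * (ENNReal.ofReal (1 / 4) + ENNReal.ofReal (1 / 4))
            * H * ENNReal.ofReal (s ^ (1 / 4 : ℝ)) := by
            rw [lintegral_mul_const' _ _ hHfin]
            gcongr
            refine (hweight s hs'.2).trans ?_
            gcongr
            exact hs'.1.2
        _ = (ENNReal.ofReal (1 / 4) + ENNReal.ofReal (1 / 4)) * H := by
            rw [mul_right_comm _ _ H, mul_assoc, mul_comm _ (ENNReal.ofReal (s ^ (1 / 4 : ℝ))),
              mul_assoc, mul_left_comm H, ← mul_assoc, hcancel s hs0, one_mul, mul_comm]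
        _ = 2⁻¹ * H := by
            rw [← ENNReal.ofReal_add (by norm_num) (by norm_num),
              show (1 / 4 + 1 / 4 : ℝ) = 2⁻¹ by norm_num, ENNReal.ofReal_inv_of_pos (by norm_num)]
            norm_num
    have hH0 : H = 0 := by
      by_contra h
      refine absurd hH2 (not_le.2 ?_)
      rw [mul_comm, ← div_eq_mul_inv]
      exact ENNReal.half_lt_self h hHfin
    intro s hs
    have := hHle s hs
    rw [hH0, mul_zero] at this
    exact le_antisymm this zero_le
  obtain ⟨M, hM⟩ := isCompact_Icc.exists_bound_of_continuousOn
    ((hw.sub hy).continuousOn (s := Set.Icc t₀ T))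
  have hkfin : ∫⁻ τ in Set.Ioc t₀ T, k τ ≠ ∞ := by
    refine lintegral_Ioc_ne_top_of_weighted ht₀ (ne_top_of_le_ne_top ?_ (hweight t₀ le_rfl))
    finiteness
  have h0 := eq_zero_of_le_lintegral_Ioi hkfin (ENNReal.ofReal_ne_top (r := M)) (fun t ht => by
    by_cases htT : t ≤ T
    · rw [hh]
      dsimp only
      rw [← ofReal_norm]
      exact ENNReal.ofReal_le_ofReal (hM t ⟨ht, htT⟩)
    · rw [hzero t (not_le.1 htT)]
      exact zero_le) hzero hle ht
  exact sub_eq_zero.1 (enorm_eq_zero.1 h0)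

/-! ### The conjugate linear term -/

/-- The resonant part `i σ a² z̄ / t` of the forcing. -/
noncomputable def conjForcing (σ a : ℝ) (u : L2) (τ : ℝ) : L2 :=
  (Complex.I * ((σ / τ : ℝ) : ℂ)) • (a : ℂ) ^ 2 • conjL2 (freePart σ a u τ)

theorem conjL2_smul (c : ℂ) (f : L2) : conjL2 (c • f) = (starRingEnd ℂ) c • conjL2 f := by
  apply Lp.ext
  filter_upwards [conjL2_ae (c • f), Lp.coeFn_smul c f, conjL2_ae f,
    Lp.coeFn_smul ((starRingEnd ℂ) c) (conjL2 f)] with x h1 h2 h3 h4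
  rw [h1, h2, h4, Pi.smul_apply, Pi.smul_apply, h3, smul_eq_mul, smul_eq_mul, map_mul]

/-- The conjugate of the profile evolves backwards, so with s = -τ the group acts at time -2τ. The
time dependence does not cancel as it does for the term a²z, and dispersion can be used. -/
theorem freeGroup_conjForcing (σ a : ℝ) (u : L2) (s τ : ℝ) : freeGroup s (conjForcing σ a u τ)
    = (Complex.I * ((σ / τ : ℝ) : ℂ) * ((a : ℂ) ^ 2 * (starRingEnd ℂ) (phase σ a τ)))
      • freeGroup (s - τ) (conjL2 u) := by
  rw [conjForcing, freePart, conjL2_smul, conjL2_freeGroup, map_smul, map_smul, map_smul,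
    ← freeGroup_add, smul_smul, smul_smul, mul_assoc, sub_eq_add_neg]

theorem enorm_conjForcing_coeff {σ : ℝ} (hσ : |σ| = 1) (a : ℝ) {τ : ℝ} (hτ : 0 < τ) :
    ‖Complex.I * ((σ / τ : ℝ) : ℂ) * ((a : ℂ) ^ 2 * (starRingEnd ℂ) (phase σ a τ))‖ₑ
      = ENNReal.ofReal (a ^ 2 * τ⁻¹) := by
  rw [enorm_mul, enorm_I_mul_div hσ hτ, ← ofReal_norm, norm_mul, RCLike.norm_conj, norm_phase,
    mul_one, norm_pow, Complex.norm_real, Real.norm_eq_abs, sq_abs, mul_comm,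
    ENNReal.ofReal_mul (sq_nonneg a)]

theorem continuousOn_conjForcing (σ a : ℝ) (u : L2) :
    ContinuousOn (conjForcing σ a u) (Set.Ioi 0) := by
  unfold conjForcing
  refine ContinuousOn.smul (continuousOn_const.mul (Complex.continuous_ofReal.comp_continuousOn
    (continuousOn_const.div continuousOn_id fun τ hτ => ne_of_gt hτ))) ?_
  exact (conjL2.continuous.comp_continuousOn (continuousOn_freePart σ a u)).const_smul ((a : ℂ) ^ 2)

theorem dispersiveKernel_two_mul_le {x : ℝ} (hx : x ≠ 0) :
    dispersiveKernel (2 * x) ≤ dispersiveKernel x := by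
  refine ENNReal.ofReal_le_ofReal (Real.rpow_le_rpow_of_nonpos (abs_pos.2 hx) ?_ (by norm_num))
  rw [abs_mul, abs_two]
  linarith [abs_nonneg x]

/-- A direct norm bound diverges logarithmically as T → ∞. The TT* estimate with α(τ) = a²ε/τ needs
only the L^{4/3} norm: ∫ τ^{-4/3} over (t,∞) is 3t^{-1/3}, and 4 · 3^{3/4} ≤ 12. The unimodular
phases disappear in absolute values. -/
theorem enorm_integral_conjForcing_le {σ : ℝ} (hσ : |σ| = 1) (a : ℝ) {ε : ℝ} (hε : 0 ≤ ε) {u : L2}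
    (hu : eLpNorm u 1 volume ≤ ENNReal.ofReal ε) {t T : ℝ} (ht : 0 < t) :
    ‖∫ τ in Set.Ioc t T, freeGroup (-τ) (conjForcing σ a u τ)‖ₑ
      ≤ ENNReal.ofReal (12 * a ^ 2 * ε * t ^ (-(1 / 4) : ℝ)) := by
  set A : ℝ → L2 := (Set.Ioc t T).indicator fun τ => freeGroup (-τ) (conjForcing σ a u τ) with hA
  set α : ℝ → ℝ≥0∞ := (Set.Ioc t T).indicator fun τ => ENNReal.ofReal (a ^ 2 * ε * τ⁻¹) with hα
  have hAint : Integrable A := by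
    refine (integrable_indicator_iff measurableSet_Ioc).2 (integrable_freeGroup_neg ?_)
    refine ((continuousOn_conjForcing σ a u).mono ?_).integrableOn_Icc.mono_set
      Set.Ioc_subset_Icc_self
    exact fun τ hτ => ht.trans_le hτ.1
  have hαm : Measurable α := Measurable.indicator (by fun_prop) measurableSet_Ioc
  have hu' : eLpNorm (conjL2 u) 1 volume ≠ ∞ := by
    rw [eLpNorm_conjL2]
    exact ne_top_of_le_ne_top ENNReal.ofReal_ne_top hu
  have hdisp : ∀ s τ, s ≠ τ → ‖inner ℂ (A s) (A τ)‖ₑ ≤ dispersiveKernel (τ - s) * α s * α τ := by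
    intro s τ hsτ
    by_cases hs : s ∈ Set.Ioc t T
    swap
    · simp [hA, Set.indicator_of_notMem hs]
    by_cases hτ : τ ∈ Set.Ioc t T
    swap
    · simp [hA, Set.indicator_of_notMem hτ]
    have hs0 := ht.trans hs.1
    have hτ0 := ht.trans hτ.1
    simp only [hA, hα]
    rw [Set.indicator_of_mem hs, Set.indicator_of_mem hs, Set.indicator_of_mem hτ,
      Set.indicator_of_mem hτ, freeGroup_conjForcing, freeGroup_conjForcing, inner_smul_left,
      inner_smul_right, enorm_mul, enorm_mul, RCLike.enorm_conj, enorm_conjForcing_coeff hσ a hs0,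
      enorm_conjForcing_coeff hσ a hτ0]
    have h1 : ‖inner ℂ (freeGroup (-s - s) (conjL2 u)) (freeGroup (-τ - τ) (conjL2 u))‖ₑ
        ≤ dispersiveKernel (τ - s) * ENNReal.ofReal ε * ENNReal.ofReal ε := by
      have h2 := enorm_inner_freeGroup_neg_le (s := 2 * s) (t := 2 * τ)
        (fun h => hsτ (by linarith)) (conjL2 u) (conjL2 u) hu' hu'
      rw [← mul_sub, eLpNorm_conjL2] at h2
      rw [show -s - s = -(2 * s) by ring, show -τ - τ = -(2 * τ) by ring]
      refine h2.trans ?_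
      gcongr
      exact dispersiveKernel_two_mul_le (sub_ne_zero.2 (Ne.symm hsτ))
    rw [show a ^ 2 * ε * s⁻¹ = a ^ 2 * s⁻¹ * ε by ring, show a ^ 2 * ε * τ⁻¹ = a ^ 2 * τ⁻¹ * ε by ring,
      ENNReal.ofReal_mul (p := a ^ 2 * s⁻¹) (by positivity),
      ENNReal.ofReal_mul (p := a ^ 2 * τ⁻¹) (by positivity)]
    calc _ ≤ ENNReal.ofReal (a ^ 2 * s⁻¹) * (ENNReal.ofReal (a ^ 2 * τ⁻¹)
          * (dispersiveKernel (τ - s) * ENNReal.ofReal ε * ENNReal.ofReal ε)) := by gcongr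
      _ = _ := by ring
  have h1 := enorm_integral_le_of_dispersive hAint hαm hdisp
  rw [hA, integral_indicator measurableSet_Ioc] at h1
  refine h1.trans ?_
  have h2 : ∫⁻ s, α s ^ (4 / 3 : ℝ)
      ≤ ENNReal.ofReal ((a ^ 2 * ε) ^ (4 / 3 : ℝ) * (3 * t ^ (-(1 / 3) : ℝ))) := by
    calc ∫⁻ s, α s ^ (4 / 3 : ℝ)
        = ∫⁻ s in Set.Ioc t T, ENNReal.ofReal (a ^ 2 * ε * s⁻¹) ^ (4 / 3 : ℝ) := by
          rw [← lintegral_indicator measurableSet_Ioc]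
          refine lintegral_congr fun s => ?_
          by_cases hs : s ∈ Set.Ioc t T
          · simp only [hα]
            rw [Set.indicator_of_mem hs, Set.indicator_of_mem hs]
          · simp only [hα]
            rw [Set.indicator_of_notMem hs, Set.indicator_of_notMem hs,
              ENNReal.zero_rpow_of_pos (by norm_num)]
      _ ≤ ∫⁻ s in Set.Ioi t, ENNReal.ofReal (a ^ 2 * ε * s⁻¹) ^ (4 / 3 : ℝ) :=
          lintegral_mono_set Set.Ioc_subset_Ioi_self
      _ = ∫⁻ s in Set.Ioi t, ENNReal.ofReal ((a ^ 2 * ε) ^ (4 / 3 : ℝ))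
            * ENNReal.ofReal (s ^ (-(4 / 3) : ℝ)) := by
          refine setLIntegral_congr_fun measurableSet_Ioi fun s hs => ?_
          have hs0 : 0 < s := ht.trans hs
          rw [ENNReal.ofReal_rpow_of_nonneg (by positivity) (by norm_num),
            Real.mul_rpow (by positivity) (by positivity), ENNReal.ofReal_mul (by positivity),
            ← Real.rpow_neg_one, ← Real.rpow_mul hs0.le]
          norm_num
      _ = _ := by
          rw [lintegral_const_mul _ (by fun_prop), lintegral_Ioi_rpow (by norm_num) ht,
            ← ENNReal.ofReal_mul (by positivity)]
          congr 2
          norm_num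
          ring
  calc 4 * (∫⁻ s, α s ^ (4 / 3 : ℝ)) ^ (3 / 4 : ℝ)
      ≤ 4 * ENNReal.ofReal ((a ^ 2 * ε) ^ (4 / 3 : ℝ) * (3 * t ^ (-(1 / 3) : ℝ))) ^ (3 / 4 : ℝ) := by
        gcongr
    _ = ENNReal.ofReal (4 * (a ^ 2 * ε * (3 ^ (3 / 4 : ℝ) * t ^ (-(1 / 4) : ℝ)))) := by
        rw [ENNReal.ofReal_rpow_of_nonneg (by positivity) (by norm_num),
          Real.mul_rpow (x := (a ^ 2 * ε) ^ (4 / 3 : ℝ)) (by positivity) (by positivity),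
          Real.mul_rpow (x := 3) (by positivity) (by positivity),
          ← Real.rpow_mul (by positivity), ← Real.rpow_mul ht.le,
          ENNReal.ofReal_mul (by norm_num : (0 : ℝ) ≤ 4)]
        norm_num
    _ ≤ _ := by
        apply ENNReal.ofReal_le_ofReal
        have h3 : (3 : ℝ) ^ (3 / 4 : ℝ) ≤ 3 := by
          calc (3 : ℝ) ^ (3 / 4 : ℝ) ≤ 3 ^ (1 : ℝ) :=
                Real.rpow_le_rpow_of_exponent_le (by norm_num) (by norm_num)
            _ = 3 := Real.rpow_one 3
        calc _ ≤ 4 * (a ^ 2 * ε * (3 * t ^ (-(1 / 4) : ℝ))) := by gcongr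
          _ = _ := by ring

/-- The dispersive time is |t - 2τ| ≥ τ for τ ≥ t, so the integrand is at most a²ετ^{-3/2} in L^∞
and converges absolutely in that norm. -/
theorem supNorm_integral_conjForcing_le {σ : ℝ} (hσ : |σ| = 1) (a : ℝ) {ε : ℝ} (hε : 0 ≤ ε)
    {u : L2} (hu : eLpNorm u 1 volume ≤ ENNReal.ofReal ε) {t T : ℝ} (ht : 0 < t) :
    supNorm (freeGroup t (∫ τ in Set.Ioc t T, freeGroup (-τ) (conjForcing σ a u τ)))
      ≤ ENNReal.ofReal (2 * a ^ 2 * ε * t ^ (-(1 / 2) : ℝ)) := by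
  have hint : IntegrableOn (fun τ => freeGroup (-τ) (conjForcing σ a u τ)) (Set.Ioc t T) := by
    refine integrable_freeGroup_neg ?_
    refine ((continuousOn_conjForcing σ a u).mono ?_).integrableOn_Icc.mono_set
      Set.Ioc_subset_Icc_self
    exact fun τ hτ => ht.trans_le hτ.1
  have hu' : eLpNorm (conjL2 u) 1 volume ≠ ∞ := by
    rw [eLpNorm_conjL2]
    exact ne_top_of_le_ne_top ENNReal.ofReal_ne_top hu
  have h1 := (freeGroup t).toContinuousLinearMap.integral_comp_comm hint
  simp only [LinearIsometry.coe_toContinuousLinearMap] at h1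
  rw [← h1]
  refine (eLpNorm_top_integral_le
    ((freeGroup t).toContinuousLinearMap.integrable_comp hint)).trans ?_
  calc _ ≤ ∫⁻ τ in Set.Ioc t T, ENNReal.ofReal (a ^ 2 * ε) * ENNReal.ofReal (τ ^ (-(3 / 2) : ℝ)) := by
        refine setLIntegral_mono' measurableSet_Ioc fun τ hτ => ?_
        have hτ0 := ht.trans hτ.1
        rw [LinearIsometry.coe_toContinuousLinearMap, ← freeGroup_add, freeGroup_conjForcing, ← supNorm, supNorm_smul,
          enorm_conjForcing_coeff hσ a hτ0]
        have h2 := eLpNorm_top_freeGroup_le (t := t + -τ - τ) (by linarith [hτ.1]) (conjL2 u) hu'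
        rw [eLpNorm_conjL2] at h2
        have h3 : dispersiveKernel (t + -τ - τ) ≤ ENNReal.ofReal (τ ^ (-(1 / 2) : ℝ)) := by
          refine ENNReal.ofReal_le_ofReal (Real.rpow_le_rpow_of_nonpos hτ0 ?_ (by norm_num))
          rw [abs_of_neg (by linarith [hτ.1])]
          linarith [hτ.1]
        calc _ ≤ ENNReal.ofReal (a ^ 2 * τ⁻¹)
              * (ENNReal.ofReal (τ ^ (-(1 / 2) : ℝ)) * ENNReal.ofReal ε) := by
              gcongr
              exact h2.trans (by gcongr)
          _ = _ := by
              rw [← ENNReal.ofReal_mul (by positivity), ← ENNReal.ofReal_mul (by positivity),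
                ← ENNReal.ofReal_mul (by positivity)]
              congr 1
              rw [show (-(3 / 2) : ℝ) = -1 + -(1 / 2) by norm_num, Real.rpow_add hτ0,
                Real.rpow_neg_one]
              ring
    _ ≤ ∫⁻ τ in Set.Ioi t, ENNReal.ofReal (a ^ 2 * ε) * ENNReal.ofReal (τ ^ (-(3 / 2) : ℝ)) :=
        lintegral_mono_set Set.Ioc_subset_Ioi_self
    _ = _ := by
        rw [lintegral_const_mul _ (by fun_prop), lintegral_Ioi_rpow (by norm_num) ht,
          ← ENNReal.ofReal_mul (by positivity)]
        congr 1
        norm_num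
        ring

/-- The resonant forcing has an improper Duhamel integral, which decays. -/
theorem exists_resonant_correction {σ : ℝ} (hσ : |σ| = 1) (a : ℝ) {ε t₀ : ℝ} (hε : 0 ≤ ε)
    (ht₀ : 0 < t₀) {u : L2} (hu : eLpNorm u 1 volume ≤ ENNReal.ofReal ε) :
    ∃ J : ℝ → L2, Continuous J ∧
      (∀ t, t₀ ≤ t → ‖J t‖ₑ ≤ ENNReal.ofReal (12 * a ^ 2 * ε * t ^ (-(1 / 4) : ℝ))) ∧
      (∀ t, t₀ ≤ t → supNorm (J t) ≤ ENNReal.ofReal (2 * a ^ 2 * ε * t ^ (-(1 / 2) : ℝ))) ∧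
      IsMildSolution t₀ J (conjForcing σ a u) := by
  set A : ℝ → L2 := fun τ => freeGroup (-τ) (conjForcing σ a u (max t₀ τ)) with hA
  have hAc : Continuous A := Continuous.freeGroup continuous_neg
    ((continuousOn_conjForcing σ a u).comp_continuous (by fun_prop)
      fun t => ht₀.trans_le (le_max_left _ _))
  have hAi : ∀ s t, IntervalIntegrable A volume s t := fun s t => hAc.intervalIntegrable s t
  have hAeq : ∀ {s t : ℝ}, t₀ ≤ s → ∫ τ in Set.Ioc s t, A τ
      = ∫ τ in Set.Ioc s t, freeGroup (-τ) (conjForcing σ a u τ) := fun {s t} hs =>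
    setIntegral_congr_fun measurableSet_Ioc fun τ hτ => by
      simp only [hA]
      rw [max_eq_right (hs.trans hτ.1.le)]
  -- Freezing before t₀ makes G continuous on the whole line; the Cauchy estimate concerns only T →
  -- ∞.
  set G : ℝ → L2 := fun T => ∫ τ in t₀..max t₀ T, A τ with hG
  have hGc : Continuous G :=
    (intervalIntegral.continuous_primitive hAi t₀).comp (by fun_prop)
  have hGsub : ∀ {s t}, t₀ ≤ s → s ≤ t → G t - G s
      = ∫ τ in Set.Ioc s t, freeGroup (-τ) (conjForcing σ a u τ) := by
    intro s t hs hst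
    simp only [hG]
    rw [max_eq_right hs, max_eq_right (hs.trans hst),
      intervalIntegral.integral_interval_sub_left (hAi _ _) (hAi _ _),
      intervalIntegral.integral_of_le hst, hAeq hs]
  have hGle : ∀ {s t}, t₀ ≤ s → s ≤ t → ‖G t - G s‖ₑ
      ≤ ENNReal.ofReal (12 * a ^ 2 * ε * s ^ (-(1 / 4) : ℝ)) := fun hs hst => by
    rw [hGsub hs hst]
    exact enorm_integral_conjForcing_le hσ a hε hu (ht₀.trans_le hs)
  have hGmax : ∀ t, G t = G (max t₀ t) := fun t => by simp only [hG]; rw [max_eq_right (le_max_left t₀ t)]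
  obtain ⟨g, hg⟩ : ∃ g, Tendsto G atTop (𝓝 g) := by
    refine cauchySeq_tendsto_of_complete ?_
    refine cauchySeq_of_le_tendsto_0 (fun N => 2 * (12 * a ^ 2 * ε * (max t₀ N) ^ (-(1 / 4) : ℝ)))
      (fun n m N hn hm => ?_) ?_
    · have h1 : ∀ n, N ≤ n → dist (G n) (G N) ≤ 12 * a ^ 2 * ε * (max t₀ N) ^ (-(1 / 4) : ℝ) := by
        intro n hn
        have hpos : 0 < max t₀ N := ht₀.trans_le (le_max_left _ _)
        have h2 := hGle (le_max_left t₀ N) (max_le_max_left t₀ hn)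
        rw [← hGmax, ← hGmax, ← ofReal_norm] at h2
        rw [dist_eq_norm]
        exact (ENNReal.ofReal_le_ofReal_iff (by positivity)).1 h2
      refine (dist_triangle_right _ _ (G N)).trans ?_
      linarith [h1 n hn, h1 m hm]
    · have h1 : Tendsto (fun N : ℝ => max t₀ N) atTop atTop :=
        tendsto_atTop_mono (fun N => le_max_right t₀ N) tendsto_id
      have h2 := (((tendsto_rpow_neg_atTop (show (0 : ℝ) < 1 / 4 by norm_num)).comp
        h1).const_mul (12 * a ^ 2 * ε)).const_mul 2
      rw [mul_zero, mul_zero] at h2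
      exact h2
  -- G(t) - g is minus the improper integral over (t,∞), so the correction has zero data at
  -- infinity.
  refine ⟨fun t => freeGroup t (G t - g), Continuous.freeGroup continuous_id
    (hGc.sub continuous_const), fun t ht => ?_, fun t ht => ?_, fun T hT => ?_⟩
  · rw [LinearIsometry.enorm_map]
    have h1 : Tendsto (fun S => ‖G S - G t‖ₑ) atTop (𝓝 ‖g - G t‖ₑ) :=
      (continuous_enorm.tendsto _).comp (hg.sub_const (G t))
    rw [← enorm_neg, neg_sub]
    exact le_of_tendsto h1 ((eventually_ge_atTop t).mono fun S hS => hGle ht hS)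
  · have h1 : Tendsto (fun S => -freeGroup t (G S - G t)) atTop (𝓝 (freeGroup t (G t - g))) := by
      have h2 := (((freeGroup t).continuous.tendsto _).comp (hg.sub_const (G t))).neg
      rwa [← map_neg, neg_sub] at h2
    refine eLpNorm_top_le_of_tendsto h1 ((eventually_ge_atTop t).mono fun S hS => ?_)
    rw [hGsub ht hS, eLpNorm_congr_ae (Lp.coeFn_neg _), eLpNorm_neg]
    exact supNorm_integral_conjForcing_le hσ a hε hu (ht₀.trans_le ht)
  · have h0 : G t₀ = 0 := by simp [hG]
    rw [freeGroup_neg_apply_self, freeGroup_neg_apply_self, h0, intervalIntegral.integral_of_le hT,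
      ← hGsub le_rfl hT, h0]
    abel

/-! ### The solution space and the fixed point theorem -/

/-- Paths of size `B` in the solution space. -/
structure IsAdmissible (t₀ B : ℝ) (w : ℝ → L2) : Prop where
  continuous : Continuous w
  enorm_le : ∀ t, t₀ ≤ t → ‖w t‖ₑ ≤ ENNReal.ofReal (B * t ^ (-(1 / 4) : ℝ))
  lintegral_le : ∀ t, t₀ ≤ t → ∫⁻ s in Set.Ioi t, supNorm (w s) ^ (4 : ℝ)
    ≤ ENNReal.ofReal (B * t ^ (-(1 / 4) : ℝ)) ^ (4 : ℝ)

/-- Lower semicontinuity of the L^∞ norm under L² convergence, combined with Fatou in time. It makes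
the L⁴L^∞ constraint closed in the weaker metric. -/
theorem lintegral_supNorm_le_of_tendsto {w : ℕ → ℝ → L2} {y : ℝ → L2} (hw : ∀ n, Continuous (w n))
    (h : ∀ s, Tendsto (fun n => w n s) atTop (𝓝 (y s))) {S : Set ℝ} {M : ℝ≥0∞}
    (hM : ∀ n, ∫⁻ s in S, supNorm (w n s) ^ (4 : ℝ) ≤ M) :
    ∫⁻ s in S, supNorm (y s) ^ (4 : ℝ) ≤ M := by
  have h1 : ∀ s, supNorm (y s) ^ (4 : ℝ) ≤ liminf (fun n => supNorm (w n s) ^ (4 : ℝ)) atTop := by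
    intro s
    have h2 := (ENNReal.orderIsoRpow 4 (by norm_num)).liminf_apply (f := atTop)
      (u := fun n => supNorm (w n s))
    simp only [ENNReal.orderIsoRpow_apply] at h2
    rw [← h2]
    exact ENNReal.rpow_le_rpow (eLpNorm_top_le_liminf (h s)) (by norm_num)
  refine (lintegral_mono h1).trans ((lintegral_liminf_le' fun n =>
    (aemeasurable_eLpNorm_top (hw n).aestronglyMeasurable).pow_const _).trans ?_)
  exact liminf_le_of_frequently_le' (Frequently.of_forall hM)

/-- Banach's fixed point theorem in the solution space. -/
theorem exists_fixedPoint_of_isAdmissible {t₀ B : ℝ} (ht₀ : 0 < t₀) (hB : 0 ≤ B)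
    {Γ : (ℝ → L2) → ℝ → L2} (hmap : ∀ w, IsAdmissible t₀ B w → IsAdmissible t₀ B (Γ w))
    (hcontr : ∀ w y, IsAdmissible t₀ B w → IsAdmissible t₀ B y → ∀ δ : ℝ, 0 ≤ δ →
      (∀ t, t₀ < t → ‖w t - y t‖ₑ ≤ ENNReal.ofReal (δ * t ^ (-(1 / 4) : ℝ))) →
      ∀ t, t₀ ≤ t → ‖Γ w t - Γ y t‖ₑ ≤ ENNReal.ofReal (2⁻¹ * δ * t ^ (-(1 / 4) : ℝ))) :
    ∃ w, IsAdmissible t₀ B w ∧ ∀ t, t₀ ≤ t → Γ w t = w t := by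
  set θ : ℝ → ℝ := fun t => max t₀ t with hθ
  have hθ0 : ∀ t, 0 < θ t := fun t => ht₀.trans_le (le_max_left _ _)
  have hθt : ∀ t, t₀ ≤ θ t := fun t => le_max_left _ _
  have hθeq : ∀ t, t₀ ≤ t → θ t = t := fun t ht => max_eq_right ht
  have hθc : Continuous θ := by fun_prop
  have hω : ∀ p : ℝ, Continuous fun t => θ t ^ p := fun p =>
    hθc.rpow_const fun t => Or.inl (hθ0 t).ne'
  have hcancel : ∀ t, θ t ^ (-(1 / 4) : ℝ) * θ t ^ (1 / 4 : ℝ) = 1 := fun t => by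
    rw [← Real.rpow_add (hθ0 t)]
    norm_num
  -- Multiplication by t^{-1/4} turns bounded continuous paths into paths with the required decay,
  -- so the weighted space inherits completeness. Times before t₀ are frozen at t₀.
  set path : (BoundedContinuousFunction ℝ L2) → ℝ → L2 := fun b t => θ t ^ (-(1 / 4) : ℝ) • b t with hpath
  have hpathc : ∀ b, Continuous (path b) := fun b => (hω _).smul b.continuous
  have hpathle : ∀ (b : BoundedContinuousFunction ℝ L2) t, t₀ ≤ t →
      ‖path b t‖ₑ ≤ ENNReal.ofReal (‖b‖ * t ^ (-(1 / 4) : ℝ)) := by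
    intro b t ht
    have ht0 := ht₀.trans_le ht
    rw [← ofReal_norm]
    apply ENNReal.ofReal_le_ofReal
    simp only [hpath]
    rw [norm_smul, Real.norm_of_nonneg (Real.rpow_nonneg (hθ0 t).le _), hθeq t ht, mul_comm]
    gcongr
    exact b.norm_coe_le_norm t
  -- Only the weighted L² norm serves as metric; the L⁴L^∞ bound cuts out a closed subset.
  set K : Set (BoundedContinuousFunction ℝ L2) := {b | ‖b‖ ≤ B ∧ ∀ t, t₀ ≤ t →
    ∫⁻ s in Set.Ioi t, supNorm (path b s) ^ (4 : ℝ)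
      ≤ ENNReal.ofReal (B * t ^ (-(1 / 4) : ℝ)) ^ (4 : ℝ)} with hK
  have hKadm : ∀ b ∈ K, IsAdmissible t₀ B (path b) := fun b hb =>
    ⟨hpathc b, fun t ht => (hpathle b t ht).trans (ENNReal.ofReal_le_ofReal (by
      have := ht₀.trans_le ht
      gcongr
      exact hb.1)), hb.2⟩
  have hKclosed : IsClosed K := by
    refine IsSeqClosed.isClosed fun b b' hb hlim => ⟨?_, fun t ht => ?_⟩
    · exact le_of_tendsto hlim.norm (Eventually.of_forall fun n => (hb n).1)
    · refine lintegral_supNorm_le_of_tendsto (fun n => hpathc (b n)) (fun s => ?_)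
        fun n => (hb n).2 t ht
      have h1 : Tendsto (fun n => b n s) atTop (𝓝 (b' s)) :=
        ((BoundedContinuousFunction.lipschitz_eval_const s).continuous.tendsto b').comp hlim
      exact h1.const_smul _
  have hbd : ∀ w, IsAdmissible t₀ B w → ∀ t, ‖θ t ^ (1 / 4 : ℝ) • w (θ t)‖ ≤ B := by
    intro w hw t
    have h1 := hw.enorm_le (θ t) (hθt t)
    have h2 := hθ0 t
    rw [← ofReal_norm, ENNReal.ofReal_le_ofReal_iff (by positivity)] at h1
    rw [norm_smul, Real.norm_of_nonneg (by positivity)]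
    calc θ t ^ (1 / 4 : ℝ) * ‖w (θ t)‖ ≤ θ t ^ (1 / 4 : ℝ) * (B * θ t ^ (-(1 / 4) : ℝ)) := by gcongr
      _ = B * (θ t ^ (-(1 / 4) : ℝ) * θ t ^ (1 / 4 : ℝ)) := by ring
      _ = B := by rw [hcancel, mul_one]
  set lift : ∀ w, IsAdmissible t₀ B w → BoundedContinuousFunction ℝ L2 := fun w hw =>
    BoundedContinuousFunction.ofNormedAddCommGroup (fun t => θ t ^ (1 / 4 : ℝ) • w (θ t))
      ((hω _).smul (hw.continuous.comp hθc)) B (hbd w hw) with hlift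
  have hpathlift : ∀ w hw t, path (lift w hw) t = w (θ t) := by
    intro w hw t
    simp only [hpath, hlift, BoundedContinuousFunction.coe_ofNormedAddCommGroup]
    rw [smul_smul, hcancel, one_smul]
  have hliftK : ∀ w hw, lift w hw ∈ K := by
    intro w hw
    refine ⟨BoundedContinuousFunction.norm_ofNormedAddCommGroup_le _ hB (hbd w hw), fun t ht => ?_⟩
    refine le_of_eq_of_le (setLIntegral_congr_fun measurableSet_Ioi fun s hs => ?_)
      (hw.lintegral_le t ht)
    rw [hpathlift w hw, hθeq s (ht.trans (le_of_lt hs))]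
  have : CompleteSpace K := hKclosed.completeSpace_coe
  have : Nonempty K := by
    refine ⟨⟨0, by rw [norm_zero]; exact hB, fun t _ => ?_⟩⟩
    have h1 : ∀ s, path 0 s = 0 := fun s => by simp [hpath]
    simp_rw [h1, supNorm_zero]
    simp
  set Φ : K → K := fun b => ⟨lift (Γ (path b)) (hmap _ (hKadm b b.2)),
    hliftK (Γ (path b)) (hmap _ (hKadm b b.2))⟩ with hΦ
  have hΦc : ContractingWith 2⁻¹ Φ := by
    refine ⟨by norm_num, LipschitzWith.of_dist_le_mul fun b b' => ?_⟩
    rw [Subtype.dist_eq, Subtype.dist_eq, dist_eq_norm, dist_eq_norm]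
    refine (BoundedContinuousFunction.norm_le (by positivity)).2 fun t => ?_
    have h1 := hcontr _ _ (hKadm b b.2) (hKadm b' b'.2) ‖(b : BoundedContinuousFunction ℝ L2) - b'‖ (norm_nonneg _)
      (fun t ht => by
        have := hpathle ((b : BoundedContinuousFunction ℝ L2) - b') t ht.le
        simp only [hpath, BoundedContinuousFunction.coe_sub, Pi.sub_apply, smul_sub] at this
        exact this) (θ t) (hθt t)
    have h2 := hθ0 t
    rw [← ofReal_norm, ENNReal.ofReal_le_ofReal_iff (by positivity)] at h1
    have h3 : (((Φ b : K) : BoundedContinuousFunction ℝ L2) - ((Φ b' : K) : BoundedContinuousFunction ℝ L2)) t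
        = θ t ^ (1 / 4 : ℝ) • (Γ (path b) (θ t) - Γ (path b') (θ t)) := by
      rw [smul_sub]
      rfl
    rw [h3, norm_smul, Real.norm_of_nonneg (by positivity)]
    calc _ ≤ θ t ^ (1 / 4 : ℝ) * (2⁻¹ * ‖(b : BoundedContinuousFunction ℝ L2) - b'‖ * θ t ^ (-(1 / 4) : ℝ)) := by gcongr
      _ = 2⁻¹ * ‖(b : BoundedContinuousFunction ℝ L2) - b'‖ * (θ t ^ (-(1 / 4) : ℝ) * θ t ^ (1 / 4 : ℝ)) := by ring
      _ = _ := by rw [hcancel, mul_one]; rfl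
  set b := ContractingWith.fixedPoint Φ hΦc with hb
  have hbfix : Φ b = b := hΦc.fixedPoint_isFixedPt
  refine ⟨path b, hKadm b b.2, fun t ht => ?_⟩
  have h1 := hpathlift (Γ (path b)) (hmap _ (hKadm b b.2)) t
  rw [hθeq t ht] at h1
  rw [← h1]
  exact congrArg (fun c : K => path c t) hbfix

/-! ### Existence of the perturbation -/

/-- Minus the part of the forcing that is quadratic or involves `w`, after time `t₀`. -/
noncomputable def negRemainder (σ a t₀ : ℝ) (u : L2) (w : ℝ → L2) : ℝ → L2 :=
  (Set.Ioi t₀).indicator fun τ =>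
    (Complex.I * ((σ / τ : ℝ) : ℂ)) • (a : ℂ) ^ 2 • freePart σ a u τ + conjForcing σ a u τ
      - forcing σ a (perturbedPath σ a t₀ u w) τ

theorem isAdmissible_zero {t₀ B : ℝ} : IsAdmissible t₀ B fun _ => 0 where
  continuous := continuous_const
  enorm_le t _ := by simp
  lintegral_le t _ := by simp_rw [supNorm_zero]; simp

theorem IsAdmissible.lintegral_ne_top {t₀ B : ℝ} {w : ℝ → L2} (hw : IsAdmissible t₀ B w) :
    ∫⁻ s in Set.Ioi t₀, supNorm (w s) ^ (4 : ℝ) ≠ ∞ :=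
  ne_top_of_le_ne_top (ENNReal.rpow_ne_top_of_nonneg (by norm_num) ENNReal.ofReal_ne_top)
    (hw.lintegral_le t₀ le_rfl)

theorem IsAdmissible.lintegral_rpow_half_le {t₀ B : ℝ} (ht₀ : 0 < t₀) (hB : 0 ≤ B) {w : ℝ → L2}
    (hw : IsAdmissible t₀ B w) {t : ℝ} (ht : t₀ ≤ t) :
    (∫⁻ s in Set.Ioi t, supNorm (w s) ^ (4 : ℝ)) ^ (1 / 2 : ℝ)
      ≤ ENNReal.ofReal (B ^ 2 * t ^ (-(1 / 2) : ℝ)) := by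
  have ht0 := ht₀.trans_le ht
  refine (ENNReal.rpow_le_rpow (hw.lintegral_le t ht) (by norm_num)).trans (le_of_eq ?_)
  rw [← ENNReal.rpow_mul, ENNReal.ofReal_rpow_of_nonneg (by positivity) (by norm_num),
    Real.mul_rpow hB (by positivity), ← Real.rpow_mul ht0.le]
  norm_num

theorem aestronglyMeasurable_negRemainder {σ a t₀ ε : ℝ} (ht₀ : 0 < t₀) (hε : 0 ≤ ε) {u : L2}
    (hu : eLpNorm u 1 volume ≤ ENNReal.ofReal ε) {w : ℝ → L2} (hw : Continuous w)
    (hw4 : ∫⁻ τ in Set.Ioi t₀, supNorm (w τ) ^ (4 : ℝ) ≠ ∞) :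
    AEStronglyMeasurable (negRemainder σ a t₀ u w) := by
  refine (aestronglyMeasurable_indicator_iff measurableSet_Ioi).2 ?_
  have hsub : Set.Ioi t₀ ⊆ Set.Ioi 0 := Set.Ioi_subset_Ioi ht₀.le
  refine AEStronglyMeasurable.sub (AEStronglyMeasurable.add ?_ ?_) ?_
  · refine (Measurable.aestronglyMeasurable (f := fun τ : ℝ => Complex.I * ((σ / τ : ℝ) : ℂ))
      (by fun_prop)).smul ?_
    exact (((continuousOn_freePart σ a u).const_smul ((a : ℂ) ^ 2)).mono hsub).aestronglyMeasurable
      measurableSet_Ioi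
  · exact ((continuousOn_conjForcing σ a u).mono hsub).aestronglyMeasurable measurableSet_Ioi
  · exact aestronglyMeasurable_forcing σ a
      (continuous_perturbedPath ht₀ hw).aestronglyMeasurable
      (ae_supNorm_perturbedPath_ne_top ht₀ hε hu hw hw4)

theorem enorm_negRemainder_sub_le {σ : ℝ} (hσ : |σ| = 1) (a : ℝ) {t₀ : ℝ} (ht₀ : 0 < t₀) (u : L2)
    (w y : ℝ → L2) {τ : ℝ} (hτ : t₀ < τ) :
    ‖negRemainder σ a t₀ u w τ - negRemainder σ a t₀ u y τ‖ₑ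
      ≤ lipFactor a (perturbedPath σ a t₀ u w) (perturbedPath σ a t₀ u y) τ * ‖w τ - y τ‖ₑ := by
  have h1 := enorm_forcing_sub_le hσ a (perturbedPath σ a t₀ u w) (perturbedPath σ a t₀ u y)
    (ht₀.trans hτ)
  rw [perturbedPath, perturbedPath, add_sub_add_left_eq_sub] at h1
  rw [negRemainder, negRemainder, Set.indicator_of_mem (show τ ∈ Set.Ioi t₀ from hτ),
    Set.indicator_of_mem (show τ ∈ Set.Ioi t₀ from hτ), sub_sub_sub_cancel_left, ← enorm_neg,
    neg_sub]
  exact h1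

/-- The contraction factor of the integral equation. -/
noncomputable def contractionFactor (a ε t₀ B : ℝ) : ℝ :=
  28 * a ^ 2 + 48 * ε ^ 2 / t₀ + 12 * B ^ 2 / t₀

/-- The terms depending only on the profile cancel, leaving the weighted Lipschitz integral.
Admissibility bounds the two L⁴ terms by 6t^{-1/2} · 2B²t^{-1/2} ≤ 12B²/t₀. -/
theorem lintegral_negRemainder_sub_le {σ : ℝ} (hσ : |σ| = 1) (a : ℝ) {ε t₀ B : ℝ} (hε : 0 ≤ ε)
    (ht₀ : 0 < t₀) (hB : 0 ≤ B) {u : L2} (hu : eLpNorm u 1 volume ≤ ENNReal.ofReal ε)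
    {w y : ℝ → L2} (hw : IsAdmissible t₀ B w) (hy : IsAdmissible t₀ B y) {δ : ℝ} (hδ : 0 ≤ δ)
    (hwy : ∀ τ, t₀ < τ → ‖w τ - y τ‖ₑ ≤ ENNReal.ofReal (δ * τ ^ (-(1 / 4) : ℝ))) {t : ℝ}
    (ht : t₀ ≤ t) :
    ∫⁻ τ in Set.Ioi t, ‖negRemainder σ a t₀ u w τ - negRemainder σ a t₀ u y τ‖ₑ
      ≤ ENNReal.ofReal (contractionFactor a ε t₀ B * δ * t ^ (-(1 / 4) : ℝ)) := by
  have ht0 := ht₀.trans_le ht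
  set k := lipFactor a (perturbedPath σ a t₀ u w) (perturbedPath σ a t₀ u y) with hk
  calc _ ≤ ∫⁻ τ in Set.Ioi t, k τ * ENNReal.ofReal (τ ^ (-(1 / 4) : ℝ)) * ENNReal.ofReal δ := by
        refine setLIntegral_mono' measurableSet_Ioi fun τ hτ => ?_
        have hτt : t₀ < τ := ht.trans_lt hτ
        refine (enorm_negRemainder_sub_le hσ a ht₀ u w y hτt).trans ?_
        rw [mul_assoc, ← ENNReal.ofReal_mul (Real.rpow_nonneg (ht₀.trans hτt).le _), mul_comm _ δ]
        gcongr
        exact hwy τ hτt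
    _ ≤ ENNReal.ofReal (t ^ (-(1 / 4) : ℝ)) * (ENNReal.ofReal (28 * a ^ 2 + 48 * ε ^ 2 / t₀)
        + 6 * ENNReal.ofReal (t ^ (-(1 / 2) : ℝ))
          * (ENNReal.ofReal (B ^ 2 * t ^ (-(1 / 2) : ℝ))
            + ENNReal.ofReal (B ^ 2 * t ^ (-(1 / 2) : ℝ)))) * ENNReal.ofReal δ := by
        rw [lintegral_mul_const' _ _ ENNReal.ofReal_ne_top]
        gcongr
        refine (lintegral_lipFactor_perturbedPath_le σ a hε ht₀ ht hu hw.continuous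
          hy.continuous).trans ?_
        gcongr
        · exact hw.lintegral_rpow_half_le ht₀ hB ht
        · exact hy.lintegral_rpow_half_le ht₀ hB ht
    _ = ENNReal.ofReal (t ^ (-(1 / 4) : ℝ) * (28 * a ^ 2 + 48 * ε ^ 2 / t₀
        + 6 * t ^ (-(1 / 2) : ℝ) * (B ^ 2 * t ^ (-(1 / 2) : ℝ) + B ^ 2 * t ^ (-(1 / 2) : ℝ)))
          * δ) := by
        rw [ENNReal.ofReal_mul (q := δ) (by positivity),
          ENNReal.ofReal_mul (p := t ^ (-(1 / 4) : ℝ)) (by positivity),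
          ENNReal.ofReal_add (p := 28 * a ^ 2 + 48 * ε ^ 2 / t₀) (by positivity) (by positivity),
          ENNReal.ofReal_mul (p := 6 * t ^ (-(1 / 2) : ℝ)) (by positivity),
          ENNReal.ofReal_mul (p := 6) (by norm_num),
          ENNReal.ofReal_add (p := B ^ 2 * t ^ (-(1 / 2) : ℝ)) (by positivity) (by positivity)]
        norm_num
    _ ≤ _ := by
        apply ENNReal.ofReal_le_ofReal
        have h1 : t ^ (-(1 / 2) : ℝ) * t ^ (-(1 / 2) : ℝ) ≤ t₀⁻¹ := by
          rw [← Real.rpow_add ht0]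
          norm_num
          rw [Real.rpow_neg_one]
          exact inv_anti₀ ht₀ ht
        have h2 : 6 * t ^ (-(1 / 2) : ℝ) * (B ^ 2 * t ^ (-(1 / 2) : ℝ) + B ^ 2 * t ^ (-(1 / 2) : ℝ))
            ≤ 12 * B ^ 2 / t₀ := by
          calc _ = 12 * B ^ 2 * (t ^ (-(1 / 2) : ℝ) * t ^ (-(1 / 2) : ℝ)) := by ring
            _ ≤ 12 * B ^ 2 * t₀⁻¹ := by gcongr
            _ = _ := by rw [div_eq_mul_inv]
        calc _ ≤ t ^ (-(1 / 4) : ℝ) * (28 * a ^ 2 + 48 * ε ^ 2 / t₀ + 12 * B ^ 2 / t₀) * δ := by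
              gcongr
          _ = _ := by rw [contractionFactor]; ring

/-- The size of the quadratic part of the forcing produced by the profile. -/
noncomputable def sourceSize (a ε t₀ : ℝ) : ℝ :=
  4 * (3 * a * t₀ ^ (-(1 / 4) : ℝ) + ε * t₀ ^ (-(3 / 4) : ℝ)) * ε ^ 2

/-- For w = 0 both linear terms are removed and the forcing is τ⁻¹(3a‖z‖_∞ + ‖z‖_∞²)‖z‖_{L²}, with
‖z‖_∞ ≤ ετ^{-1/2}. The powers beyond τ^{-5/4} are traded for powers of t₀. -/
theorem lintegral_negRemainder_zero_le {σ : ℝ} (hσ : |σ| = 1) {a : ℝ} (ha : 0 ≤ a) {ε t₀ : ℝ}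
    (hε : 0 ≤ ε) (ht₀ : 0 < t₀) {u : L2} (hu : eLpNorm u 1 volume ≤ ENNReal.ofReal ε)
    (hu2 : ‖u‖ₑ ≤ ENNReal.ofReal ε) {t : ℝ} (ht : t₀ ≤ t) :
    ∫⁻ τ in Set.Ioi t, ‖negRemainder σ a t₀ u (fun _ => 0) τ‖ₑ
      ≤ ENNReal.ofReal (sourceSize a ε t₀ * t ^ (-(1 / 4) : ℝ)) := by
  have ht0 := ht₀.trans_le ht
  set C : ℝ := (3 * a * t₀ ^ (-(1 / 4) : ℝ) + ε * t₀ ^ (-(3 / 4) : ℝ)) * ε ^ 2 with hC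
  calc _ ≤ ∫⁻ τ in Set.Ioi t, ENNReal.ofReal C * ENNReal.ofReal (τ ^ (-(5 / 4) : ℝ)) := by
        refine setLIntegral_mono' measurableSet_Ioi fun τ hτ => ?_
        have hτt : t₀ < τ := ht.trans_lt hτ
        have hτ0 : 0 < τ := ht₀.trans hτt
        set z := freePart σ a u τ with hz
        have hzn : ‖z‖ₑ ≤ ENNReal.ofReal ε := by
          rwa [← ofReal_norm, hz, norm_freePart, ofReal_norm]
        have hzs : supNorm z ≤ ENNReal.ofReal (ε * τ ^ (-(1 / 2) : ℝ)) :=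
          supNorm_freePart_le_rpow σ a hε hu hτ0
        have h1 : negRemainder σ a t₀ u (fun _ => 0) τ = -((Complex.I * ((σ / τ : ℝ) : ℂ))
            • (nonlinearity a z - (a : ℂ) ^ 2 • z - (a : ℂ) ^ 2 • conjL2 z)) := by
          rw [negRemainder, Set.indicator_of_mem (show τ ∈ Set.Ioi t₀ from hτt), conjForcing,
            forcing, perturbedPath_of_le hτt.le, add_zero, ← hz, smul_sub, smul_sub]
          abel
        rw [h1, enorm_neg, enorm_smul, enorm_I_mul_div hσ hτ0]
        calc _ ≤ ENNReal.ofReal τ⁻¹ * ((ENNReal.ofReal (3 * a)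
                * ENNReal.ofReal (ε * τ ^ (-(1 / 2) : ℝ))
                + ENNReal.ofReal (ε * τ ^ (-(1 / 2) : ℝ)) ^ 2) * ENNReal.ofReal ε) := by
              gcongr
              exact (enorm_nonlinearity_sub_linear_le ha z).trans (by gcongr)
          _ = ENNReal.ofReal (τ⁻¹ * ((3 * a * (ε * τ ^ (-(1 / 2) : ℝ))
                + (ε * τ ^ (-(1 / 2) : ℝ)) ^ 2) * ε)) := by
              rw [ENNReal.ofReal_mul (p := τ⁻¹) (by positivity),
                ENNReal.ofReal_mul (q := ε) (by positivity),
                ENNReal.ofReal_add (by positivity) (by positivity),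
                ENNReal.ofReal_mul (p := 3 * a) (by positivity),
                ENNReal.ofReal_pow (by positivity)]
          _ ≤ _ := by
              rw [← ENNReal.ofReal_mul (by positivity)]
              apply ENNReal.ofReal_le_ofReal
              have e1 : τ⁻¹ * τ ^ (-(1 / 2) : ℝ) ≤ t₀ ^ (-(1 / 4) : ℝ) * τ ^ (-(5 / 4) : ℝ) := by
                have : τ⁻¹ * τ ^ (-(1 / 2) : ℝ) = τ ^ (-(1 / 4) : ℝ) * τ ^ (-(5 / 4) : ℝ) := by
                  rw [← Real.rpow_neg_one, ← Real.rpow_add hτ0, ← Real.rpow_add hτ0]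
                  norm_num
                rw [this]
                gcongr ?_ * _
                exact Real.rpow_le_rpow_of_nonpos ht₀ hτt.le (by norm_num)
              have e2 : τ⁻¹ * (τ ^ (-(1 / 2) : ℝ)) ^ 2 ≤ t₀ ^ (-(3 / 4) : ℝ) * τ ^ (-(5 / 4) : ℝ) := by
                have : τ⁻¹ * (τ ^ (-(1 / 2) : ℝ)) ^ 2 = τ ^ (-(3 / 4) : ℝ) * τ ^ (-(5 / 4) : ℝ) := by
                  rw [← Real.rpow_natCast (τ ^ (-(1 / 2) : ℝ)), ← Real.rpow_mul hτ0.le,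
                    ← Real.rpow_neg_one, ← Real.rpow_add hτ0, ← Real.rpow_add hτ0]
                  norm_num
                rw [this]
                gcongr ?_ * _
                exact Real.rpow_le_rpow_of_nonpos ht₀ hτt.le (by norm_num)
              calc _ = 3 * a * ε ^ 2 * (τ⁻¹ * τ ^ (-(1 / 2) : ℝ))
                    + ε ^ 3 * (τ⁻¹ * (τ ^ (-(1 / 2) : ℝ)) ^ 2) := by ring
                _ ≤ 3 * a * ε ^ 2 * (t₀ ^ (-(1 / 4) : ℝ) * τ ^ (-(5 / 4) : ℝ))
                    + ε ^ 3 * (t₀ ^ (-(3 / 4) : ℝ) * τ ^ (-(5 / 4) : ℝ)) := by gcongr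
                _ = _ := by rw [hC]; ring
    _ = _ := by
        rw [lintegral_const_mul _ (by fun_prop), lintegral_Ioi_rpow_five_quarters ht0,
          ← ENNReal.ofReal_mul (by positivity)]
        congr 1
        rw [hC, sourceSize]
        ring

/-- Comparison with w = 0 through the difference estimate with δ = B. -/
theorem lintegral_negRemainder_le {σ : ℝ} (hσ : |σ| = 1) {a : ℝ} (ha : 0 ≤ a) {ε t₀ B : ℝ}
    (hε : 0 ≤ ε) (ht₀ : 0 < t₀) (hB : 0 ≤ B) {u : L2} (hu : eLpNorm u 1 volume ≤ ENNReal.ofReal ε)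
    (hu2 : ‖u‖ₑ ≤ ENNReal.ofReal ε) {w : ℝ → L2} (hw : IsAdmissible t₀ B w) {t : ℝ} (ht : t₀ ≤ t) :
    ∫⁻ τ in Set.Ioi t, ‖negRemainder σ a t₀ u w τ‖ₑ ≤ ENNReal.ofReal
      ((sourceSize a ε t₀ + contractionFactor a ε t₀ B * B) * t ^ (-(1 / 4) : ℝ)) := by
  have ht0 := ht₀.trans_le ht
  have h0 : IsAdmissible t₀ B (fun _ : ℝ => (0 : L2)) := isAdmissible_zero
  have h1 := lintegral_negRemainder_zero_le hσ ha hε ht₀ hu hu2 ht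
  have h2 := lintegral_negRemainder_sub_le hσ a hε ht₀ hB hu hw h0 hB
    (fun τ hτ => by rw [sub_zero]; exact hw.enorm_le τ hτ.le) ht
  have hm := (aestronglyMeasurable_negRemainder (σ := σ) (a := a) ht₀ hε hu h0.continuous
    h0.lintegral_ne_top).enorm.restrict (s := Set.Ioi t)
  calc _ ≤ ∫⁻ τ in Set.Ioi t, (‖negRemainder σ a t₀ u (fun _ => 0) τ‖ₑ
        + ‖negRemainder σ a t₀ u w τ - negRemainder σ a t₀ u (fun _ => 0) τ‖ₑ) := by
        refine lintegral_mono fun τ => ?_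
        refine le_of_eq_of_le ?_ (enorm_add_le _ _)
        rw [add_sub_cancel]
    _ ≤ _ := by
        rw [lintegral_add_left' hm]
        refine (add_le_add h1 h2).trans (le_of_eq ?_)
        have hs : 0 ≤ sourceSize a ε t₀ := by rw [sourceSize]; positivity
        have hc : 0 ≤ contractionFactor a ε t₀ B := by rw [contractionFactor]; positivity
        rw [← ENNReal.ofReal_add (by positivity) (by positivity)]
        congr 1
        ring

theorem integrable_negRemainder {σ : ℝ} (hσ : |σ| = 1) {a : ℝ} (ha : 0 ≤ a) {ε t₀ B : ℝ}
    (hε : 0 ≤ ε) (ht₀ : 0 < t₀) (hB : 0 ≤ B) {u : L2} (hu : eLpNorm u 1 volume ≤ ENNReal.ofReal ε)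
    (hu2 : ‖u‖ₑ ≤ ENNReal.ofReal ε) {w : ℝ → L2} (hw : IsAdmissible t₀ B w) :
    Integrable (negRemainder σ a t₀ u w) := by
  refine ⟨aestronglyMeasurable_negRemainder ht₀ hε hu hw.continuous hw.lintegral_ne_top, ?_⟩
  have h1 := lintegral_negRemainder_le hσ ha hε ht₀ hB hu hu2 hw le_rfl
  refine lt_of_eq_of_lt ?_ (h1.trans_lt ENNReal.ofReal_lt_top)
  rw [← lintegral_indicator measurableSet_Ioi]
  refine lintegral_congr fun τ => ?_
  by_cases hτ : τ ∈ Set.Ioi t₀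
  · rw [Set.indicator_of_mem hτ]
  · rw [Set.indicator_of_notMem hτ, negRemainder, Set.indicator_of_notMem hτ, enorm_zero]

theorem duhamel_sub {r q : ℝ → L2} (hr : Integrable r) (hq : Integrable q) (s : ℝ) :
    duhamel r s - duhamel q s = duhamel (fun τ => r τ - q τ) s := by
  rw [duhamel, duhamel, duhamel, ← map_sub,
    ← integral_sub (integrable_freeGroup_neg hr).integrableOn (integrable_freeGroup_neg hq).integrableOn]
  simp_rw [map_sub]

/-- With data at infinity, the Duhamel term at times s > t sees only the source after t, so the
source may be truncated before applying Strichartz. -/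
theorem lintegral_eLpNorm_top_duhamel_Ioi_le {r : ℝ → L2} (hr : Integrable r) (t : ℝ) :
    ∫⁻ s in Set.Ioi t, supNorm (duhamel r s) ^ (4 : ℝ)
      ≤ (4 * ∫⁻ τ in Set.Ioi t, ‖r τ‖ₑ) ^ (4 : ℝ) := by
  have h1 := lintegral_eLpNorm_top_duhamel_le (hr.indicator (measurableSet_Ioi (a := t)))
  have h2 : ∫⁻ τ, ‖(Set.Ioi t).indicator r τ‖ₑ = ∫⁻ τ in Set.Ioi t, ‖r τ‖ₑ := by
    rw [← lintegral_indicator measurableSet_Ioi]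
    refine lintegral_congr fun τ => ?_
    by_cases hτ : τ ∈ Set.Ioi t
    · rw [Set.indicator_of_mem hτ, Set.indicator_of_mem hτ]
    · rw [Set.indicator_of_notMem hτ, Set.indicator_of_notMem hτ, enorm_zero]
  rw [h2] at h1
  refine le_trans ?_ h1
  refine le_trans (setLIntegral_mono' measurableSet_Ioi fun s hs => ?_) (setLIntegral_le_lintegral _ _)
  have h3 : duhamel r s = duhamel ((Set.Ioi t).indicator r) s := by
    rw [duhamel, duhamel]
    congr 1
    refine setIntegral_congr_fun measurableSet_Ioi fun τ hτ => ?_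
    rw [Set.indicator_of_mem (Set.mem_Ioi.2 ((Set.mem_Ioi.1 hs).trans (Set.mem_Ioi.1 hτ)))]
  rw [h3]

/-- Minkowski in L⁴(t,∞): a pointwise bound c s^{-1/2} has L⁴ norm c t^{-1/4}, and the Strichartz
constant accounts for 4C. -/
theorem IsAdmissible.add_duhamel {t₀ B c C : ℝ} (ht₀ : 0 < t₀) (hc : 0 ≤ c) (hC : 0 ≤ C)
    (hB : c + 4 * C ≤ B)
    {J r : ℝ → L2} (hJc : Continuous J)
    (hJ : ∀ t, t₀ ≤ t → ‖J t‖ₑ ≤ ENNReal.ofReal (c * t ^ (-(1 / 4) : ℝ)))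
    (hJs : ∀ t, t₀ ≤ t → supNorm (J t) ≤ ENNReal.ofReal (c * t ^ (-(1 / 2) : ℝ)))
    (hr : Integrable r)
    (hrC : ∀ t, t₀ ≤ t → ∫⁻ τ in Set.Ioi t, ‖r τ‖ₑ ≤ ENNReal.ofReal (C * t ^ (-(1 / 4) : ℝ))) :
    IsAdmissible t₀ B fun t => J t + duhamel r t where
  continuous := hJc.add (continuous_duhamel hr)
  enorm_le t ht := by
    have ht0 := ht₀.trans_le ht
    calc _ ≤ ENNReal.ofReal (c * t ^ (-(1 / 4) : ℝ)) + ENNReal.ofReal (C * t ^ (-(1 / 4) : ℝ)) :=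
          (enorm_add_le _ _).trans (add_le_add (hJ t ht)
            ((enorm_duhamel_le r t).trans (hrC t ht)))
      _ = ENNReal.ofReal ((c + C) * t ^ (-(1 / 4) : ℝ)) := by
          rw [← ENNReal.ofReal_add (by positivity) (by positivity), add_mul]
      _ ≤ _ := by
          gcongr
          linarith
  lintegral_le t ht := by
    have ht0 := ht₀.trans_le ht
    have hJm := aemeasurable_eLpNorm_top (hJc.aestronglyMeasurable (μ := volume.restrict (Set.Ioi t)))
    have hDm := aemeasurable_eLpNorm_top
      ((continuous_duhamel hr).aestronglyMeasurable (μ := volume.restrict (Set.Ioi t)))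
    have h1 : (∫⁻ s in Set.Ioi t, supNorm (J s) ^ (4 : ℝ)) ^ (1 / 4 : ℝ)
        ≤ ENNReal.ofReal (c * t ^ (-(1 / 4) : ℝ)) := by
      calc _ ≤ (∫⁻ s in Set.Ioi t, ENNReal.ofReal (c ^ (4 : ℝ))
            * ENNReal.ofReal (s ^ (-2 : ℝ))) ^ (1 / 4 : ℝ) := by
            refine ENNReal.rpow_le_rpow (setLIntegral_mono' measurableSet_Ioi fun s hs => ?_)
              (by norm_num)
            have hs0 : 0 < s := ht0.trans hs
            refine (ENNReal.rpow_le_rpow (hJs s (ht.trans (le_of_lt hs))) (by norm_num)).trans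
              (le_of_eq ?_)
            rw [ENNReal.ofReal_rpow_of_nonneg (by positivity) (by norm_num),
              Real.mul_rpow hc (by positivity), ← Real.rpow_mul hs0.le,
              ENNReal.ofReal_mul (by positivity)]
            norm_num
        _ = _ := by
            rw [lintegral_const_mul _ (by fun_prop), lintegral_Ioi_rpow (by norm_num) ht0,
              ← ENNReal.ofReal_mul (by positivity),
              ENNReal.ofReal_rpow_of_nonneg (by positivity) (by norm_num),
              Real.mul_rpow (by positivity) (by positivity), ← Real.rpow_mul hc]
            norm_num
            rw [← Real.rpow_mul ht0.le]
            norm_num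
    have h2 : (∫⁻ s in Set.Ioi t, supNorm (duhamel r s) ^ (4 : ℝ)) ^ (1 / 4 : ℝ)
        ≤ ENNReal.ofReal (4 * C * t ^ (-(1 / 4) : ℝ)) := by
      calc _ ≤ ((4 * ENNReal.ofReal (C * t ^ (-(1 / 4) : ℝ))) ^ (4 : ℝ)) ^ (1 / 4 : ℝ) := by
            refine ENNReal.rpow_le_rpow ((lintegral_eLpNorm_top_duhamel_Ioi_le hr t).trans ?_)
              (by norm_num)
            gcongr
            exact hrC t ht
        _ = _ := by
            rw [← ENNReal.rpow_mul, mul_assoc 4 C, ENNReal.ofReal_mul (by norm_num : (0 : ℝ) ≤ 4)]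
            norm_num
    have h3 : (∫⁻ s in Set.Ioi t, supNorm (J s + duhamel r s) ^ (4 : ℝ)) ^ (1 / 4 : ℝ)
        ≤ ENNReal.ofReal (B * t ^ (-(1 / 4) : ℝ)) := by
      calc _ ≤ (∫⁻ s in Set.Ioi t, ((fun s => supNorm (J s)) + fun s => supNorm (duhamel r s)) s
            ^ (4 : ℝ)) ^ (1 / 4 : ℝ) := by
            refine ENNReal.rpow_le_rpow (lintegral_mono fun s => ?_) (by norm_num)
            exact ENNReal.rpow_le_rpow (eLpNorm_top_add_le _ _) (by norm_num)
        _ ≤ _ := (ENNReal.lintegral_Lp_add_le hJm hDm (by norm_num)).trans (add_le_add h1 h2)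
        _ = ENNReal.ofReal ((c + 4 * C) * t ^ (-(1 / 4) : ℝ)) := by
          rw [← ENNReal.ofReal_add (by positivity) (by positivity), add_mul]
        _ ≤ _ := by gcongr
    calc _ = ((∫⁻ s in Set.Ioi t, supNorm (J s + duhamel r s) ^ (4 : ℝ)) ^ (1 / 4 : ℝ))
          ^ (4 : ℝ) := by
          rw [← ENNReal.rpow_mul]
          norm_num
      _ ≤ _ := ENNReal.rpow_le_rpow h3 (by norm_num)

/-- Integration over the future decreases in time, hence the minus sign; this is why the remainder
is defined with its sign reversed. -/
theorem isMildSolution_neg_duhamel {t₀ : ℝ} {r : ℝ → L2} (hr : Integrable r) :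
    IsMildSolution t₀ (duhamel r) fun τ => -r τ := by
  intro T hT
  have hi := integrable_freeGroup_neg hr
  simp_rw [map_neg]
  rw [duhamel, duhamel, freeGroup_neg_apply_self, freeGroup_neg_apply_self,
    intervalIntegral.integral_neg, ← intervalIntegral.integral_Ioi_sub_Ioi' hi.integrableOn
      hi.integrableOn]
  abel

theorem IsMildSolution.add {t₀ : ℝ} {Z Y F G : ℝ → L2} (hZ : IsMildSolution t₀ Z F)
    (hY : IsMildSolution t₀ Y G) (hF : ∀ T, IntegrableOn F (Set.Ioc t₀ T))
    (hG : ∀ T, IntegrableOn G (Set.Ioc t₀ T)) :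
    IsMildSolution t₀ (fun t => Z t + Y t) fun t => F t + G t := by
  intro T hT
  have hi : ∀ {F : ℝ → L2}, (∀ T, IntegrableOn F (Set.Ioc t₀ T)) →
      IntervalIntegrable (fun τ => freeGroup (-τ) (F τ)) volume t₀ T := fun hF =>
    (intervalIntegrable_iff_integrableOn_Ioc_of_le hT).2 (integrable_freeGroup_neg (hF T))
  simp_rw [map_add]
  rw [intervalIntegral.integral_add (hi hF) (hi hG), hZ T hT, hY T hT]
  abel

theorem IsMildSolution.congr {t₀ : ℝ} {Z Y F G : ℝ → L2} (hZ : IsMildSolution t₀ Z F)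
    (hZY : ∀ t, t₀ ≤ t → Z t = Y t) (hFG : ∀ t, t₀ < t → F t = G t) : IsMildSolution t₀ Y G := by
  intro T hT
  rw [← hZY T hT, ← hZY t₀ le_rfl, hZ T hT, intervalIntegral.integral_of_le hT,
    intervalIntegral.integral_of_le hT]
  congr 1
  refine setIntegral_congr_fun measurableSet_Ioc fun τ hτ => ?_
  rw [hFG τ hτ.1]

/-- The fixed point of w = J + duhamel(negRemainder w), J being the conjugate correction. Adding the
Duhamel formulas of the profile, of J and of the remainder reassembles the full forcing. -/
theorem exists_isAdmissible_isMildSolution {σ : ℝ} (hσ : |σ| = 1) {a : ℝ} (ha : 0 ≤ a)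
    {ε t₀ B : ℝ} (hε : 0 ≤ ε) (ht₀ : 0 < t₀) (hB : 0 ≤ B)
    (hρ : contractionFactor a ε t₀ B ≤ 2⁻¹)
    (hsize : 12 * a ^ 2 * ε + 4 * (sourceSize a ε t₀ + contractionFactor a ε t₀ B * B) ≤ B)
    {u : L2} (hu : eLpNorm u 1 volume ≤ ENNReal.ofReal ε) (hu2 : ‖u‖ₑ ≤ ENNReal.ofReal ε) :
    ∃ w, IsAdmissible t₀ B w ∧ IsMildSolution t₀ (perturbedPath σ a t₀ u w)
      (forcing σ a (perturbedPath σ a t₀ u w)) := by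
  obtain ⟨J, hJc, hJ, hJs, hJm⟩ := exists_resonant_correction hσ a hε ht₀ hu
  have hs : 0 ≤ sourceSize a ε t₀ := by rw [sourceSize]; positivity
  have hc : 0 ≤ contractionFactor a ε t₀ B := by rw [contractionFactor]; positivity
  have hint : ∀ {w}, IsAdmissible t₀ B w → Integrable (negRemainder σ a t₀ u w) := fun hw =>
    integrable_negRemainder hσ ha hε ht₀ hB hu hu2 hw
  obtain ⟨w, hw, hfix⟩ := exists_fixedPoint_of_isAdmissible ht₀ hB
    (Γ := fun w t => J t + duhamel (negRemainder σ a t₀ u w) t)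
    (fun w hw => IsAdmissible.add_duhamel ht₀ (by positivity) (by positivity) hsize hJc hJ
      (fun t ht => (hJs t ht).trans (ENNReal.ofReal_le_ofReal (by
        have := ht₀.trans_le ht
        have : 0 ≤ a ^ 2 * ε * t ^ (-(1 / 2) : ℝ) := by positivity
        linarith)))
      (hint hw) fun t ht => lintegral_negRemainder_le hσ ha hε ht₀ hB hu hu2 hw ht)
    (fun w y hw hy δ hδ hwy t ht => by
      have ht0 := ht₀.trans_le ht
      rw [add_sub_add_left_eq_sub, duhamel_sub (hint hw) (hint hy)]
      refine (enorm_duhamel_le _ _).trans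
        ((lintegral_negRemainder_sub_le hσ a hε ht₀ hB hu hw hy hδ hwy ht).trans ?_)
      gcongr)
  refine ⟨w, hw, ?_⟩
  have hi1 : ∀ T, IntegrableOn (fun τ => (Complex.I * ((σ / τ : ℝ) : ℂ)) • (a : ℂ) ^ 2
      • freePart σ a u τ) (Set.Ioc t₀ T) := fun T => by
    refine (ContinuousOn.mono (ContinuousOn.smul (continuousOn_const.mul
      (Complex.continuous_ofReal.comp_continuousOn
      (continuousOn_const.div continuousOn_id fun τ (hτ : τ ∈ Set.Ioi (0 : ℝ)) => ne_of_gt hτ)))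
      ((continuousOn_freePart σ a u).const_smul ((a : ℂ) ^ 2)))
      fun τ hτ => ?_).integrableOn_Icc.mono_set Set.Ioc_subset_Icc_self
    exact ht₀.trans_le hτ.1
  have hi2 : ∀ T, IntegrableOn (conjForcing σ a u) (Set.Ioc t₀ T) := fun T =>
    ((continuousOn_conjForcing σ a u).mono fun τ hτ => ht₀.trans_le hτ.1).integrableOn_Icc.mono_set
      Set.Ioc_subset_Icc_self
  have hm1 : IsMildSolution t₀ (freePart σ a u) fun τ =>
      (Complex.I * ((σ / τ : ℝ) : ℂ)) • (a : ℂ) ^ 2 • freePart σ a u τ :=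
    fun T hT => freePart_mild σ a u ht₀ hT
  have hm := (hm1.add hJm hi1 hi2).add (isMildSolution_neg_duhamel (hint hw))
    (fun T => (hi1 T).add (hi2 T)) fun T => (hint hw).neg.integrableOn
  refine hm.congr (fun t ht => ?_) fun t ht => ?_
  · rw [perturbedPath_of_le ht, ← hfix t ht, add_assoc]
  · rw [negRemainder, Set.indicator_of_mem (show t ∈ Set.Ioi t₀ from ht)]
    abel

/-! ### From perturbations in L² to solutions of the equation -/

section Correspondence

variable {σ a t₀ : ℝ} {u : L2} {v : ℝ → ℝ → ℂ} {w : ℝ → L2}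

theorem ae_eq_add_perturbedPath
    (hvw : ∀ t, t₀ ≤ t → (fun x => v t x - profile σ a u t x) =ᵐ[volume] w t) {t : ℝ}
    (ht : t₀ ≤ t) : v t =ᵐ[volume] fun x => a + perturbedPath σ a t₀ u w t x := by
  rw [perturbedPath_of_le ht]
  filter_upwards [hvw t ht, profile_ae σ a u t, Lp.coeFn_add (freePart σ a u t) (w t)]
    with x h1 h2 h3
  rw [h3, Pi.add_apply, ← h1, h2]
  ring

theorem normL4Linfty_eq (hvw : ∀ t, t₀ ≤ t → (fun x => v t x - profile σ a u t x) =ᵐ[volume] w t)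
    {I : Set ℝ} (hI : MeasurableSet I) (hIt : I ⊆ Set.Ici t₀) :
    normL4Linfty I (fun t x => v t x - profile σ a u t x)
      = (∫⁻ t in I, supNorm (w t) ^ (4 : ℝ)) ^ (1 / 4 : ℝ) := by
  rw [normL4Linfty]
  congr 1
  exact setLIntegral_congr_fun hI fun t ht => by rw [eLpNorm_congr_ae (hvw t (hIt ht))]

theorem isDistributionalSolution_iff_isMildSolution {ε : ℝ} (hσ : |σ| = 1) (ht₀ : 0 < t₀)
    (hε : 0 ≤ ε) (hu : eLpNorm u 1 volume ≤ ENNReal.ofReal ε) (hw : Continuous w)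
    (hw4 : ∫⁻ τ in Set.Ioi t₀, supNorm (w τ) ^ (4 : ℝ) ≠ ∞)
    (hvw : ∀ t, t₀ ≤ t → (fun x => v t x - profile σ a u t x) =ᵐ[volume] w t) :
    IsDistributionalSolution σ a t₀ v ↔ IsMildSolution t₀ (perturbedPath σ a t₀ u w)
      (forcing σ a (perturbedPath σ a t₀ u w)) := by
  have hZ := continuous_perturbedPath (σ := σ) (a := a) (u := u) ht₀ hw
  have hF := integrableOn_forcing (a := a) hσ ht₀ hε hu hw hw4
  rw [isDistributionalSolution_iff hZ (fun t ht => ae_eq_add_perturbedPath hvw ht.le)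
    (ae_supNorm_perturbedPath_ne_top ht₀ hε hu hw hw4) hF]
  exact ⟨fun h => h.isMildSolution hZ hF, fun h => h.isWeakSolution hF⟩

theorem IsAdmissible.isAsymptoticSolution {ε B : ℝ} (hσ : |σ| = 1) (ht₀ : 0 < t₀)
    (hε : 0 ≤ ε) (hB : 0 ≤ B) (hu : eLpNorm u 1 volume ≤ ENNReal.ofReal ε)
    (hw : IsAdmissible t₀ B w)
    (hwm : IsMildSolution t₀ (perturbedPath σ a t₀ u w)
      (forcing σ a (perturbedPath σ a t₀ u w)))
    (hvw : ∀ t, t₀ ≤ t → (fun x => v t x - profile σ a u t x) =ᵐ[volume] w t) :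
    IsAsymptoticSolution σ a t₀ u v where
  solves := (isDistributionalSolution_iff_isMildSolution hσ ht₀ hε hu hw.continuous
    hw.lintegral_ne_top hvw).2 hwm
  continuousInL2 := by
    refine ⟨fun t ht => (Lp.memLp (w t)).ae_eq (hvw t ht).symm, fun t ht => ?_⟩
    have h1 : Tendsto (fun s => edist (w s) (w t)) (𝓝[Set.Ici t₀] t) (𝓝 0) :=
      (tendsto_iff_edist_tendsto_0.1 (hw.continuous.tendsto t)).mono_left nhdsWithin_le_nhds
    refine h1.congr' ?_
    filter_upwards [self_mem_nhdsWithin] with s hs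
    rw [Lp.edist_def]
    refine eLpNorm_congr_ae ?_
    filter_upwards [hvw s hs, hvw t ht] with x h1 h2
    rw [Pi.sub_apply, ← h1, ← h2]
  l4Linfty := by
    rw [normL4Linfty_eq hvw measurableSet_Ici subset_rfl, ← setLIntegral_congr Ioi_ae_eq_Ici]
    exact (ENNReal.rpow_ne_top_of_nonneg (by norm_num) hw.lintegral_ne_top).lt_top
  decay := by
    refine ⟨2 * B, ?_⟩
    filter_upwards [eventually_ge_atTop t₀] with t ht
    have ht0 := ht₀.trans_le ht
    rw [eLpNorm_congr_ae (hvw t ht), ← Lp.enorm_def,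
      normL4Linfty_eq hvw measurableSet_Ioi ((Set.Ioi_subset_Ioi ht).trans Set.Ioi_subset_Ici_self),
      two_mul, add_mul, ENNReal.ofReal_add (by positivity) (by positivity)]
    refine add_le_add (hw.enorm_le t ht) ?_
    refine (ENNReal.rpow_le_rpow (hw.lintegral_le t ht) (by norm_num)).trans (le_of_eq ?_)
    rw [← ENNReal.rpow_mul]
    norm_num

/-- The path is extended to all times by its value at t₀, since the preceding theory works with
paths continuous on the whole line. -/
theorem ContinuousInL2.exists_path {f : ℝ → ℝ → ℂ} (h : ContinuousInL2 t₀ f) :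
    ∃ w : ℝ → L2, Continuous w ∧ ∀ t, t₀ ≤ t → f t =ᵐ[volume] w t := by
  refine ⟨fun t => (h.1 (max t₀ t) (le_max_left _ _)).toLp, ?_, fun t ht => ?_⟩
  · rw [continuous_iff_continuousAt]
    intro t
    rw [ContinuousAt, tendsto_iff_edist_tendsto_0]
    simp_rw [Lp.edist_toLp_toLp]
    refine (h.2 (max t₀ t) (le_max_left _ _)).comp
      (tendsto_nhdsWithin_iff.2 ⟨?_, Eventually.of_forall fun s => Set.mem_Ici.2 (le_max_left _ _)⟩)
    exact (by fun_prop : Continuous fun s : ℝ => max t₀ s).tendsto t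
  · have h1 := (h.1 (max t₀ t) (le_max_left _ _)).coeFn_toLp
    have h2 : f (max t₀ t) = f t := by rw [max_eq_right ht]
    exact (h1.trans h2.eventuallyEq).symm

/-- An arbitrary solution is converted into a mild one with its own decay constant C, which need not
be small; max B C serves both perturbations in the uniqueness theorem. -/
theorem IsAsymptoticSolution.ae_eq {ε B : ℝ} (hσ : |σ| = 1) (ht₀ : 0 < t₀) (hε : 0 ≤ ε)
    (hsmall : 28 * a ^ 2 + 48 * ε ^ 2 / t₀ ≤ 1 / 4)
    (hu : eLpNorm u 1 volume ≤ ENNReal.ofReal ε) (hw : IsAdmissible t₀ B w)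
    (hwm : IsMildSolution t₀ (perturbedPath σ a t₀ u w)
      (forcing σ a (perturbedPath σ a t₀ u w))) (hv : IsAsymptoticSolution σ a t₀ u v) {t : ℝ}
    (ht : t₀ ≤ t) : v t =ᵐ[volume] fun x => a + perturbedPath σ a t₀ u w t x := by
  obtain ⟨y, hy, hvy⟩ := hv.continuousInL2.exists_path
  have hy4 : ∫⁻ τ in Set.Ioi t₀, supNorm (y τ) ^ (4 : ℝ) ≠ ∞ := by
    have h1 := hv.l4Linfty
    rw [normL4Linfty_eq hvy measurableSet_Ici subset_rfl, ← setLIntegral_congr Ioi_ae_eq_Ici] at h1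
    intro h2
    rw [h2, ENNReal.top_rpow_of_pos (by norm_num)] at h1
    exact lt_irrefl _ h1
  have hym := (isDistributionalSolution_iff_isMildSolution hσ ht₀ hε hu hy hy4 hvy).1 hv.solves
  obtain ⟨C, hC⟩ := hv.decay
  have hyC : ∀ᶠ t in atTop, ‖y t‖ₑ ≤ ENNReal.ofReal (max B C * t ^ (-(1 / 4) : ℝ)) := by
    filter_upwards [hC, eventually_ge_atTop t₀] with t h1 h2
    have ht0 := ht₀.trans_le h2
    rw [eLpNorm_congr_ae (hvy t h2), ← Lp.enorm_def] at h1
    refine (le_self_add.trans h1).trans (ENNReal.ofReal_le_ofReal ?_)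
    gcongr
    exact le_max_right _ _
  have hwC : ∀ᶠ t in atTop, ‖w t‖ₑ ≤ ENNReal.ofReal (max B C * t ^ (-(1 / 4) : ℝ)) := by
    filter_upwards [eventually_ge_atTop t₀] with t h2
    have ht0 := ht₀.trans_le h2
    refine (hw.enorm_le t h2).trans (ENNReal.ofReal_le_ofReal ?_)
    gcongr
    exact le_max_left _ _
  have heq := perturbedPath_unique hσ ht₀ hε hsmall hu hw.continuous hy hw.lintegral_ne_top hy4
    hwC hyC hwm hym ht
  have h1 := ae_eq_add_perturbedPath hvy ht
  rw [perturbedPath, ← heq] at h1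
  exact h1

end Correspondence

/-! ### Choice of constants and conclusion -/

theorem exists_smallness_constants {t₀ : ℝ} (ht₀ : 0 < t₀) :
    ∃ B a₀ ε : ℝ, 0 < B ∧ 0 < a₀ ∧ 0 < ε ∧ ∀ a, 0 < a → a < a₀ →
      28 * a ^ 2 + 48 * ε ^ 2 / t₀ ≤ 1 / 4 ∧ contractionFactor a ε t₀ B ≤ 2⁻¹ ∧
      12 * a ^ 2 * ε + 4 * (sourceSize a ε t₀ + contractionFactor a ε t₀ B * B) ≤ B := by
  -- The three terms of the contraction factor are each made at most 1/24: B² = t₀/288 gives 12B²/t₀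
  -- = 1/24, ε² ≤ t₀/1152 gives 48ε²/t₀ ≤ 1/24, and a < 1/26 gives 28a² ≤ 1/24. The total 1/8 turns
  -- 4 · (factor) · B into at most B/2.
  set B := √(t₀ / 288) with hB
  have hB0 : 0 < B := Real.sqrt_pos.2 (by positivity)
  have hB2 : B ^ 2 = t₀ / 288 := Real.sq_sqrt (by positivity)
  set D : ℝ := 12 + 16 * (3 * t₀ ^ (-(1 / 4) : ℝ) + t₀ ^ (-(3 / 4) : ℝ)) with hD
  have hD0 : 0 < D := by positivity
  -- The bound ε ≤ B/(2D) leaves the other B/2 for the source terms, which are at most Dε once a ≤ 1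
  -- and ε ≤ 1.
  set ε := min 1 (min √(t₀ / 1152) (B / (2 * D))) with hεdef
  have hε0 : 0 < ε := lt_min one_pos (lt_min (Real.sqrt_pos.2 (by positivity)) (by positivity))
  have hε1 : ε ≤ 1 := min_le_left _ _
  have hε2 : ε ^ 2 ≤ t₀ / 1152 := by
    rw [← Real.sq_sqrt (show 0 ≤ t₀ / 1152 by positivity)]
    exact pow_le_pow_left₀ hε0.le ((min_le_right _ _).trans (min_le_left _ _)) 2
  have hε3 : D * ε ≤ B / 2 := by
    have : ε ≤ B / (2 * D) := (min_le_right _ _).trans (min_le_right _ _)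
    rw [le_div_iff₀ (by positivity)] at this
    linarith
  refine ⟨B, 1 / 26, ε, hB0, by norm_num, hε0, fun a ha0 ha => ?_⟩
  have ha2 : 28 * a ^ 2 ≤ 1 / 24 := by nlinarith
  have h48 : 48 * ε ^ 2 / t₀ ≤ 1 / 24 := by
    rw [div_le_iff₀ ht₀]
    linarith
  have h12 : 12 * B ^ 2 / t₀ = 1 / 24 := by
    rw [hB2]
    field_simp
    norm_num
  have hρ : contractionFactor a ε t₀ B ≤ 1 / 8 := by
    rw [contractionFactor]
    linarith
  refine ⟨by linarith, by linarith, ?_⟩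
  have hs : 12 * a ^ 2 * ε + 4 * sourceSize a ε t₀ ≤ D * ε := by
    have ha1 : a ≤ 1 := by linarith
    have h1 : a ^ 2 ≤ 1 := by nlinarith
    have h2 : ε ^ 2 ≤ ε := by nlinarith
    rw [sourceSize]
    calc 12 * a ^ 2 * ε + 4 * (4 * (3 * a * t₀ ^ (-(1 / 4) : ℝ) + ε * t₀ ^ (-(3 / 4) : ℝ)) * ε ^ 2)
        ≤ 12 * 1 * ε + 4 * (4 * (3 * 1 * t₀ ^ (-(1 / 4) : ℝ) + 1 * t₀ ^ (-(3 / 4) : ℝ)) * ε) := by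
          gcongr
      _ = D * ε := by rw [hD]; ring
  have h3 : contractionFactor a ε t₀ B * B ≤ 1 / 8 * B := by gcongr
  linarith

end SingularVortex

theorem theorem1p2 (t₀ : ℝ) (ht₀ : 0 < t₀) :
    ∃ a₀ : ℝ, 0 < a₀ ∧ ∃ ε : ℝ, 0 < ε ∧
      ∀ σ : ℝ, (σ = 1 ∨ σ = -1) → ∀ a : ℝ, 0 < a → a < a₀ →
        ∀ u : Lp ℂ 2 (volume : Measure ℝ),
          eLpNorm u 1 volume + eLpNorm u 2 volume < ENNReal.ofReal ε →
            ∃ v : ℝ → ℝ → ℂ, SingularVortex.IsAsymptoticSolution σ a t₀ u v ∧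
              ∀ v' : ℝ → ℝ → ℂ, SingularVortex.IsAsymptoticSolution σ a t₀ u v' →
                ∀ t : ℝ, t₀ ≤ t → v' t =ᵐ[volume] v t := by
  obtain ⟨B, a₀, ε, hB, ha₀, hε, hconst⟩ := SingularVortex.exists_smallness_constants ht₀
  refine ⟨a₀, ha₀, ε, hε, fun σ hσ a ha haa u hu => ?_⟩
  obtain ⟨hsmall, hρ, hsize⟩ := hconst a ha haa
  have hσ1 : |σ| = 1 := by rcases hσ with rfl | rfl <;> simp
  have hu1 : eLpNorm u 1 volume ≤ ENNReal.ofReal ε := le_self_add.trans hu.le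
  have hu2 : ‖u‖ₑ ≤ ENNReal.ofReal ε := by
    rw [Lp.enorm_def]
    exact le_add_self.trans hu.le
  obtain ⟨w, hw, hwm⟩ := SingularVortex.exists_isAdmissible_isMildSolution hσ1 ha.le hε.le ht₀
    hB.le hρ hsize hu1 hu2
  refine ⟨fun t x => a + SingularVortex.perturbedPath σ a t₀ u w t x,
    hw.isAsymptoticSolution hσ1 ht₀ hε.le hB.le hu1 hwm fun t ht => ?_,
    fun v' hv' t ht => hv'.ae_eq hσ1 ht₀ hε.le hsmall hu1 hw hwm ht⟩
  rw [SingularVortex.perturbedPath_of_le ht]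
  filter_upwards [SingularVortex.profile_ae σ a u t,
    Lp.coeFn_add (SingularVortex.freePart σ a u t) (w t)] with x h1 h2
  rw [h1, h2, Pi.add_apply]
  ring
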